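/- **Setting.** Let $p,q\ge 0$ be integers and let $\nu$ be a Borel measure on $\mathbb R^{q}$, symmetric about the origin, which is either finite or satisfies $\int \min(1,\|s\|^{\alpha})\,\nu(ds)<\infty$ for some $\alpha\in(0,2]$. Put $K(z)=\int(1-\cos(z's))\,\nu(ds)$. Let $D=(U,V,Z)$ be a random vector in $\mathbb R\times\mathbb R^{p}\times\mathbb R^{q}$ with law $\mu$, let $D^\dagger=(U^\dagger,V^\dagger,Z^\dagger)$ be an independent copy of $D$, and let $D_1,D_2,\dots$ be i.i.d. with law $\mu$. Define $$\psi(D,D^\dagger)=\tfrac12K(Z-Z^\dagger)(UV^\dagger+U^\dagger V),\quad \psi^{(1)}(D)=\mathbb E[\psi(D,D^\dagger)\mid D],\quad \delta_V=\mathbb E[K(Z-Z^\dagger)VU^\dagger],\quad \Omega_V=4\,\mathrm{Var}(\psi^{(1)}(D)).$$ A law of $(U,V,Z)$ satisfies the *moment condition* with exponent $\varepsilon>0$ if $U$, $V$ and $K(Z-Z^\dagger)VU^\dagger$ are integrable (so that $\mathbb E[U|Z]$, $\mu_V(Z):=\mathbb E[V|Z]$ and $\delta_V$ are defined) and $\mathbb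 E\|\psi(D,D^\dagger)\|^{4+\varepsilon}<\infty$. For a sample $D_1,\dots,D_n$ with $D_i=(U_i,V_i,Z_i)$ let $$\widehat\delta_V=\frac1{n(n-1)}\sum_{i=1}^n\sum_{j\ne i}K(Z_i-Z_j)U_iV_j,\qquad \widehat\psi^{(1)}(D_i)=\frac1{2(n-1)}\sum_{j\neq i}K(Z_i-Z_j)(V_iU_j+V_jU_i),$$ $$\widetilde\Omega_{V,n}=\frac4{n-1}\sum_{i=1}^n[\widehat\psi^{(1)}(D_i)-\widehat\delta_V][\widehat\psi^{(1)}(D_i)-\widehat\delta_V]'=\widetilde\Gamma_n\,\mathrm{diag}(\widetilde\lambda_1,\dots,\widetilde\lambda_p)\,\widetilde\Gamma_n'$$ with $\widetilde\Gamma_n$ orthogonal. Fix $\iota\in(0,1/2)$, let $c_n=n^{-1/2+\iota}$, let $\widehat\Omega_{V,n}$ be obtained from $\widetilde\Omega_{V,n}$ by replacing every eigenvalue $\widetilde\lambda_k\le c_n$ by $0$, let $\widehat\Omega_{V,n}^-$ be its Moore–Penrose inverse, i.e. $\widehat\Omega_{V,n}^-=\widetilde\Gamma_n\,\mathrm{diag}(\widetilde\lambda_k^{-1}\mathbf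 1(\widetilde\lambda_k>c_n))\,\widetilde\Gamma_n'$, and let $T_{V,n}=n\,\widehat\delta_V'\,\widehat\Omega_{V,n}^-\,\widehat\delta_V$. Write $A^-$ for the Moore–Penrose inverse, $\chi^2_r(\theta)$ for the noncentral $\chi^2$ law with $r$ degrees of freedom and noncentrality $\theta$ (the point mass at $0$ if $r=0$), $\chi^2_r=\chi^2_r(0)$, and $\chi^2_{r,t}$ for the $t$-quantile of $\chi^2_r$. **Theorem.** Let $\mu$ satisfy the moment condition with some exponent $\varepsilon>0$. (i) *Null hypothesis.* Suppose that $\mathbb E[U|Z]=0$ a.s. and write $\Omega_{V_o}$ for $\Omega_V$. Then $\widehat\Omega_{V,n}^-\to\Omega_{V_o}^-$ in probability and $T_{V,n}\to\chi^2_{\mathrm{rank}(\Omega_{V_o})}$ in distribution. (ii) *Pitman local alternatives.* Let $\mu$ be the law of a null model $(U^\circ,V^\circ,Z)$, so that $\mathbb E[U^\circ|Z]=0$ a.s., and let $\Omega_{V_o}$ be the matrix $\Omega_V$ of this law. Let $a:\mathbb R^q\to\mathbb R$ and $b:\mathbb R\times\mathbb R^p\times\mathbb R^q\to\mathbb R^p$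 be measurable. At sample size $n$ let the sample consist of $n$ i.i.d. copies of $$U=U^\circ+n^{-1/2}a(Z),\qquad V=V^\circ+n^{-1/2}b(U^\circ,V^\circ,Z),\qquad Z,$$ so that $\mathbb E[U|Z]=n^{-1/2}a(Z)$; here $b=0$ if $V$ does not involve $U$, and $b=a(Z)\,(0,1)'$ for $V=(h(Z),U-h(Z))'$. Assume that for every $n\ge1$ this law satisfies the moment condition with exponent $\varepsilon$, and that $K(Z-Z^\dagger)a(Z^\dagger)V^\circ$ is integrable, and put $a_o=\mathbb E[\mu_{V^\circ}(Z)a(Z^\dagger)K(Z-Z^\dagger)]$ with $\mu_{V^\circ}(Z)=\mathbb E[V^\circ|Z]$. Then $\widehat\Omega_{V,n}^-\to\Omega_{V_o}^-$ in probability, and for every $\alpha\in(0,1)$, with $r=\mathrm{rank}(\Omega_{V_o})$ and $\theta=a_o'\Omega_{V_o}^-a_o$, $$\lim_{n\to\infty}\mathbb P(T_{V,n}>\chi^2_{r,1-\alpha})=\mathbb P\big(\chi^2_r(\theta)>\chi^2_{r,1-\alpha}\big).$$ (iii) *Fixed alternative.* Suppose that $\mathbb E[U|Z]=a(Z)$ a.s.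 for a measurable function $a$ and write $\Omega_{V_a}$ for $\Omega_V$. Then $\widehat\Omega_{V,n}^-\to\Omega_{V_a}^-$ in probability. If moreover $\delta_V\notin\mathcal M_0$, where $\mathcal M_0$ is the eigenspace of $\Omega_{V_a}$ for the eigenvalue $0$, then for every $r\in\{0,1,2,\dots\}$ (in particular for $r=\mathrm{rank}(\Omega_{V_o})$, the rank of $\Omega_V$ under a null law) and every $\alpha\in(0,1)$, $$\lim_{n\to\infty}\mathbb P(T_{V,n}>\chi^2_{r,1-\alpha})=1.$$ -/

import Mathlib

open MeasureTheory ProbabilityTheory Filter Topology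

noncomputable section

namespace GMDD

/-! ### The weighting function `K` -/

/-- Conditions on the integrating measure `ν` on `ℝ^q`: it is symmetric about the origin, and it is
either finite or satisfies `∫ min(1, ‖s‖^α) ν(ds) < ∞` for some `α ∈ (0, 2]`. -/
structure IsIntegratingMeasure {q : ℕ} (ν : Measure (EuclideanSpace ℝ (Fin q))) : Prop where
  symmetric : ν.map (fun s => -s) = ν
  integrability : IsFiniteMeasure ν ∨
    ∃ α : ℝ, 0 < α ∧ α ≤ 2 ∧ ∫⁻ s, ENNReal.ofReal (min 1 (‖s‖ ^ α)) ∂ν < ⊤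

/-- `K(z) = ∫ (1 - cos(z's)) ν(ds)`. -/
def kernelK {q : ℕ} (ν : Measure (EuclideanSpace ℝ (Fin q))) (z : EuclideanSpace ℝ (Fin q)) : ℝ :=
  ∫ s, (1 - Real.cos (inner ℝ z s)) ∂ν

/-! ### Observations `D = (U, V, Z)` -/

/-- The space of values of an observation `D = (U, V, Z) ∈ ℝ × ℝ^p × ℝ^q`. -/
abbrev Obs (p q : ℕ) : Type := ℝ × EuclideanSpace ℝ (Fin p) × EuclideanSpace ℝ (Fin q)

/-- The component `U`. -/
abbrev Obs.U {p q : ℕ} (d : Obs p q) : ℝ := d.1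

/-- The component `V`. -/
abbrev Obs.V {p q : ℕ} (d : Obs p q) : EuclideanSpace ℝ (Fin p) := d.2.1

/-- The component `Z`. -/
abbrev Obs.Z {p q : ℕ} (d : Obs p q) : EuclideanSpace ℝ (Fin q) := d.2.2

/-- The σ-algebra generated by `Z`. -/
abbrev sigmaZ (p q : ℕ) : MeasurableSpace (Obs p q) :=
  MeasurableSpace.comap Obs.Z inferInstance

/-- `E[U | Z]`, when the observation has law `μ`. -/
def condMeanU {p q : ℕ} (μ : Measure (Obs p q)) : Obs p q → ℝ :=
  μ[Obs.U | sigmaZ p q]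

/-- `μ_V(Z) = E[V | Z]`, when the observation has law `μ`. -/
def condMeanV {p q : ℕ} (μ : Measure (Obs p q)) : Obs p q → EuclideanSpace ℝ (Fin p) :=
  μ[Obs.V | sigmaZ p q]

/-- `D 0, D 1, …` are independent random vectors with common law `μ`. -/
structure IsIIDSample {Ω : Type*} [MeasurableSpace Ω] {p q : ℕ} (P : Measure Ω)
    (D : ℕ → Ω → Obs p q) (μ : Measure (Obs p q)) : Prop where
  measurable : ∀ i, Measurable (D i)
  indep : iIndepFun D P
  law : ∀ i, P.map (D i) = μ

/-! ### Population quantities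

Everywhere `D` and `D†` are independent with law `μ`, i.e. `(D, D†)` has law `μ.prod μ`. -/

section Population

variable {p q : ℕ} (K : EuclideanSpace ℝ (Fin q) → ℝ)

/-- The symmetrized kernel `ψ(D, D†) = ½ K(Z - Z†) (U V† + U† V)`. -/
def psi (d e : Obs p q) : EuclideanSpace ℝ (Fin p) :=
  ((1 / 2 : ℝ) * K (d.Z - e.Z)) • (d.U • e.V + e.U • d.V)

/-- `δ_V = E[K(Z - Z†) V U†]`. -/
def delta (μ : Measure (Obs p q)) : EuclideanSpace ℝ (Fin p) :=
  ∫ x, (K (x.1.Z - x.2.Z) * x.2.U) • x.1.V ∂(μ.prod μ)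

/-- `ψ⁽¹⁾(d) = E[ψ(D, D†) | D = d]`. -/
def psi1 (μ : Measure (Obs p q)) (d : Obs p q) : EuclideanSpace ℝ (Fin p) :=
  ∫ e, psi K d e ∂μ

/-- `Ω_V = 4 Var(ψ⁽¹⁾(D))`, four times a covariance matrix. -/
def omegaV (μ : Measure (Obs p q)) : Matrix (Fin p) (Fin p) ℝ :=
  Matrix.of fun k l => 4 * cov[fun d => psi1 K μ d k, fun d => psi1 K μ d l; μ]

theorem omegaV_isHermitian (μ : Measure (Obs p q)) : (omegaV K μ).IsHermitian := by
  ext k l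
  simp [omegaV, covariance_comm]

/-- `a_o = E[μ_V(Z) a(Z†) K(Z - Z†)]`. -/
def aO (a : EuclideanSpace ℝ (Fin q) → ℝ) (μ : Measure (Obs p q)) : EuclideanSpace ℝ (Fin p) :=
  ∫ x, (K (x.1.Z - x.2.Z) * a x.2.Z) • condMeanV μ x.1 ∂(μ.prod μ)

/-- The moment conditions on the law `μ` of `(U, V, Z)`: the means of `U` and `V` exist (so that
`E[U | Z]` and `E[V | Z]` are defined), the expectation that defines `δ_V` exists, and
`E ‖ψ(D, D†)‖^(4 + ε) < ∞`. -/
structure MomentCondition (ε : ℝ) (μ : Measure (Obs p q)) : Prop where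
  integrable_U : Integrable Obs.U μ
  integrable_V : Integrable Obs.V μ
  integrable_delta :
    Integrable (fun x : Obs p q × Obs p q => (K (x.1.Z - x.2.Z) * x.2.U) • x.1.V) (μ.prod μ)
  moment : ∫⁻ x, ‖psi K x.1 x.2‖ₑ ^ (4 + ε) ∂(μ.prod μ) < ⊤

end Population

/-! ### Hypotheses on the conditional mean (`E U` is known and has been subtracted) -/

/-- The null hypothesis: `E[U | Z] = 0` almost surely. -/
def NullHypothesis {p q : ℕ} (μ : Measure (Obs p q)) : Prop :=
  condMeanU μ =ᵐ[μ] 0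

/-- The fixed alternative: `E[U | Z] = a(Z)` almost surely. -/
def FixedAlternative {p q : ℕ} (a : EuclideanSpace ℝ (Fin q) → ℝ) (μ : Measure (Obs p q)) : Prop :=
  condMeanU μ =ᵐ[μ] fun d => a d.Z

/-- The observation at sample size `n` under the Pitman local alternatives, obtained from an
observation `d = (U°, V°, Z)` of the null model:
`(U° + n^{-1/2} a(Z), V° + n^{-1/2} b(d), Z)`. -/
def localShift {p q : ℕ} (a : EuclideanSpace ℝ (Fin q) → ℝ)
    (b : Obs p q → EuclideanSpace ℝ (Fin p)) (n : ℕ) (d : Obs p q) : Obs p q :=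
  (d.U + (n : ℝ) ^ (-(1 / 2) : ℝ) * a d.Z, d.V + (n : ℝ) ^ (-(1 / 2) : ℝ) • b d, d.Z)

/-- Under the local alternatives at sample size `n`, indeed `E[U | Z] = n^{-1/2} a(Z)`. -/
theorem condMeanU_map_localShift {p q : ℕ} {a : EuclideanSpace ℝ (Fin q) → ℝ}
    {b : Obs p q → EuclideanSpace ℝ (Fin p)} (ha : Measurable a) (hb : Measurable b) (n : ℕ)
    (μ : Measure (Obs p q)) [IsProbabilityMeasure μ] (hμ : NullHypothesis μ)
    (hU : Integrable Obs.U μ) (haU : Integrable (fun d : Obs p q => a d.Z) μ) :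
    condMeanU (μ.map (localShift a b n)) =ᵐ[μ.map (localShift a b n)]
      fun d => (n : ℝ) ^ (-(1 / 2) : ℝ) * a d.Z := by
  have hs : Measurable (localShift a b n : Obs p q → Obs p q) := by
    unfold localShift; fun_prop
  have hZ : sigmaZ p q ≤ (inferInstance : MeasurableSpace (Obs p q)) :=
    Measurable.comap_le (by fun_prop)
  have hZa : Measurable[sigmaZ p q] (fun d : Obs p q => a d.Z) :=
    ha.comp (comap_measurable _)
  have : IsProbabilityMeasure (μ.map (localShift a b n : Obs p q → Obs p q)) :=
    Measure.isProbabilityMeasure_map hs.aemeasurable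
  have hg : Measurable (fun d : Obs p q => (n : ℝ) ^ (-(1 / 2) : ℝ) * a d.Z) := by fun_prop
  have hgi : Integrable (fun d : Obs p q => (n : ℝ) ^ (-(1 / 2) : ℝ) * a d.Z)
      (μ.map (localShift a b n)) := by
    rw [integrable_map_measure hg.aestronglyMeasurable hs.aemeasurable]
    exact haU.const_mul _
  have hUi : Integrable (Obs.U : Obs p q → ℝ) (μ.map (localShift a b n)) := by
    rw [integrable_map_measure (by fun_prop) hs.aemeasurable]
    exact hU.add (haU.const_mul _)
  symm
  refine ae_eq_condExp_of_forall_setIntegral_eq hZ hUi (fun _ _ _ => hgi.integrableOn) ?_ ?_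
  · rintro s hs' -
    obtain ⟨t, ht, rfl⟩ := hs'
    have ht' : MeasurableSet[sigmaZ p q] ((Obs.Z : Obs p q → _) ⁻¹' t) := ⟨t, ht, rfl⟩
    have h0 : ∫ d in (Obs.Z : Obs p q → _) ⁻¹' t, d.U ∂μ = 0 := by
      rw [← setIntegral_condExp hZ hU ht']
      exact (integral_congr_ae (ae_restrict_of_ae hμ)).trans (by simp)
    rw [setIntegral_map (hZ _ ht') hg.aestronglyMeasurable hs.aemeasurable,
      setIntegral_map (hZ _ ht') (by fun_prop) hs.aemeasurable]
    change ∫ d in (Obs.Z : Obs p q → _) ⁻¹' t, (n : ℝ) ^ (-(1 / 2) : ℝ) * a d.Z ∂μ =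
      ∫ d in (Obs.Z : Obs p q → _) ⁻¹' t, (d.U + (n : ℝ) ^ (-(1 / 2) : ℝ) * a d.Z) ∂μ
    rw [integral_add hU.integrableOn (haU.const_mul _).integrableOn, h0, zero_add]
  · exact (hZa.const_mul _).aestronglyMeasurable

/-! ### Moore–Penrose inverses and eigenvalue thresholding of symmetric matrices -/

section Spectral

variable {p : ℕ} {A : Matrix (Fin p) (Fin p) ℝ}

/-- `Γ diag(f(λ₁), …, f(λ_p)) Γ'`, where `A = Γ diag(λ₁, …, λ_p) Γ'` is an orthogonal
diagonalization of the symmetric matrix `A`. -/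
def spectralMap (f : ℝ → ℝ) (hA : A.IsHermitian) : Matrix (Fin p) (Fin p) ℝ :=
  (hA.eigenvectorUnitary : Matrix (Fin p) (Fin p) ℝ) *
    Matrix.diagonal (fun i => f (hA.eigenvalues i)) *
    (hA.eigenvectorUnitary : Matrix (Fin p) (Fin p) ℝ).transpose

/-- The Moore–Penrose inverse `A⁻` of a symmetric matrix: nonzero eigenvalues are inverted, zero
eigenvalues are kept (recall `0⁻¹ = 0`). -/
def mpInverse (hA : A.IsHermitian) : Matrix (Fin p) (Fin p) ℝ :=
  spectralMap (fun t => t⁻¹) hA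

/-- The regularized matrix: the eigenvalues that are not larger than `c` are replaced by `0`. -/
def thresholded (c : ℝ) (hA : A.IsHermitian) : Matrix (Fin p) (Fin p) ℝ :=
  spectralMap (fun t => if c < t then t else 0) hA

/-- The Moore–Penrose inverse of the regularized matrix `thresholded c hA`. -/
def thresholdedInv (c : ℝ) (hA : A.IsHermitian) : Matrix (Fin p) (Fin p) ℝ :=
  spectralMap (fun t => if c < t then t⁻¹ else 0) hA

/-- The four Penrose equations. -/
structure IsMoorePenrose (A B : Matrix (Fin p) (Fin p) ℝ) : Prop where
  mul_mul_left : A * B * A = A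
  mul_mul_right : B * A * B = B
  symm_left : (A * B).transpose = A * B
  symm_right : (B * A).transpose = B * A

theorem spectralMap_mul (f g : ℝ → ℝ) (hA : A.IsHermitian) :
    spectralMap f hA * spectralMap g hA = spectralMap (fun t => f t * g t) hA := by
  have h : (hA.eigenvectorUnitary : Matrix (Fin p) (Fin p) ℝ).transpose *
      (hA.eigenvectorUnitary : Matrix (Fin p) (Fin p) ℝ) = 1 := by
    have := Unitary.coe_star_mul_self hA.eigenvectorUnitary
    simpa [Matrix.star_eq_conjTranspose, Matrix.conjTranspose_eq_transpose_of_trivial] using this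
  unfold spectralMap
  calc _ = (hA.eigenvectorUnitary : Matrix (Fin p) (Fin p) ℝ) *
          Matrix.diagonal (fun i => f (hA.eigenvalues i)) *
          ((hA.eigenvectorUnitary : Matrix (Fin p) (Fin p) ℝ).transpose *
          (hA.eigenvectorUnitary : Matrix (Fin p) (Fin p) ℝ)) *
          Matrix.diagonal (fun i => g (hA.eigenvalues i)) *
          (hA.eigenvectorUnitary : Matrix (Fin p) (Fin p) ℝ).transpose := by
        simp only [Matrix.mul_assoc]
    _ = _ := by
        rw [h, Matrix.mul_one, Matrix.mul_assoc _ (Matrix.diagonal _) (Matrix.diagonal _),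
          Matrix.diagonal_mul_diagonal]

theorem spectralMap_transpose (f : ℝ → ℝ) (hA : A.IsHermitian) :
    (spectralMap f hA).transpose = spectralMap f hA := by
  simp [spectralMap, Matrix.transpose_mul, Matrix.mul_assoc]

theorem spectralMap_id (hA : A.IsHermitian) : spectralMap (fun t => t) hA = A := by
  conv_rhs => rw [hA.spectral_theorem]
  simp [spectralMap, Unitary.conjStarAlgAut_apply, Matrix.star_eq_conjTranspose,
    Matrix.conjTranspose_eq_transpose_of_trivial]

theorem isMoorePenrose_spectralMap (f g : ℝ → ℝ) (hA : A.IsHermitian) (hfg : ∀ t, g t = (f t)⁻¹) :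
    IsMoorePenrose (spectralMap f hA) (spectralMap g hA) := by
  obtain rfl : g = fun t => (f t)⁻¹ := funext hfg
  refine ⟨?_, ?_, ?_, ?_⟩
  · rw [spectralMap_mul, spectralMap_mul]
    congr 1; funext t; exact mul_inv_mul_cancel (f t)
  · rw [spectralMap_mul, spectralMap_mul]
    congr 1; funext t; simpa using mul_inv_mul_cancel (f t)⁻¹
  · rw [spectralMap_mul, spectralMap_transpose]
  · rw [spectralMap_mul, spectralMap_transpose]

theorem isMoorePenrose_mpInverse (hA : A.IsHermitian) : IsMoorePenrose A (mpInverse hA) := by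
  have h := isMoorePenrose_spectralMap (fun t => t) (fun t => t⁻¹) hA (fun _ => rfl)
  rwa [spectralMap_id] at h

theorem isMoorePenrose_thresholdedInv (c : ℝ) (hA : A.IsHermitian) :
    IsMoorePenrose (thresholded c hA) (thresholdedInv c hA) :=
  isMoorePenrose_spectralMap _ _ hA (fun t => by split_ifs <;> simp)

end Spectral

/-! ### Sample quantities

A sample is a sequence `x 0, x 1, …` of observations; at sample size `n` only `x 0, …, x (n - 1)`
are used. -/

section Sample

variable {p q : ℕ} (K : EuclideanSpace ℝ (Fin q) → ℝ)

/-- `δ̂_V = (n(n-1))⁻¹ ∑_i ∑_{j ≠ i} K(Z_i - Z_j) U_i V_j`. -/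
def deltaHat (n : ℕ) (x : ℕ → Obs p q) : EuclideanSpace ℝ (Fin p) :=
  (1 / ((n : ℝ) * ((n : ℝ) - 1))) • ∑ i ∈ Finset.range n, ∑ j ∈ (Finset.range n).erase i,
    (K ((x i).Z - (x j).Z) * (x i).U) • (x j).V

/-- `ψ̂⁽¹⁾(D_i) = (2(n-1))⁻¹ ∑_{j ≠ i} K(Z_i - Z_j) (V_i U_j + V_j U_i)`. -/
def psiHat (n : ℕ) (x : ℕ → Obs p q) (i : ℕ) : EuclideanSpace ℝ (Fin p) :=
  (1 / (2 * ((n : ℝ) - 1))) • ∑ j ∈ (Finset.range n).erase i,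
    K ((x i).Z - (x j).Z) • ((x j).U • (x i).V + (x i).U • (x j).V)

/-- `Ω̃_{V,n} = 4/(n-1) ∑_i [ψ̂⁽¹⁾(D_i) - δ̂_V] [ψ̂⁽¹⁾(D_i) - δ̂_V]'`. -/
def omegaTilde (n : ℕ) (x : ℕ → Obs p q) : Matrix (Fin p) (Fin p) ℝ :=
  Matrix.of fun k l => (4 / ((n : ℝ) - 1)) * ∑ i ∈ Finset.range n,
    (psiHat K n x i k - deltaHat K n x k) * (psiHat K n x i l - deltaHat K n x l)

theorem omegaTilde_isHermitian (n : ℕ) (x : ℕ → Obs p q) : (omegaTilde K n x).IsHermitian := by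
  ext k l
  simp [omegaTilde, mul_comm]

/-- `Ω̂⁻_{V,n}`: the Moore–Penrose inverse of the matrix obtained from `Ω̃_{V,n}` by thresholding
its eigenvalues at `c_n = n^{-1/2+ι}`. -/
def omegaHatInv (ι : ℝ) (n : ℕ) (x : ℕ → Obs p q) : Matrix (Fin p) (Fin p) ℝ :=
  thresholdedInv ((n : ℝ) ^ (-(1 / 2) + ι : ℝ)) (omegaTilde_isHermitian K n x)

/-- The quadratic form `v' A v`. -/
def quadForm (A : Matrix (Fin p) (Fin p) ℝ) (v : EuclideanSpace ℝ (Fin p)) : ℝ :=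
  ∑ k, ∑ l, v k * A k l * v l

/-- The regularized Wald statistic `T_{V,n} = n δ̂_V' Ω̂⁻_{V,n} δ̂_V`. -/
def waldStat (ι : ℝ) (n : ℕ) (x : ℕ → Obs p q) : ℝ :=
  n * quadForm (omegaHatInv K ι n x) (deltaHat K n x)

end Sample

/-! ### Chi-squared laws -/

/-- The noncentral `χ²_r(θ)` law: the law of `∑_{k<r} (ξ_k + m_k)²` with `ξ_k` independent standard
normal and `∑_k m_k² = θ`; we take all `m_k` equal. For `r = 0` it is the point mass at `0`. -/
def ncChiSq (r : ℕ) (θ : ℝ) : Measure ℝ :=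
  (Measure.pi fun _ : Fin r => gaussianReal 0 1).map
    fun ξ => ∑ k, (ξ k + Real.sqrt (θ / r)) ^ 2

/-- The central `χ²_r` law. -/
def chiSq (r : ℕ) : Measure ℝ :=
  (Measure.pi fun _ : Fin r => gaussianReal 0 1).map fun ξ => ∑ k, ξ k ^ 2

instance (r : ℕ) : IsProbabilityMeasure (chiSq r) :=
  Measure.isProbabilityMeasure_map
    (by exact (show Measurable fun ξ : Fin r → ℝ => ∑ k, ξ k ^ 2 by fun_prop).aemeasurable)

/-- `χ²_{r,t}`, the `t`-quantile of the `χ²_r` law. -/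
def chiSqQuantile (r : ℕ) (t : ℝ) : ℝ :=
  sInf {y : ℝ | t ≤ cdf (chiSq r) y}

end GMDD

end

/-!
The statistic `T_{V,n}` is a Wald statistic built on U-statistics of order two, and everything is
reduced to the kernel `ψ` and its first projection `ψ⁽¹⁾`: `δ̂_V` is the U-statistic of `ψ`,
`ψ̂⁽¹⁾(D_i)` are its row means, and `Ω̃_{V,n}` is four times their sample covariance matrix.

*Rates.* For a symmetric kernel in `L⁴`, orthogonality of the degenerate parts gives the Hoeffding
decomposition with a remainder that is `O(n⁻¹)` in `L²`
(`SymmL4.exists_integral_hoeffding_remainder_sq_le`), and it shows that the row means are within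
`O(n^{-1/2})` of the projection in `L²`. By Cauchy–Schwarz, `Ω̃_{V,n} - Ω_V` is `O(n^{-1/2})` in
`L¹` (`SymmL4.l1Rate_rowCov`), which by Markov's inequality is of smaller order than the threshold
`c_n = n^{-1/2+ι}`.

*Thresholding.* In the eigenbases of two symmetric matrices `A` and `B`, the squared Frobenius norm
of `f(A) - g(B)` is a weighted sum of `(f(λ_i) - g(μ_j))²` with the same weights as `‖A - B‖²`
(`frobSq_spectralMap_sub`). Hence, when `‖A - B‖ < c` and `c` is at most half the smallest positive
eigenvalue of `B ≥ 0`, inverting the eigenvalues of `A` above `c` is a Lipschitz perturbation of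
`B⁻` (`frobSq_thresholdedInv_sub_mpInverse_le`), and `Ω̂⁻_{V,n}` converges in probability to `Ω_V⁻`
although the rank of `Ω_V` is arbitrary (`tendstoInMeasure_thresholdedInv`).

*Local alternatives.* The kernel `ψ` of the shifted sample is `ψ + n^{-1/2} ψ₁ + n⁻¹ ψ₂` evaluated
at the null sample. The moment conditions at the null law and at sample sizes `1` and `4` bound the
coefficients `ψ₁` and `ψ₂` in `L⁴`. The quadratic term is negligible; the linear term does not
affect the limit of `Ω̃_{V,n}`, and its U-statistic converges to `E ψ₁`, which is `a_o` because
`E[K(Z - Z†) U† g(D)] = 0` under the null hypothesis (`kmean_psiLin`). With the central limit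
theorem for the projection, `√n δ̂_V` converges to a Gaussian vector with mean `a_o` and covariance
matrix `Ω_V` (`tendstoInDistribution_deltaHat`). The null hypothesis itself is the case
`a = 0`, `b = 0`.

*Limit laws.* Factor `Ω_V = M M'` and `Ω_V⁻ = N N'` with `rank Ω_V` columns and `N' M = 1`. Then the
limit of `T_{V,n}` is `‖N'(M ξ + a_o)‖² = ‖ξ + N' a_o‖²` with `ξ` standard Gaussian, a noncentral
`χ²` variable by rotational invariance (`tendstoInDistribution_wald`); the component of `a_o` outside
the range of `Ω_V` plays no role. The law has no atoms unless the rank is zero, in which case `Ω̂⁻_{V,n}`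
vanishes with probability tending to one. Under a fixed alternative with `δ_V` outside the kernel of
`Ω_V`, `T_{V,n} / n` converges to `δ_V' Ω_V⁻ δ_V > 0` (`tendsto_measure_lt_wald`).
-/

namespace GMDD

set_option linter.unusedSectionVars false

/-! ### Second moments of sums over a sample -/

section UStat

variable {Ω X : Type*} [MeasurableSpace Ω] [MeasurableSpace X] {P : Measure Ω}
  [IsProbabilityMeasure P] {μ : Measure X} [IsProbabilityMeasure μ] {D : ℕ → Ω → X}

/-- The row mean `(n-1)⁻¹ ∑_{j ≠ i} f(x_i, x_j)` of a kernel `f` along a sample. -/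
noncomputable def rowMean (f : X → X → ℝ) (n : ℕ) (x : ℕ → X) (i : ℕ) : ℝ :=
  (1 / ((n : ℝ) - 1)) * ∑ j ∈ (Finset.range n).erase i, f (x i) (x j)

/-- The U-statistic of order two with kernel `f`, written as the mean of the row means. -/
noncomputable def uStat (f : X → X → ℝ) (n : ℕ) (x : ℕ → X) : ℝ :=
  (1 / (n : ℝ)) * ∑ i ∈ Finset.range n, rowMean f n x i

/-- Four times the sample covariance of the row means of two kernels. -/
noncomputable def rowCov (f g : X → X → ℝ) (n : ℕ) (x : ℕ → X) : ℝ :=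
  (4 / ((n : ℝ) - 1)) * ∑ i ∈ Finset.range n,
    (rowMean f n x i - uStat f n x) * (rowMean g n x i - uStat g n x)

/-- The first projection `f⁽¹⁾(d) = ∫ f(d, e) μ(de)` of a kernel. -/
noncomputable def proj (μ : Measure X) (f : X → X → ℝ) (d : X) : ℝ := ∫ e, f d e ∂μ

/-- The mean `∫∫ f(d, e) μ(de) μ(dd)` of a kernel. -/
noncomputable def kmean (μ : Measure X) (f : X → X → ℝ) : ℝ := ∫ d, proj μ f d ∂μ

/-- Symmetric measurable kernels that are in `L⁴(μ ⊗ μ)`. -/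
structure SymmL4 (μ : Measure X) (f : X → X → ℝ) : Prop where
  measurable : Measurable (fun x : X × X => f x.1 x.2)
  symm : ∀ d e, f d e = f e d
  memLp : MemLp (fun x : X × X => f x.1 x.2) 4 (μ.prod μ)

/-- `D 0, D 1, …` are independent with common law `μ`, for observations in an arbitrary
measurable space. -/
structure IIDSeq (P : Measure Ω) (D : ℕ → Ω → X) (μ : Measure X) : Prop where
  measurable : ∀ i, Measurable (D i)
  indep : iIndepFun D P
  law : ∀ i, P.map (D i) = μ

lemma IIDSeq.measurePreserving (hD : IIDSeq P D μ) (i : ℕ) : MeasurePreserving (D i) P μ :=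
  ⟨hD.measurable i, hD.law i⟩

lemma IIDSeq.measurePreserving_pair (hD : IIDSeq P D μ) {i j : ℕ} (hij : i ≠ j) :
    MeasurePreserving (fun ω => (D i ω, D j ω)) P (μ.prod μ) := by
  refine ⟨(hD.measurable i).prodMk (hD.measurable j), ?_⟩
  rw [(indepFun_iff_map_prod_eq_prod_map_map (hD.measurable i).aemeasurable
    (hD.measurable j).aemeasurable).1 (hD.indep.indepFun hij), hD.law, hD.law]

/-- A kernel whose first projection vanishes, evaluated at `(D_i, D_j)`, is orthogonal to every
function of observations other than `D_j`: integrate `D_j` out first. -/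
lemma IIDSeq.integral_mul_eq_zero (hD : IIDSeq P D μ) {g G : X × X → ℝ} (hg : Measurable g)
    (hG : Measurable G) (h0 : ∀ᵐ d ∂μ, ∫ e, g (d, e) ∂μ = 0) {i j k l : ℕ}
    (hi : j ≠ i) (hk : j ≠ k) (hl : j ≠ l) :
    ∫ ω, g (D i ω, D j ω) * G (D k ω, D l ω) ∂P = 0 := by
  have hm := hD.measurable
  set W : Ω → X × X × X := fun ω => (D i ω, D k ω, D l ω) with hW
  have hWm : Measurable W := by fun_prop
  have hind : IndepFun W (D j) P := by
    have h := hD.indep.indepFun_finset {i, k, l} {j} (by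
      simp [hi, hk, hl]) hm
    have hφ : Measurable (fun u : ((a : ({i, k, l} : Finset ℕ)) → X) =>
      ((u ⟨i, by simp⟩, u ⟨k, by simp⟩, u ⟨l, by simp⟩) : X × X × X)) := by fun_prop
    have hψ : Measurable (fun u : ((a : ({j} : Finset ℕ)) → X) => u ⟨j, by simp⟩) := by fun_prop
    exact h.comp hφ hψ
  have hmap := (indepFun_iff_map_prod_eq_prod_map_map hWm.aemeasurable
    (hm j).aemeasurable).1 hind
  rw [hD.law] at hmap
  have hφm : Measurable (fun u : (X × X × X) × X => g (u.1.1, u.2) * G u.1.2) := by fun_prop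
  have e1 : ∫ ω, g (D i ω, D j ω) * G (D k ω, D l ω) ∂P
      = ∫ u, g (u.1.1, u.2) * G u.1.2 ∂((P.map W).prod μ) := by
    rw [← hmap, integral_map (by fun_prop) hφm.aestronglyMeasurable]
  rw [e1]
  have : IsProbabilityMeasure (P.map W) := Measure.isProbabilityMeasure_map hWm.aemeasurable
  by_cases hint : Integrable (fun u : (X × X × X) × X => g (u.1.1, u.2) * G u.1.2)
      ((P.map W).prod μ)
  · rw [integral_prod _ hint]
    simp only [integral_mul_const]
    have h0' : ∀ᵐ w ∂(P.map W), ∫ e, g (w.1, e) ∂μ = 0 := by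
      rw [ae_map_iff hWm.aemeasurable]
      · have := (hD.measurePreserving i).quasiMeasurePreserving.ae h0
        simpa [W] using this
      · have : StronglyMeasurable (fun d : X => ∫ e, g (d, e) ∂μ) :=
          StronglyMeasurable.integral_prod_right (f := fun d e => g (d, e)) hg.stronglyMeasurable
        exact (this.measurable.comp measurable_fst) (measurableSet_singleton 0)
    refine integral_eq_zero_of_ae ?_
    filter_upwards [h0'] with w hw
    simp [hw]
  · exact integral_undef hint

lemma integral_sum_sq {ι : Type*} (s : Finset ι) (Y : ι → Ω → ℝ)
    (hY : ∀ i ∈ s, MemLp (Y i) 2 P) :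
    ∫ ω, (∑ i ∈ s, Y i ω) ^ 2 ∂P = ∑ i ∈ s, ∑ j ∈ s, ∫ ω, Y i ω * Y j ω ∂P := by
  simp_rw [pow_two, Finset.sum_mul_sum]
  rw [integral_finsetSum]
  · refine Finset.sum_congr rfl fun i hi => ?_
    rw [integral_finsetSum]
    exact fun j hj => (hY i hi).integrable_mul (hY j hj)
  · exact fun i hi => integrable_finsetSum _ fun j hj => (hY i hi).integrable_mul (hY j hj)

lemma integral_sum_sq_le_of_orthogonal {ι : Type*} [DecidableEq ι] (s : Finset ι) (Y : ι → Ω → ℝ)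
    (hY : ∀ i ∈ s, MemLp (Y i) 2 P)
    (h0 : ∀ i ∈ s, ∀ j ∈ s, i ≠ j → ∫ ω, Y i ω * Y j ω ∂P = 0) {v : ℝ}
    (hv : ∀ i ∈ s, ∫ ω, Y i ω ^ 2 ∂P ≤ v) :
    ∫ ω, (∑ i ∈ s, Y i ω) ^ 2 ∂P ≤ s.card * v := by
  rw [integral_sum_sq s Y hY, ← nsmul_eq_mul]
  refine Finset.sum_le_card_nsmul _ _ _ fun i hi => ?_
  rw [Finset.sum_eq_single_of_mem i hi fun j hj hji => h0 i hi j hj hji.symm]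
  simpa [pow_two] using hv i hi

/-! ### Projections of kernels -/

variable {f g : X → X → ℝ}

lemma SymmL4.integrable (hf : SymmL4 μ f) :
    Integrable (fun x : X × X => f x.1 x.2) (μ.prod μ) :=
  hf.memLp.integrable (by norm_num)

lemma SymmL4.measurable_proj (hf : SymmL4 μ f) : Measurable (proj μ f) :=
  (StronglyMeasurable.integral_prod_right (f := fun d e => f d e)
    hf.measurable.stronglyMeasurable).measurable

lemma SymmL4.memLp_proj (hf : SymmL4 μ f) : MemLp (proj μ f) 4 μ := by
  refine ⟨hf.measurable_proj.aestronglyMeasurable, ?_⟩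
  have h4 := hf.memLp.2
  rw [eLpNorm_lt_top_iff_lintegral_rpow_enorm_lt_top (by norm_num) (by norm_num)] at h4 ⊢
  refine lt_of_le_of_lt ?_ h4
  rw [lintegral_prod _ (by have := hf.measurable; fun_prop)]
  refine lintegral_mono fun d => ?_
  have hd : Measurable (f d) := hf.measurable.comp measurable_prodMk_left
  have h1 : ‖proj μ f d‖ₑ ≤ eLpNorm (f d) 4 μ := by
    refine (enorm_integral_le_lintegral_enorm _).trans ?_
    rw [← eLpNorm_one_eq_lintegral_enorm]
    exact eLpNorm_le_eLpNorm_of_exponent_le (by norm_num) hd.aestronglyMeasurable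
  rw [eLpNorm_eq_lintegral_rpow_enorm_toReal (by norm_num) (by norm_num)] at h1
  refine (ENNReal.rpow_le_rpow h1 (by norm_num)).trans ?_
  rw [← ENNReal.rpow_mul]
  simp

variable {n : ℕ}

lemma SymmL4.memLp_pair (hf : SymmL4 μ f) (hD : IIDSeq P D μ) {i j : ℕ} (hij : i ≠ j) :
    MemLp (fun ω => f (D i ω) (D j ω)) 4 P :=
  hf.memLp.comp_measurePreserving (hD.measurePreserving_pair hij)

lemma SymmL4.memLp_proj_comp (hf : SymmL4 μ f) (hD : IIDSeq P D μ) (i : ℕ) :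
    MemLp (fun ω => proj μ f (D i ω)) 4 P :=
  hf.memLp_proj.comp_measurePreserving (hD.measurePreserving i)

lemma SymmL4.memLp_rowMean (hf : SymmL4 μ f) (hD : IIDSeq P D μ) (n i : ℕ) :
    MemLp (fun ω => rowMean f n (fun j => D j ω) i) 4 P := by
  unfold rowMean
  have h : MemLp (fun ω => ∑ j ∈ (Finset.range n).erase i, f (D i ω) (D j ω)) 4 P :=
    memLp_finsetSum _ fun j hj => hf.memLp_pair hD (Finset.ne_of_mem_erase hj).symm
  exact h.const_mul _

lemma SymmL4.memLp_uStat (hf : SymmL4 μ f) (hD : IIDSeq P D μ) (n : ℕ) :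
    MemLp (fun ω => uStat f n (fun j => D j ω)) 4 P := by
  unfold uStat
  have h : MemLp (fun ω => ∑ i ∈ Finset.range n, rowMean f n (fun j => D j ω) i) 4 P :=
    memLp_finsetSum _ fun j _ => hf.memLp_rowMean hD n j
  exact h.const_mul _

lemma integral_sq_comp_pair (hD : IIDSeq P D μ) {i j : ℕ} (hij : i ≠ j) {g : X × X → ℝ}
    (hg : Measurable g) :
    ∫ ω, g (D i ω, D j ω) ^ 2 ∂P = ∫ x, g x ^ 2 ∂(μ.prod μ) := by
  rw [← (hD.measurePreserving_pair hij).map_eq, integral_map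
    (hD.measurePreserving_pair hij).measurable.aemeasurable
    (hg.pow_const 2).aestronglyMeasurable]

/-- The row means are within `O(n^{-1/2})` of the first projection in `L²`: given `D_i`, the
summands of a row are independent with mean `f⁽¹⁾(D_i)`. -/
lemma SymmL4.exists_integral_rowMean_sub_sq_le (hf : SymmL4 μ f) (hD : IIDSeq P D μ) :
    ∃ C, 0 ≤ C ∧ ∀ n, 2 ≤ n → ∀ i < n,
      ∫ ω, (rowMean f n (fun j => D j ω) i - proj μ f (D i ω)) ^ 2 ∂P ≤ C / n := by
  set g : X × X → ℝ := fun x => f x.1 x.2 - proj μ f x.1 with hg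
  have hfm := hf.measurable
  have hpm := hf.measurable_proj
  have hgm : Measurable g := hfm.sub (hpm.comp measurable_fst)
  have hg0 : ∀ᵐ d ∂μ, ∫ e, g (d, e) ∂μ = 0 := by
    filter_upwards [hf.integrable.prod_right_ae] with d hd
    simp only [hg]
    rw [integral_sub hd (integrable_const _)]
    simp [proj]
  have hgL : ∀ {i j : ℕ}, i ≠ j → MemLp (fun ω => g (D i ω, D j ω)) 2 P := fun hij =>
    ((hf.memLp_pair hD hij).sub (hf.memLp_proj_comp hD _)).mono_exponent (by norm_num)
  refine ⟨2 * ∫ x, g x ^ 2 ∂(μ.prod μ), by positivity, fun n hn i hi => ?_⟩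
  have hn' : (2 : ℝ) ≤ n := by exact_mod_cast hn
  have hcard : ((Finset.range n).erase i).card = n - 1 := by
    rw [Finset.card_erase_of_mem (Finset.mem_range.2 hi), Finset.card_range]
  have hcast : ((n - 1 : ℕ) : ℝ) = (n : ℝ) - 1 := by
    rw [Nat.cast_sub (by omega)]; simp
  have e : ∀ ω, (rowMean f n (fun j => D j ω) i - proj μ f (D i ω)) ^ 2
      = (1 / ((n : ℝ) - 1)) ^ 2 *
        (∑ j ∈ (Finset.range n).erase i, g (D i ω, D j ω)) ^ 2 := by
    intro ω
    rw [← mul_pow]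
    congr 1
    simp only [hg, rowMean, Finset.sum_sub_distrib, Finset.sum_const, hcard, nsmul_eq_mul, hcast]
    field_simp [show (n : ℝ) - 1 ≠ 0 by linarith]
  simp_rw [e]
  rw [integral_const_mul]
  have hb : ∫ ω, (∑ j ∈ (Finset.range n).erase i, g (D i ω, D j ω)) ^ 2 ∂P
      ≤ ((Finset.range n).erase i).card * ∫ x, g x ^ 2 ∂(μ.prod μ) := by
    refine integral_sum_sq_le_of_orthogonal _ (fun j ω => g (D i ω, D j ω)) ?_ ?_ ?_
    · exact fun j hj => hgL (Finset.ne_of_mem_erase hj).symm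
    · intro j hj k hk hjk
      exact hD.integral_mul_eq_zero hgm hgm hg0 (Finset.ne_of_mem_erase hj)
        (Finset.ne_of_mem_erase hj) hjk
    · exact fun j hj => (integral_sq_comp_pair hD (Finset.ne_of_mem_erase hj).symm hgm).le
  rw [hcard, hcast] at hb
  set v := ∫ x, g x ^ 2 ∂(μ.prod μ)
  have hv : 0 ≤ v := by positivity
  calc _ ≤ (1 / ((n : ℝ) - 1)) ^ 2 * (((n : ℝ) - 1) * v) := by gcongr
    _ = v / ((n : ℝ) - 1) := by field_simp [show (n : ℝ) - 1 ≠ 0 by linarith]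
    _ ≤ 2 * v / n := by
      rw [div_le_div_iff₀ (by linarith) (by linarith)]
      nlinarith

/-- The Hoeffding decomposition: the remainder of the projection of the U-statistic onto sums of
functions of single observations is `O(n⁻¹)` in `L²`. -/
lemma SymmL4.exists_integral_hoeffding_remainder_sq_le (hf : SymmL4 μ f) (hD : IIDSeq P D μ) :
    ∃ C, 0 ≤ C ∧ ∀ n, 2 ≤ n →
      ∫ ω, (uStat f n (fun j => D j ω) - kmean μ f
        - (2 / n) * ∑ i ∈ Finset.range n, (proj μ f (D i ω) - kmean μ f)) ^ 2 ∂P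
        ≤ C / (n : ℝ) ^ 2 := by
  set m := kmean μ f with hm
  set g : X × X → ℝ := fun x => f x.1 x.2 - proj μ f x.1 - proj μ f x.2 + m with hg
  have hfm := hf.measurable
  have hpm := hf.measurable_proj
  have hgm : Measurable g := by fun_prop
  have hgs : ∀ d e, g (d, e) = g (e, d) := fun d e => by
    simp only [hg]; rw [hf.symm d e]; ring
  have hpi : Integrable (proj μ f) μ := hf.memLp_proj.integrable (by norm_num)
  have hg0 : ∀ᵐ d ∂μ, ∫ e, g (d, e) ∂μ = 0 := by
    filter_upwards [hf.integrable.prod_right_ae] with d hd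
    simp only [hg]
    have h1 : Integrable (fun e => f d e - proj μ f d) μ := hd.sub (integrable_const _)
    have h2 : Integrable (fun e => f d e - proj μ f d - proj μ f e) μ := h1.sub hpi
    rw [integral_add h2 (integrable_const _), integral_sub h1 hpi,
      integral_sub hd (integrable_const _)]
    simp [proj, hm, kmean]
  have hgL : ∀ {i j : ℕ}, i ≠ j → MemLp (fun ω => g (D i ω, D j ω)) 2 P := fun hij =>
    (((hf.memLp_pair hD hij).sub (hf.memLp_proj_comp hD _)).sub
      (hf.memLp_proj_comp hD _)).add (memLp_const m) |>.mono_exponent (by norm_num)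
  set v := ∫ x, g x ^ 2 ∂(μ.prod μ) with hv
  have hv0 : 0 ≤ v := by positivity
  refine ⟨4 * v, by positivity, fun n hn => ?_⟩
  have hn' : (2 : ℝ) ≤ n := by exact_mod_cast hn
  have hcast : ((n - 1 : ℕ) : ℝ) = (n : ℝ) - 1 := by
    rw [Nat.cast_sub (by omega)]; simp
  have hcard : ∀ i ∈ Finset.range n, ((Finset.range n).erase i).card = n - 1 := fun i hi => by
    rw [Finset.card_erase_of_mem hi, Finset.card_range]
  set S : Finset (Σ _ : ℕ, ℕ) := (Finset.range n).sigma fun i => (Finset.range n).erase i with hS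
  have hScard : (S.card : ℝ) = n * ((n : ℝ) - 1) := by
    rw [hS, Finset.card_sigma, Finset.sum_congr rfl hcard]
    simp [hcast]
  have hSne : ∀ a ∈ S, a.1 ≠ a.2 := fun a ha =>
    (Finset.ne_of_mem_erase (Finset.mem_sigma.1 ha).2).symm
  have e : ∀ ω, uStat f n (fun j => D j ω) - m
        - (2 / n) * ∑ i ∈ Finset.range n, (proj μ f (D i ω) - m)
      = (1 / ((n : ℝ) * ((n : ℝ) - 1))) * ∑ a ∈ S, g (D a.1 ω, D a.2 ω) := by
    intro ω
    have hin : ∀ i ∈ Finset.range n, ∑ j ∈ (Finset.range n).erase i, g (D i ω, D j ω)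
        = ∑ j ∈ (Finset.range n).erase i, f (D i ω) (D j ω) - ((n : ℝ) - 2) * proj μ f (D i ω)
          - ∑ j ∈ Finset.range n, proj μ f (D j ω) + ((n : ℝ) - 1) * m := by
      intro i hi
      simp only [hg, Finset.sum_add_distrib, Finset.sum_sub_distrib, Finset.sum_const,
        hcard i hi, nsmul_eq_mul, hcast]
      rw [← Finset.add_sum_erase _ (fun j => proj μ f (D j ω)) hi]
      ring
    rw [hS, Finset.sum_sigma]
    simp only
    rw [Finset.sum_congr rfl hin]
    simp only [uStat, rowMean, Finset.sum_add_distrib, Finset.sum_sub_distrib, Finset.sum_const,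
      nsmul_eq_mul, Finset.card_range, ← Finset.mul_sum]
    field_simp [show (n : ℝ) - 1 ≠ 0 by linarith]
    ring
  simp_rw [e, mul_pow]
  rw [integral_const_mul, integral_sum_sq S (fun a ω => g (D a.1 ω, D a.2 ω))
    fun a ha => hgL (hSne a ha)]
  -- The pair `(i, j)` is correlated only with itself and with `(j, i)`.
  have hb : ∀ a ∈ S, ∑ b ∈ S, ∫ ω, g (D a.1 ω, D a.2 ω) * g (D b.1 ω, D b.2 ω) ∂P ≤ 2 * v := by
    intro a ha
    have hane := hSne a ha
    have hz : ∀ b ∈ S, b ∉ ({a, ⟨a.2, a.1⟩} : Finset (Σ _ : ℕ, ℕ)) →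
        ∫ ω, g (D a.1 ω, D a.2 ω) * g (D b.1 ω, D b.2 ω) ∂P = 0 := by
      rintro ⟨k, l⟩ hb hba
      have hkl : k ≠ l := hSne _ hb
      obtain ⟨i, j⟩ := a
      simp only [Finset.mem_insert, Finset.mem_singleton, Sigma.mk.injEq, heq_eq_eq] at hba
      simp only at hane ⊢
      by_cases h2 : j ≠ k ∧ j ≠ l
      · exact hD.integral_mul_eq_zero hgm hgm hg0 hane.symm h2.1 h2.2
      · have h1 : i ≠ k ∧ i ≠ l := by
          constructor <;> rintro rfl <;> grind
        simp_rw [hgs (D i _)]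
        exact hD.integral_mul_eq_zero hgm hgm hg0 hane h1.1 h1.2
    have hne : a ≠ ⟨a.2, a.1⟩ := fun h => hane (congrArg Sigma.fst h)
    have hsw : (⟨a.2, a.1⟩ : Σ _ : ℕ, ℕ) ∈ S := by
      simp only [hS, Finset.mem_sigma, Finset.mem_erase] at ha ⊢
      exact ⟨ha.2.2, ha.2.1.symm, ha.1⟩
    rw [← Finset.sum_subset (s₁ := ({a, ⟨a.2, a.1⟩} : Finset (Σ _ : ℕ, ℕ))) (by
      intro b hb; simp only [Finset.mem_insert, Finset.mem_singleton] at hb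
      rcases hb with rfl | rfl <;> assumption) hz, Finset.sum_pair hne]
    simp_rw [hgs (D a.2 _), ← pow_two]
    rw [integral_sq_comp_pair hD hane hgm]
    linarith
  have hb2 := Finset.sum_le_card_nsmul S _ _ hb
  rw [nsmul_eq_mul, hScard] at hb2
  calc _ ≤ (1 / ((n : ℝ) * ((n : ℝ) - 1))) ^ 2 * (n * ((n : ℝ) - 1) * (2 * v)) := by gcongr
    _ = 2 * v / (n * ((n : ℝ) - 1)) := by field_simp [show (n : ℝ) - 1 ≠ 0 by linarith]
    _ ≤ 4 * v / (n : ℝ) ^ 2 := by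
      rw [div_le_div_iff₀ (by nlinarith) (by positivity)]
      nlinarith [mul_nonneg hv0 (by linarith : (0 : ℝ) ≤ n),
        mul_nonneg (mul_nonneg hv0 (by linarith : (0 : ℝ) ≤ n)) (by linarith : (0 : ℝ) ≤ n - 2)]

end UStat

/-! ### Rates in `L¹` -/

section Rates

variable {Ω X : Type*} [MeasurableSpace Ω] [MeasurableSpace X] {P : Measure Ω}
  [IsProbabilityMeasure P] {μ : Measure X} [IsProbabilityMeasure μ] {D : ℕ → Ω → X}

/-- The sequence `Y n` is `O(n^{-1/2})` in `L¹`, from `n = 2` on. -/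
def L1Rate (P : Measure Ω) (Y : ℕ → Ω → ℝ) : Prop :=
  ∃ C, 0 ≤ C ∧ ∀ n, 2 ≤ n → Integrable (Y n) P ∧ ∫ ω, |Y n ω| ∂P ≤ C / √n

lemma L1Rate.add {Y Y' : ℕ → Ω → ℝ} (h : L1Rate P Y) (h' : L1Rate P Y') :
    L1Rate P (fun n ω => Y n ω + Y' n ω) := by
  obtain ⟨C, hC, h⟩ := h
  obtain ⟨C', hC', h'⟩ := h'
  refine ⟨C + C', by positivity, fun n hn => ⟨(h n hn).1.add (h' n hn).1, ?_⟩⟩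
  calc _ ≤ ∫ ω, (|Y n ω| + |Y' n ω|) ∂P :=
        integral_mono ((h n hn).1.add (h' n hn).1).abs ((h n hn).1.abs.add (h' n hn).1.abs)
          fun ω => abs_add_le _ _
    _ = ∫ ω, |Y n ω| ∂P + ∫ ω, |Y' n ω| ∂P := integral_add (h n hn).1.abs (h' n hn).1.abs
    _ ≤ _ := by rw [add_div]; exact add_le_add (h n hn).2 (h' n hn).2

lemma L1Rate.mul_bdd {Y : ℕ → Ω → ℝ} (h : L1Rate P Y) {a : ℕ → ℝ} {K : ℝ}
    (ha : ∀ n, 2 ≤ n → |a n| ≤ K) : L1Rate P (fun n ω => a n * Y n ω) := by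
  obtain ⟨C, hC, h⟩ := h
  have hK : 0 ≤ K := (abs_nonneg _).trans (ha 2 le_rfl)
  refine ⟨K * C, by positivity, fun n hn => ⟨(h n hn).1.const_mul _, ?_⟩⟩
  simp_rw [abs_mul]
  rw [integral_const_mul, mul_div_assoc]
  exact mul_le_mul (ha n hn) (h n hn).2 (integral_nonneg fun _ => abs_nonneg _) hK

lemma L1Rate.const_mul {Y : ℕ → Ω → ℝ} (h : L1Rate P Y) (a : ℝ) :
    L1Rate P (fun n ω => a * Y n ω) :=
  h.mul_bdd (a := fun _ => a) (K := |a|) fun _ _ => le_rfl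

lemma L1Rate.sub {Y Y' : ℕ → Ω → ℝ} (h : L1Rate P Y) (h' : L1Rate P Y') :
    L1Rate P (fun n ω => Y n ω - Y' n ω) := by
  simpa [sub_eq_add_neg] using h.add (h'.const_mul (-1))

lemma L1Rate.congr {Y Y' : ℕ → Ω → ℝ} (h : L1Rate P Y) (he : ∀ n, 2 ≤ n → ∀ ω, Y n ω = Y' n ω) :
    L1Rate P Y' := by
  obtain ⟨C, hC, h⟩ := h
  refine ⟨C, hC, fun n hn => ?_⟩
  rw [← funext (he n hn)]
  exact h n hn

lemma L1Rate.average {Y : ℕ → ℕ → Ω → ℝ} (h : ∃ C, 0 ≤ C ∧ ∀ n, 2 ≤ n → ∀ i < n,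
    Integrable (Y n i) P ∧ ∫ ω, |Y n i ω| ∂P ≤ C / √n) :
    L1Rate P (fun n ω => (1 / (n : ℝ)) * ∑ i ∈ Finset.range n, Y n i ω) := by
  obtain ⟨C, hC, h⟩ := h
  refine ⟨C, hC, fun n hn => ⟨(integrable_finsetSum _ fun i hi =>
    (h n hn i (Finset.mem_range.1 hi)).1).const_mul _, ?_⟩⟩
  have hn' : (2 : ℝ) ≤ n := by exact_mod_cast hn
  calc _ ≤ ∫ ω, (1 / (n : ℝ)) * ∑ i ∈ Finset.range n, |Y n i ω| ∂P := by
        refine integral_mono ((integrable_finsetSum _ fun i hi =>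
          (h n hn i (Finset.mem_range.1 hi)).1).const_mul _).abs
          ((integrable_finsetSum _ fun i hi =>
          (h n hn i (Finset.mem_range.1 hi)).1.abs).const_mul _) fun ω => ?_
        simp only
        rw [abs_mul, abs_of_nonneg (by positivity : 0 ≤ 1 / (n : ℝ))]
        gcongr
        exact Finset.abs_sum_le_sum_abs _ _
    _ = (1 / (n : ℝ)) * ∑ i ∈ Finset.range n, ∫ ω, |Y n i ω| ∂P := by
        rw [integral_const_mul, integral_finsetSum _ fun i hi =>
          (h n hn i (Finset.mem_range.1 hi)).1.abs]
    _ ≤ (1 / (n : ℝ)) * (n * (C / √n)) := by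
        gcongr
        have := Finset.sum_le_card_nsmul (Finset.range n) _ _
          fun i hi => (h n hn i (Finset.mem_range.1 hi)).2
        simpa using this
    _ = C / √n := by field_simp

/-- A product is `O(n^{-1/2})` in `L¹` if its factors are `O(n^{-1/2})` and `O(1)` in `L²`. -/
lemma integral_abs_mul_le {Y Y' : Ω → ℝ} (hY : MemLp Y 2 P) (hY' : MemLp Y' 2 P) {n : ℕ}
    (hn : 2 ≤ n) {A B : ℝ} (hA : ∫ ω, Y ω ^ 2 ∂P ≤ A / n) (hB : ∫ ω, Y' ω ^ 2 ∂P ≤ B) :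
    Integrable (fun ω => Y ω * Y' ω) P ∧ ∫ ω, |Y ω * Y' ω| ∂P ≤ (A + B) / √n := by
  have hn' : (2 : ℝ) ≤ n := by exact_mod_cast hn
  have hs : 0 < √(n : ℝ) := Real.sqrt_pos.2 (by linarith)
  have hss : √(n : ℝ) * √n = n := Real.mul_self_sqrt (by linarith)
  have hi : Integrable (fun ω => Y ω * Y' ω) P := hY.integrable_mul hY'
  refine ⟨hi, ?_⟩
  have hY2 : Integrable (fun ω => √(n : ℝ) * Y ω ^ 2) P := hY.integrable_sq.const_mul _
  have hY2' : Integrable (fun ω => (1 / √(n : ℝ)) * Y' ω ^ 2) P := hY'.integrable_sq.const_mul _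
  have h0 : 0 ≤ ∫ ω, Y ω ^ 2 ∂P := integral_nonneg fun _ => sq_nonneg _
  have h0' : 0 ≤ ∫ ω, Y' ω ^ 2 ∂P := integral_nonneg fun _ => sq_nonneg _
  calc _ ≤ ∫ ω, (√(n : ℝ) * Y ω ^ 2 + (1 / √(n : ℝ)) * Y' ω ^ 2) ∂P := by
        refine integral_mono hi.abs (hY2.add hY2') fun ω => ?_
        simp only
        rw [abs_mul]
        have : √(n : ℝ) * Y ω ^ 2 + 1 / √(n : ℝ) * Y' ω ^ 2 - |Y ω| * |Y' ω|
          = (1 / √(n : ℝ)) * ((√n * |Y ω| - |Y' ω| / 2) ^ 2 + 3 / 4 * |Y' ω| ^ 2) := by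
          rw [← sq_abs (Y ω), ← sq_abs (Y' ω)]
          field_simp
          ring
        have h2 : 0 ≤ (1 / √(n : ℝ)) * ((√n * |Y ω| - |Y' ω| / 2) ^ 2 + 3 / 4 * |Y' ω| ^ 2) := by
          positivity
        linarith
    _ = √(n : ℝ) * ∫ ω, Y ω ^ 2 ∂P + (1 / √(n : ℝ)) * ∫ ω, Y' ω ^ 2 ∂P := by
        rw [integral_add hY2 hY2', integral_const_mul, integral_const_mul]
    _ ≤ √(n : ℝ) * (A / n) + (1 / √(n : ℝ)) * B := by gcongr
    _ = (A + B) / √n := by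
        generalize √(n : ℝ) = s at hs hss
        rw [← hss]; field_simp

lemma L1Rate.of_sq {Y : ℕ → Ω → ℝ} (hY : ∀ n, 2 ≤ n → MemLp (Y n) 2 P)
    (h : ∃ C, 0 ≤ C ∧ ∀ n, 2 ≤ n → ∫ ω, Y n ω ^ 2 ∂P ≤ C / n) : L1Rate P Y := by
  obtain ⟨C, hC, h⟩ := h
  refine ⟨C + 1, by positivity, fun n hn => ?_⟩
  have := integral_abs_mul_le (hY n hn) (memLp_const (1 : ℝ)) hn (h n hn) (B := 1) (by simp)
  simpa using this

lemma L1Rate.const {a : ℕ → ℝ} {K : ℝ} (ha : ∀ n, 2 ≤ n → |a n| ≤ K / √n) :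
    L1Rate P (fun n _ => a n) := by
  refine ⟨|K|, by positivity, fun n hn => ⟨integrable_const _, ?_⟩⟩
  simp only [integral_const, probReal_univ, one_smul]
  exact (ha n hn).trans (by gcongr; exact le_abs_self K)

/-- Markov's inequality: what is `O(n^{-1/2})` in `L¹` is negligible in probability with respect
to `n^{-1/2 + ι}`. -/
lemma L1Rate.tendstoInMeasure_div {Y : ℕ → Ω → ℝ} (h : L1Rate P Y) {ι : ℝ} (hι : 0 < ι) :
    TendstoInMeasure P (fun n ω => Y n ω / (n : ℝ) ^ (-(1 / 2) + ι : ℝ)) atTop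
      (fun _ => (0 : ℝ)) := by
  obtain ⟨C, hC, h⟩ := h
  rw [tendstoInMeasure_iff_measureReal_norm]
  intro δ hδ
  have hlim : Tendsto (fun n : ℕ => (C / δ) * (n : ℝ) ^ (-ι)) atTop (𝓝 0) := by
    have := ((tendsto_rpow_neg_atTop hι).comp tendsto_natCast_atTop_atTop).const_mul (C / δ)
    simpa using this
  refine squeeze_zero' (Eventually.of_forall fun n => measureReal_nonneg) ?_ hlim
  filter_upwards [eventually_ge_atTop 2] with n hn
  have hn' : (2 : ℝ) ≤ n := by exact_mod_cast hn
  have hn0 : (0 : ℝ) < n := by linarith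
  set c := (n : ℝ) ^ (-(1 / 2) + ι : ℝ) with hc
  have hc0 : 0 < c := Real.rpow_pos_of_pos hn0 _
  have hset : {ω | δ ≤ ‖Y n ω / c - 0‖} = {ω | δ * c ≤ |Y n ω|} := by
    ext ω
    simp only [sub_zero, Real.norm_eq_abs, abs_div, abs_of_pos hc0, Set.mem_ofPred_eq,
      le_div_iff₀ hc0]
  rw [hset]
  have hM := mul_meas_ge_le_integral_of_nonneg (μ := P) (f := fun ω => |Y n ω|)
    (Eventually.of_forall fun _ => abs_nonneg _) (h n hn).1.abs (δ * c)
  have hM2 := hM.trans (h n hn).2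
  have e : (1 : ℝ) / √n = c * (n : ℝ) ^ (-ι) := by
    rw [hc, ← Real.rpow_add hn0, Real.sqrt_eq_rpow, one_div, ← Real.rpow_neg hn0.le]
    congr 1; ring
  rw [div_eq_mul_one_div C, e] at hM2
  have : δ * c * P.real {ω | δ * c ≤ |Y n ω|} ≤ δ * c * (C / δ * (n : ℝ) ^ (-ι)) := by
    refine hM2.trans (le_of_eq ?_)
    field_simp
  exact le_of_mul_le_mul_left this (by positivity)

lemma L1Rate.tendstoInMeasure {Y : ℕ → Ω → ℝ} (h : L1Rate P Y) :
    TendstoInMeasure P Y atTop (fun _ => (0 : ℝ)) := by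
  simpa using h.tendstoInMeasure_div (ι := 1 / 2) (by norm_num)

/-! ### Rates for U-statistics and for the covariance matrix of their row means -/

variable {f g : X → X → ℝ}

lemma IIDSeq.integral_comp_sq (hD : IIDSeq P D μ) {φ : X → ℝ} (hφ : Measurable φ) (i : ℕ) :
    ∫ ω, φ (D i ω) ^ 2 ∂P = ∫ x, φ x ^ 2 ∂μ := by
  rw [← hD.law i, integral_map (hD.measurable i).aemeasurable
    (hφ.pow_const 2).aestronglyMeasurable]

lemma IIDSeq.exists_integral_average_sub_sq_le (hD : IIDSeq P D μ) {φ : X → ℝ}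
    (hφ : Measurable φ) (h2 : MemLp φ 2 μ) :
    ∃ C : ℝ, 0 ≤ C ∧ ∀ n : ℕ, 2 ≤ n →
      ∫ ω, ((1 / (n : ℝ)) * ∑ i ∈ Finset.range n, φ (D i ω) - ∫ x, φ x ∂μ) ^ 2 ∂P ≤ C / n := by
  set m := ∫ x, φ x ∂μ with hm
  have hmeas : Measurable (fun x => φ x - m) := hφ.sub_const m
  have hL : MemLp (fun x => φ x - m) 2 μ := h2.sub (memLp_const m)
  have h0 : ∫ x, (φ x - m) ∂μ = 0 := by
    rw [integral_sub (h2.integrable (by norm_num)) (integrable_const _)]; simp [hm]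
  refine ⟨∫ x, (φ x - m) ^ 2 ∂μ, by positivity, fun n hn => ?_⟩
  have hn' : (2 : ℝ) ≤ n := by exact_mod_cast hn
  have e : ∀ ω, ((1 / (n : ℝ)) * ∑ i ∈ Finset.range n, φ (D i ω) - m) ^ 2
      = (1 / (n : ℝ)) ^ 2 * (∑ i ∈ Finset.range n, (φ (D i ω) - m)) ^ 2 := by
    intro ω
    rw [← mul_pow, Finset.sum_sub_distrib]
    congr 1
    simp only [Finset.sum_const, Finset.card_range, nsmul_eq_mul]
    field_simp
  simp_rw [e]
  rw [integral_const_mul]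
  have hb : ∫ ω, (∑ i ∈ Finset.range n, (φ (D i ω) - m)) ^ 2 ∂P
      ≤ (Finset.range n).card * ∫ x, (φ x - m) ^ 2 ∂μ := by
    refine integral_sum_sq_le_of_orthogonal _ (fun i ω => φ (D i ω) - m) ?_ ?_ ?_
    · exact fun i _ => hL.comp_measurePreserving (hD.measurePreserving i)
    · intro i _ j _ hij
      exact hD.integral_mul_eq_zero (g := fun x => φ x.2 - m) (G := fun x => φ x.2 - m)
        (i := j) (k := j) (by fun_prop) (by fun_prop) (Eventually.of_forall fun d => h0) hij hij hij
    · exact fun i _ => (hD.integral_comp_sq hmeas i).le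
  rw [Finset.card_range] at hb
  calc _ ≤ (1 / (n : ℝ)) ^ 2 * (n * ∫ x, (φ x - m) ^ 2 ∂μ) := by gcongr
    _ = _ := by field_simp

lemma integral_add_sq_le {Y Y' : Ω → ℝ} (hY : MemLp Y 2 P) (hY' : MemLp Y' 2 P) :
    ∫ ω, (Y ω + Y' ω) ^ 2 ∂P ≤ 2 * ∫ ω, Y ω ^ 2 ∂P + 2 * ∫ ω, Y' ω ^ 2 ∂P := by
  rw [← integral_const_mul, ← integral_const_mul, ← integral_add (hY.integrable_sq.const_mul _)
    (hY'.integrable_sq.const_mul _)]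
  refine integral_mono (hY.add hY').integrable_sq ((hY.integrable_sq.const_mul _).add
    (hY'.integrable_sq.const_mul _)) fun ω => ?_
  simp only
  nlinarith [sq_nonneg (Y ω - Y' ω)]

lemma SymmL4.exists_integral_rowMean_sq_le (hf : SymmL4 μ f) (hD : IIDSeq P D μ) :
    ∃ C, 0 ≤ C ∧ ∀ n, 2 ≤ n → ∀ i < n,
      ∫ ω, rowMean f n (fun j => D j ω) i ^ 2 ∂P ≤ C := by
  obtain ⟨C, hC, h⟩ := hf.exists_integral_rowMean_sub_sq_le hD
  refine ⟨2 * C + 2 * ∫ x, proj μ f x ^ 2 ∂μ, by positivity, fun n hn i hi => ?_⟩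
  have hn' : (2 : ℝ) ≤ n := by exact_mod_cast hn
  have h2 := integral_add_sq_le (P := P)
    (((hf.memLp_rowMean hD n i).sub (hf.memLp_proj_comp hD i)).mono_exponent
      (p := 2) (by norm_num))
    ((hf.memLp_proj_comp hD i).mono_exponent (p := 2) (by norm_num))
  simp only [Pi.sub_apply, sub_add_cancel] at h2
  rw [hD.integral_comp_sq hf.measurable_proj] at h2
  have h3 := (h n hn i hi).trans (div_le_self hC (by linarith))
  linarith

lemma SymmL4.exists_integral_uStat_sub_sq_le (hf : SymmL4 μ f) (hD : IIDSeq P D μ) :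
    ∃ C, 0 ≤ C ∧ ∀ n, 2 ≤ n →
      ∫ ω, (uStat f n (fun j => D j ω) - kmean μ f) ^ 2 ∂P ≤ C / n := by
  obtain ⟨C, hC, h⟩ := hf.exists_integral_hoeffding_remainder_sq_le hD
  obtain ⟨C', hC', h'⟩ := hD.exists_integral_average_sub_sq_le hf.measurable_proj
    (hf.memLp_proj.mono_exponent (by norm_num))
  refine ⟨2 * C + 8 * C', by positivity, fun n hn => ?_⟩
  have hn' : (2 : ℝ) ≤ n := by exact_mod_cast hn
  have hu := ((hf.memLp_uStat hD n).mono_exponent (p := 2) (by norm_num)).sub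
    (memLp_const (kmean μ f))
  have hs : MemLp (fun ω => (2 / (n : ℝ)) *
      ∑ i ∈ Finset.range n, (proj μ f (D i ω) - kmean μ f)) 2 P := by
    have : MemLp (fun ω => ∑ i ∈ Finset.range n, (proj μ f (D i ω) - kmean μ f)) 2 P :=
      memLp_finsetSum _ fun i _ => ((hf.memLp_proj_comp hD i).mono_exponent
        (p := 2) (by norm_num)).sub (memLp_const _)
    exact this.const_mul _
  have h2 := integral_add_sq_le (P := P) (hu.sub hs) hs
  simp only [Pi.sub_apply, sub_add_cancel] at h2
  have e : ∀ ω, ((2 / (n : ℝ)) * ∑ i ∈ Finset.range n, (proj μ f (D i ω) - kmean μ f)) ^ 2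
      = 4 * ((1 / (n : ℝ)) * ∑ i ∈ Finset.range n, proj μ f (D i ω) - ∫ x, proj μ f x ∂μ) ^ 2 := by
    intro ω
    rw [Finset.sum_sub_distrib]
    simp only [Finset.sum_const, Finset.card_range, nsmul_eq_mul, kmean]
    field_simp
    ring
  have h3 := h n hn
  have h4 := h' n hn
  simp_rw [e] at h2
  rw [integral_const_mul] at h2
  have h5 : C / (n : ℝ) ^ 2 ≤ C / n := by
    gcongr
    nlinarith
  calc _ ≤ _ := h2
    _ ≤ 2 * (C / n) + 2 * (4 * (C' / n)) := by
      gcongr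
      exact h3.trans h5
    _ = _ := by ring

lemma SymmL4.l1Rate_uStat (hf : SymmL4 μ f) (hD : IIDSeq P D μ) :
    L1Rate P (fun n ω => uStat f n (fun j => D j ω) - kmean μ f) :=
  .of_sq (fun n _ => ((hf.memLp_uStat hD n).mono_exponent (by norm_num)).sub (memLp_const _))
    (hf.exists_integral_uStat_sub_sq_le hD)

/-- The remainder of the Hoeffding decomposition is negligible at the scale `n^{-1/2}`. -/
lemma SymmL4.l1Rate_hoeffding_remainder (hf : SymmL4 μ f) (hD : IIDSeq P D μ) :
    L1Rate P (fun n ω => √(n : ℝ) * (uStat f n (fun j => D j ω) - kmean μ f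
        - (2 / n) * ∑ i ∈ Finset.range n, (proj μ f (D i ω) - kmean μ f))) := by
  refine .of_sq (fun n _ => ?_) ?_
  · have : MemLp (fun ω => ∑ i ∈ Finset.range n, (proj μ f (D i ω) - kmean μ f)) 2 P :=
      memLp_finsetSum _ fun i _ => ((hf.memLp_proj_comp hD i).mono_exponent
        (p := 2) (by norm_num)).sub (memLp_const _)
    exact ((((hf.memLp_uStat hD n).mono_exponent (p := 2) (by norm_num)).sub
      (memLp_const (kmean μ f))).sub (this.const_mul _)).const_mul _
  · obtain ⟨C, hC, h⟩ := hf.exists_integral_hoeffding_remainder_sq_le hD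
    refine ⟨C, hC, fun n hn => ?_⟩
    have hn' : (2 : ℝ) ≤ n := by exact_mod_cast hn
    simp_rw [mul_pow]
    rw [integral_const_mul, Real.sq_sqrt (by linarith)]
    calc _ ≤ (n : ℝ) * (C / (n : ℝ) ^ 2) := by gcongr; exact h n hn
      _ = C / n := by field_simp

/-- The population counterpart `4 Cov(f⁽¹⁾(D), g⁽¹⁾(D))` of `rowCov`. -/
noncomputable def projCov (μ : Measure X) (f g : X → X → ℝ) : ℝ :=
  4 * (∫ x, proj μ f x * proj μ g x ∂μ - kmean μ f * kmean μ g)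

/-- The covariances of the row means are consistent at the rate `n^{-1/2}`. The products of row
means are compared with the products of the projections; since the latter are in `L⁴`, their
products have finite variance. -/
lemma SymmL4.l1Rate_rowCov (hf : SymmL4 μ f) (hg : SymmL4 μ g) (hD : IIDSeq P D μ) :
    L1Rate P (fun n ω => rowCov f g n (fun j => D j ω) - projCov μ f g) := by
  have two {Y : Ω → ℝ} (h : MemLp Y 4 P) : MemLp Y 2 P := h.mono_exponent (by norm_num)
  obtain ⟨A, hA, hfA⟩ := hf.exists_integral_rowMean_sub_sq_le hD
  obtain ⟨A', hA', hgA⟩ := hg.exists_integral_rowMean_sub_sq_le hD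
  obtain ⟨B, hB, hgB⟩ := hg.exists_integral_rowMean_sq_le hD
  obtain ⟨U, hU, hfU⟩ := hf.exists_integral_uStat_sub_sq_le hD
  obtain ⟨U', hU', hgU⟩ := hg.exists_integral_uStat_sub_sq_le hD
  -- The three parts of the mean of the products of row means.
  have r1 : L1Rate P (fun n ω => (1 / (n : ℝ)) * ∑ i ∈ Finset.range n,
      (rowMean f n (fun j => D j ω) i - proj μ f (D i ω)) * rowMean g n (fun j => D j ω) i) :=
    .average ⟨A + B, by positivity, fun n hn i hi => integral_abs_mul_le
      (two ((hf.memLp_rowMean hD n i).sub (hf.memLp_proj_comp hD i)))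
      (two (hg.memLp_rowMean hD n i)) hn (hfA n hn i hi) (hgB n hn i hi)⟩
  have r2 : L1Rate P (fun n ω => (1 / (n : ℝ)) * ∑ i ∈ Finset.range n,
      (rowMean g n (fun j => D j ω) i - proj μ g (D i ω)) * proj μ f (D i ω)) :=
    .average ⟨A' + ∫ x, proj μ f x ^ 2 ∂μ, by positivity, fun n hn i hi => integral_abs_mul_le
      (two ((hg.memLp_rowMean hD n i).sub (hg.memLp_proj_comp hD i)))
      (two (hf.memLp_proj_comp hD i)) hn (hgA n hn i hi)
      (hD.integral_comp_sq hf.measurable_proj i).le⟩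
  have hpp : MemLp (fun x => proj μ f x * proj μ g x) 2 μ :=
    hg.memLp_proj.mul' hf.memLp_proj (hpqr := ⟨by
      rw [← ENNReal.toReal_eq_toReal_iff' (by simp) (by simp),
        ENNReal.toReal_add (by simp) (by simp)]
      norm_num⟩)
  have r3 : L1Rate P (fun n ω => (1 / (n : ℝ)) * ∑ i ∈ Finset.range n,
      (proj μ f (D i ω) * proj μ g (D i ω)) - ∫ x, proj μ f x * proj μ g x ∂μ) := by
    refine .of_sq (fun n _ => ?_) (hD.exists_integral_average_sub_sq_le
      (hf.measurable_proj.mul hg.measurable_proj) hpp)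
    have : MemLp (fun ω => ∑ i ∈ Finset.range n, (proj μ f (D i ω) * proj μ g (D i ω))) 2 P :=
      memLp_finsetSum _ fun i _ => hpp.comp_measurePreserving (hD.measurePreserving i)
    exact (this.const_mul _).sub (memLp_const _)
  -- The product of the two U-statistics.
  have hg2 : ∀ n, 2 ≤ n → ∫ ω, uStat g n (fun j => D j ω) ^ 2 ∂P
      ≤ 2 * U' + 2 * kmean μ g ^ 2 := by
    intro n hn
    have hn' : (2 : ℝ) ≤ n := by exact_mod_cast hn
    have h := integral_add_sq_le (P := P)
      ((two (hg.memLp_uStat hD n)).sub (memLp_const (kmean μ g))) (memLp_const (kmean μ g))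
    simp only [Pi.sub_apply, sub_add_cancel] at h
    have h' := (hgU n hn).trans (div_le_self hU' (by linarith))
    simp only [integral_const, probReal_univ, one_smul] at h
    linarith
  have r4 : L1Rate P (fun n ω =>
      (uStat f n (fun j => D j ω) - kmean μ f) * uStat g n (fun j => D j ω)) :=
    ⟨U + (2 * U' + 2 * kmean μ g ^ 2), by positivity, fun n hn => integral_abs_mul_le
      ((two (hf.memLp_uStat hD n)).sub (memLp_const _)) (two (hg.memLp_uStat hD n)) hn
      (hfU n hn) (hg2 n hn)⟩
  have r5 := (hg.l1Rate_uStat hD).const_mul (kmean μ f)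
  have r6 : L1Rate P (fun n _ => (1 / ((n : ℝ) - 1)) * projCov μ f g) := by
    refine .const (K := 2 * |projCov μ f g|) fun n hn => ?_
    have hn' : (2 : ℝ) ≤ n := by exact_mod_cast hn
    have hs : √(n : ℝ) ≤ n := Real.sqrt_le_self_iff.2 (Or.inr (by linarith))
    rw [abs_mul, abs_of_pos (by apply one_div_pos.2; linarith), mul_comm, mul_one_div,
      div_le_div_iff₀ (by linarith) (Real.sqrt_pos.2 (by linarith))]
    nlinarith [abs_nonneg (projCov μ f g)]
  have hfac : ∀ n : ℕ, 2 ≤ n → |4 * ((n : ℝ) / ((n : ℝ) - 1))| ≤ 8 := by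
    intro n hn
    have hn' : (2 : ℝ) ≤ n := by exact_mod_cast hn
    rw [abs_of_nonneg (by have : 0 < (n : ℝ) - 1 := by linarith
                          positivity), ← mul_div_assoc, div_le_iff₀ (by linarith)]
    linarith
  refine (((((r1.add r2).add r3).sub (r4.add r5)).mul_bdd hfac).add r6).congr fun n hn ω => ?_
  have hn' : (2 : ℝ) ≤ n := by exact_mod_cast hn
  have hn1 : (n : ℝ) - 1 ≠ 0 := by linarith
  set F := fun i => rowMean f n (fun j => D j ω) i with hF
  set G := fun i => rowMean g n (fun j => D j ω) i with hG
  have eF : ∑ i ∈ Finset.range n, F i = n * uStat f n (fun j => D j ω) := by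
    simp only [uStat, hF]; field_simp
  have eG : ∑ i ∈ Finset.range n, G i = n * uStat g n (fun j => D j ω) := by
    simp only [uStat, hG]; field_simp
  have e1 : ∑ i ∈ Finset.range n,
      (F i - uStat f n (fun j => D j ω)) * (G i - uStat g n (fun j => D j ω))
      = ∑ i ∈ Finset.range n, F i * G i
        - n * (uStat f n (fun j => D j ω) * uStat g n (fun j => D j ω)) := by
    simp only [sub_mul, mul_sub, Finset.sum_sub_distrib, ← Finset.mul_sum, ← Finset.sum_mul,
      eF, eG, Finset.sum_const, Finset.card_range, nsmul_eq_mul]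
    ring
  have e2 : ∑ i ∈ Finset.range n, (F i - proj μ f (D i ω)) * G i
      + ∑ i ∈ Finset.range n, (G i - proj μ g (D i ω)) * proj μ f (D i ω)
      + ∑ i ∈ Finset.range n, proj μ f (D i ω) * proj μ g (D i ω)
      = ∑ i ∈ Finset.range n, F i * G i := by
    rw [← Finset.sum_add_distrib, ← Finset.sum_add_distrib]
    exact Finset.sum_congr rfl fun i _ => by ring
  rw [rowCov, e1, ← e2, projCov]
  field_simp
  ring

/-! ### Linearity in the kernel -/

lemma rowMean_add (f g : X → X → ℝ) (n : ℕ) (x : ℕ → X) (i : ℕ) :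
    rowMean (fun d e => f d e + g d e) n x i = rowMean f n x i + rowMean g n x i := by
  simp only [rowMean, Finset.sum_add_distrib, mul_add]

lemma rowMean_const_mul (c : ℝ) (f : X → X → ℝ) (n : ℕ) (x : ℕ → X) (i : ℕ) :
    rowMean (fun d e => c * f d e) n x i = c * rowMean f n x i := by
  simp only [rowMean, ← Finset.mul_sum]; ring

lemma uStat_add (f g : X → X → ℝ) (n : ℕ) (x : ℕ → X) :
    uStat (fun d e => f d e + g d e) n x = uStat f n x + uStat g n x := by
  simp only [uStat, rowMean_add, Finset.sum_add_distrib, mul_add]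

lemma uStat_const_mul (c : ℝ) (f : X → X → ℝ) (n : ℕ) (x : ℕ → X) :
    uStat (fun d e => c * f d e) n x = c * uStat f n x := by
  simp only [uStat, rowMean_const_mul, ← Finset.mul_sum]; ring

lemma rowCov_comm (f g : X → X → ℝ) (n : ℕ) (x : ℕ → X) :
    rowCov f g n x = rowCov g f n x := by
  simp only [rowCov, mul_comm]

lemma rowCov_add_left (f g h : X → X → ℝ) (n : ℕ) (x : ℕ → X) :
    rowCov (fun d e => f d e + g d e) h n x = rowCov f h n x + rowCov g h n x := by
  simp only [rowCov, rowMean_add, uStat_add]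
  rw [← mul_add, ← Finset.sum_add_distrib]
  congr 1
  exact Finset.sum_congr rfl fun i _ => by ring

lemma rowCov_const_mul_left (c : ℝ) (f h : X → X → ℝ) (n : ℕ) (x : ℕ → X) :
    rowCov (fun d e => c * f d e) h n x = c * rowCov f h n x := by
  simp only [rowCov, rowMean_const_mul, uStat_const_mul]
  rw [mul_left_comm]
  congr 1
  rw [Finset.mul_sum]
  exact Finset.sum_congr rfl fun i _ => by ring

lemma rowCov_add_right (f g h : X → X → ℝ) (n : ℕ) (x : ℕ → X) :
    rowCov h (fun d e => f d e + g d e) n x = rowCov h f n x + rowCov h g n x := by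
  simp only [rowCov_comm h, rowCov_add_left]

lemma rowCov_const_mul_right (c : ℝ) (f h : X → X → ℝ) (n : ℕ) (x : ℕ → X) :
    rowCov h (fun d e => c * f d e) n x = c * rowCov h f n x := by
  simp only [rowCov_comm h, rowCov_const_mul_left]

/-- The local expansion of a kernel at scale `n^{-1/2}`. -/
noncomputable def localKernel (f : Fin 3 → X → X → ℝ) (n : ℕ) (d e : X) : ℝ :=
  f 0 d e + (√(n : ℝ))⁻¹ * (f 1 d e + (√(n : ℝ))⁻¹ * f 2 d e)

/-- Terms of order `n^{-1/2}` in the kernels do not change the limit of `rowCov`, nor its rate,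
because `rowCov` is bilinear. -/
lemma l1Rate_rowCov_localKernel {f g : Fin 3 → X → X → ℝ} (hf : ∀ a, SymmL4 μ (f a))
    (hg : ∀ a, SymmL4 μ (g a)) (hD : IIDSeq P D μ) :
    L1Rate P (fun n ω => rowCov (localKernel f n) (localKernel g n) n (fun j => D j ω)
      - projCov μ (f 0) (g 0)) := by
  have hs : ∀ n : ℕ, 2 ≤ n → 0 ≤ (√(n : ℝ))⁻¹ ∧ (√(n : ℝ))⁻¹ ≤ 1 := fun n hn => by
    have hn' : (2 : ℝ) ≤ n := by exact_mod_cast hn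
    refine ⟨by positivity, inv_le_one_of_one_le₀ ?_⟩
    rw [Real.one_le_sqrt]; linarith
  -- A term with a factor `n^{-1/2}` and bounded coefficients.
  have small : ∀ a b (c : ℕ → ℝ), (∀ n, 2 ≤ n → |c n| ≤ 1) →
      L1Rate P (fun n ω => (√(n : ℝ))⁻¹ * c n * rowCov (f a) (g b) n (fun j => D j ω)) := by
    intro a b c hc
    have h1 := ((hf a).l1Rate_rowCov (hg b) hD).mul_bdd (a := fun n => (√(n : ℝ))⁻¹ * c n)
      (K := 1) fun n hn => by
        rw [abs_mul, abs_of_nonneg (hs n hn).1]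
        exact mul_le_one₀ (hs n hn).2 (abs_nonneg _) (hc n hn)
    have h2 : L1Rate P (fun n _ => (√(n : ℝ))⁻¹ * c n * projCov μ (f a) (g b)) := by
      refine .const (K := |projCov μ (f a) (g b)|) fun n hn => ?_
      rw [abs_mul, abs_mul, abs_of_nonneg (hs n hn).1, div_eq_inv_mul]
      gcongr
      exact mul_le_of_le_one_right (hs n hn).1 (hc n hn)
    exact (h1.add h2).congr fun n _ ω => by ring
  have hc1 : ∀ n : ℕ, 2 ≤ n → |(√(n : ℝ))⁻¹| ≤ 1 := fun n hn => by
    rw [abs_of_nonneg (hs n hn).1]; exact (hs n hn).2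
  have hc2 : ∀ n : ℕ, 2 ≤ n → |(√(n : ℝ))⁻¹ ^ 2| ≤ 1 := fun n hn => by
    rw [abs_pow]; exact pow_le_one₀ (abs_nonneg _) (hc1 n hn)
  have hc3 : ∀ n : ℕ, 2 ≤ n → |(√(n : ℝ))⁻¹ ^ 3| ≤ 1 := fun n hn => by
    rw [abs_pow]; exact pow_le_one₀ (abs_nonneg _) (hc1 n hn)
  have one : ∀ n : ℕ, 2 ≤ n → |(1 : ℝ)| ≤ 1 := by simp
  refine (((((((((hf 0).l1Rate_rowCov (hg 0) hD).add (small 0 1 _ one)).add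
    (small 1 0 _ one)).add (small 0 2 _ hc1)).add (small 2 0 _ hc1)).add (small 1 1 _ hc1)).add
    (small 1 2 _ hc2)).add (small 2 1 _ hc2)).add (small 2 2 _ hc3) |>.congr fun n hn ω => ?_
  simp +unfoldPartialApp only [localKernel, rowCov_add_left, rowCov_add_right, rowCov_const_mul_left,
    rowCov_const_mul_right, mul_add]
  ring

end Rates

/-! ### Perturbation of spectral functions of symmetric matrices -/

section SpectralPerturbation

variable {p : ℕ} {A B : Matrix (Fin p) (Fin p) ℝ}

/-- The squared Frobenius norm. -/
def frobSq (M : Matrix (Fin p) (Fin p) ℝ) : ℝ := ∑ i, ∑ j, M i j ^ 2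

lemma sq_le_frobSq (M : Matrix (Fin p) (Fin p) ℝ) (i j : Fin p) : M i j ^ 2 ≤ frobSq M :=
  (Finset.single_le_sum (f := fun j => M i j ^ 2) (fun _ _ => sq_nonneg _)
    (Finset.mem_univ j)).trans
    (Finset.single_le_sum (f := fun i => ∑ j, M i j ^ 2)
      (fun _ _ => Finset.sum_nonneg fun _ _ => sq_nonneg _) (Finset.mem_univ i))

lemma frobSq_eq_trace (M : Matrix (Fin p) (Fin p) ℝ) :
    frobSq M = (M * M.transpose).trace := by
  simp [frobSq, Matrix.trace, Matrix.mul_apply, pow_two]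

/-- The orthogonal matrix of eigenvectors of a symmetric matrix. -/
noncomputable abbrev eigMat (hA : A.IsHermitian) : Matrix (Fin p) (Fin p) ℝ :=
  (hA.eigenvectorUnitary : Matrix (Fin p) (Fin p) ℝ)

lemma eigMat_transpose_mul (hA : A.IsHermitian) : (eigMat hA).transpose * eigMat hA = 1 := by
  have := Unitary.coe_star_mul_self hA.eigenvectorUnitary
  simpa [Matrix.star_eq_conjTranspose, Matrix.conjTranspose_eq_transpose_of_trivial] using this

lemma eigMat_mul_transpose (hA : A.IsHermitian) : eigMat hA * (eigMat hA).transpose = 1 :=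
  mul_eq_one_comm.1 (eigMat_transpose_mul hA)

lemma frobSq_orthogonal_mul_mul {U V M : Matrix (Fin p) (Fin p) ℝ} (hU : U * U.transpose = 1)
    (hV : V * V.transpose = 1) : frobSq (U.transpose * M * V) = frobSq M := by
  rw [frobSq_eq_trace, frobSq_eq_trace]
  simp only [Matrix.transpose_mul, Matrix.transpose_transpose]
  calc (U.transpose * M * V * (V.transpose * (M.transpose * U))).trace
      = (U.transpose * (M * (V * V.transpose) * M.transpose * U)).trace := by
        simp only [Matrix.mul_assoc]
    _ = (M * M.transpose * (U * U.transpose)).trace := by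
        rw [hV, Matrix.trace_mul_comm]; simp only [Matrix.mul_assoc, Matrix.mul_one]
    _ = _ := by rw [hU, Matrix.mul_one]

/-- In the pair of eigenbases of `A` and `B`, the difference `f(A) - g(B)` has entries
`(f(λ_i) - g(μ_j)) w_{ij}`, where `w` is the orthogonal transition matrix. -/
lemma eigMat_conj_spectralMap_sub (f g : ℝ → ℝ) (hA : A.IsHermitian) (hB : B.IsHermitian)
    (i j : Fin p) :
    ((eigMat hA).transpose * (spectralMap f hA - spectralMap g hB) * eigMat hB) i j
      = (f (hA.eigenvalues i) - g (hB.eigenvalues j)) *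
        ((eigMat hA).transpose * eigMat hB) i j := by
  have h1 : (eigMat hA).transpose * (spectralMap f hA - spectralMap g hB) * eigMat hB
      = Matrix.diagonal (fun i => f (hA.eigenvalues i)) * ((eigMat hA).transpose * eigMat hB)
        - ((eigMat hA).transpose * eigMat hB) * Matrix.diagonal (fun i => g (hB.eigenvalues i)) := by
    rw [Matrix.mul_sub, Matrix.sub_mul]
    congr 1
    · calc _ = ((eigMat hA).transpose * eigMat hA) *
            (Matrix.diagonal (fun i => f (hA.eigenvalues i)) *
              ((eigMat hA).transpose * eigMat hB)) := by
            simp only [spectralMap, Matrix.mul_assoc]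
        _ = _ := by rw [eigMat_transpose_mul, Matrix.one_mul]
    · calc _ = ((eigMat hA).transpose * eigMat hB) *
            Matrix.diagonal (fun i => g (hB.eigenvalues i)) *
              ((eigMat hB).transpose * eigMat hB) := by
            simp only [spectralMap, Matrix.mul_assoc]
        _ = _ := by rw [eigMat_transpose_mul, Matrix.mul_one]
  rw [h1, Matrix.sub_apply, Matrix.diagonal_mul, Matrix.mul_diagonal]
  ring

lemma frobSq_spectralMap_sub (f g : ℝ → ℝ) (hA : A.IsHermitian) (hB : B.IsHermitian) :
    frobSq (spectralMap f hA - spectralMap g hB) =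
      ∑ i, ∑ j, (f (hA.eigenvalues i) - g (hB.eigenvalues j)) ^ 2 *
        ((eigMat hA).transpose * eigMat hB) i j ^ 2 := by
  rw [← frobSq_orthogonal_mul_mul (eigMat_mul_transpose hA) (eigMat_mul_transpose hB), frobSq]
  simp only [eigMat_conj_spectralMap_sub, mul_pow]

lemma frobSq_sub_eq (hA : A.IsHermitian) (hB : B.IsHermitian) :
    frobSq (A - B) = ∑ i, ∑ j, (hA.eigenvalues i - hB.eigenvalues j) ^ 2 *
        ((eigMat hA).transpose * eigMat hB) i j ^ 2 := by
  rw [← frobSq_spectralMap_sub (fun t => t) (fun t => t) hA hB, spectralMap_id, spectralMap_id]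

/-- A Lipschitz bound that holds between the two spectra carries over to the matrices. -/
lemma frobSq_spectralMap_sub_le {f g : ℝ → ℝ} (hA : A.IsHermitian) (hB : B.IsHermitian) {L : ℝ}
    (h : ∀ i j, |f (hA.eigenvalues i) - g (hB.eigenvalues j)|
      ≤ L * |hA.eigenvalues i - hB.eigenvalues j|) :
    frobSq (spectralMap f hA - spectralMap g hB) ≤ L ^ 2 * frobSq (A - B) := by
  rw [frobSq_spectralMap_sub, frobSq_sub_eq hA hB, Finset.mul_sum]
  refine Finset.sum_le_sum fun i _ => ?_
  rw [Finset.mul_sum]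
  refine Finset.sum_le_sum fun j _ => ?_
  rw [← mul_assoc]
  gcongr
  calc _ = |f (hA.eigenvalues i) - g (hB.eigenvalues j)| ^ 2 := (sq_abs _).symm
    _ ≤ (L * |hA.eigenvalues i - hB.eigenvalues j|) ^ 2 := by gcongr; exact h i j
    _ = _ := by rw [mul_pow, sq_abs]

/-- Every eigenvalue of `A` is close to some eigenvalue of `B`. -/
lemma exists_eigenvalue_sub_sq_le (hA : A.IsHermitian) (hB : B.IsHermitian) (i : Fin p) :
    ∃ j, (hA.eigenvalues i - hB.eigenvalues j) ^ 2 ≤ frobSq (A - B) := by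
  set W := (eigMat hA).transpose * eigMat hB with hW
  have hrow : ∑ j, W i j ^ 2 = 1 := by
    have h1 : W * W.transpose = 1 := by
      rw [hW, Matrix.transpose_mul, Matrix.transpose_transpose]
      calc _ = (eigMat hA).transpose * (eigMat hB * (eigMat hB).transpose) * eigMat hA := by
            simp only [Matrix.mul_assoc]
        _ = 1 := by rw [eigMat_mul_transpose, Matrix.mul_one, eigMat_transpose_mul]
    have h2 := congrFun (congrFun h1 i) i
    simpa [Matrix.mul_apply, pow_two] using h2
  by_contra! hcon
  obtain ⟨j₀, hj₀⟩ : ∃ j, W i j ≠ 0 := by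
    by_contra! h
    simp [h] at hrow
  have hlt : ∑ j, frobSq (A - B) * W i j ^ 2
      < ∑ j, (hA.eigenvalues i - hB.eigenvalues j) ^ 2 * W i j ^ 2 :=
    Finset.sum_lt_sum (fun j _ => by have := (hcon j).le; gcongr)
      ⟨j₀, Finset.mem_univ _, by have := hcon j₀; have := sq_pos_of_ne_zero hj₀; gcongr⟩
  rw [← Finset.mul_sum, hrow, mul_one] at hlt
  refine absurd hlt (not_lt.2 ?_)
  rw [frobSq_sub_eq hA hB]
  exact Finset.single_le_sum (f := fun i => ∑ j, (hA.eigenvalues i - hB.eigenvalues j) ^ 2 *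
    W i j ^ 2) (fun _ _ => Finset.sum_nonneg fun _ _ => by positivity) (Finset.mem_univ i)

/-- Thresholding at a level `c` between the size of the perturbation and the spectral gap `σ` of
the limit: an eigenvalue of `A` above `c` is near a positive eigenvalue of `B`, an eigenvalue
below `c` is near `0`, so that the thresholded inverse is a Lipschitz perturbation of the
Moore–Penrose inverse. -/
lemma frobSq_thresholdedInv_sub_mpInverse_le (hA : A.IsHermitian) (hB : B.IsHermitian) {c σ : ℝ}
    (hc : 0 < c) (hcσ : c ≤ σ / 2) (hσ : ∀ j, hB.eigenvalues j = 0 ∨ σ ≤ hB.eigenvalues j)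
    (hAB : frobSq (A - B) < c ^ 2) :
    frobSq (thresholdedInv c hA - mpInverse hB) ≤ (4 / σ ^ 2) ^ 2 * frobSq (A - B) := by
  have hσ0 : 0 < σ := by linarith
  refine frobSq_spectralMap_sub_le hA hB fun i j => ?_
  obtain ⟨k, hk⟩ := exists_eigenvalue_sub_sq_le hA hB i
  have hk' : |hA.eigenvalues i - hB.eigenvalues k| < c := abs_lt_of_sq_lt_sq (hk.trans_lt hAB) hc.le
  rw [abs_lt] at hk'
  set a := hA.eigenvalues i
  set b := hB.eigenvalues j
  have hdich : |a| < c ∨ σ / 2 < a := by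
    rcases hσ k with h | h
    · left; rw [h] at hk'; rw [abs_lt]; constructor <;> linarith
    · right; linarith
  have hσ2 : 0 < 4 / σ ^ 2 := by positivity
  rcases hdich with ha | ha <;> rcases hσ j with hb | hb
  · rw [abs_lt] at ha
    simp only [show ¬ c < a from by linarith, if_false]
    rw [show b = 0 from hb]; simp; positivity
  · rw [abs_lt] at ha
    simp only [show ¬ c < a from by linarith, if_false]
    have hb0 : 0 < b := by linarith
    have h1 : σ / 2 ≤ |a - b| := by rw [abs_sub_comm]; exact le_trans (by linarith) (le_abs_self _)
    rw [zero_sub, abs_neg, abs_of_pos (by positivity)]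
    calc b⁻¹ ≤ σ⁻¹ := by gcongr
      _ ≤ 4 / σ ^ 2 * (σ / 2) := by rw [inv_le_iff_one_le_mul₀ hσ0]; field_simp; norm_num
      _ ≤ _ := by gcongr
  · simp only [show c < a from by linarith, if_true]
    have ha0 : 0 < a := by linarith
    rw [show b = 0 from hb, inv_zero, sub_zero, sub_zero, abs_of_pos (by positivity), abs_of_pos ha0]
    calc a⁻¹ ≤ (σ / 2)⁻¹ := by gcongr
      _ = 4 / σ ^ 2 * (σ / 2) := by field_simp; norm_num
      _ ≤ _ := by gcongr
  · simp only [show c < a from by linarith, if_true]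
    have ha0 : 0 < a := by linarith
    have hb0 : 0 < b := by linarith
    have e : a⁻¹ - b⁻¹ = (a⁻¹ * b⁻¹) * (b - a) := by field_simp
    rw [e, abs_mul, abs_of_pos (by positivity), abs_sub_comm]
    gcongr
    calc a⁻¹ * b⁻¹ ≤ (σ / 2)⁻¹ * σ⁻¹ := by gcongr
      _ ≤ 4 / σ ^ 2 := by field_simp; norm_num

/-- If the limit matrix `B` vanishes, then no eigenvalue of `A` reaches the threshold. -/
lemma thresholdedInv_eq_zero (hA : A.IsHermitian) (hB : B.IsHermitian) {c : ℝ} (hc : 0 < c)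
    (h0 : ∀ j, hB.eigenvalues j = 0) (hAB : frobSq (A - B) < c ^ 2) :
    thresholdedInv c hA = 0 := by
  have : (fun i => if c < hA.eigenvalues i then (hA.eigenvalues i)⁻¹ else 0) = 0 := by
    funext i
    obtain ⟨k, hk⟩ := exists_eigenvalue_sub_sq_le hA hB i
    have hk' := abs_lt_of_sq_lt_sq (hk.trans_lt hAB) hc.le
    rw [h0, sub_zero, abs_lt] at hk'
    simp [hk'.2.le]
  simp only [thresholdedInv, spectralMap, this]
  simp

/-! ### Measurability of the thresholded inverse -/

lemma spectralMap_congr (f : ℝ → ℝ) (hA : A.IsHermitian) (hB : B.IsHermitian) (h : A = B) :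
    spectralMap f hA = spectralMap f hB := by subst h; rfl

lemma spectralMap_apply (f : ℝ → ℝ) (hA : A.IsHermitian) (k l : Fin p) :
    spectralMap f hA k l = ∑ i, eigMat hA k i * f (hA.eigenvalues i) * eigMat hA l i := by
  simp only [spectralMap, Matrix.mul_apply (M := _ * _), Matrix.mul_diagonal,
    Matrix.transpose_apply]

lemma isHermitian_symmetrization (M : Matrix (Fin p) (Fin p) ℝ) :
    ((1 / 2 : ℝ) • (M + M.transpose)).IsHermitian := by
  ext i j
  simp [add_comm, mul_add]

/-- Symmetrizing the argument makes the spectral function a function of an arbitrary matrix. -/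
lemma continuous_spectralMap_of_lipschitz {f : ℝ → ℝ} {L : ℝ}
    (hf : ∀ s t, |f s - f t| ≤ L * |s - t|) (k l : Fin p) :
    Continuous (fun M : Fin p → Fin p → ℝ =>
      spectralMap f (isHermitian_symmetrization (Matrix.of M)) k l) := by
  rw [continuous_iff_continuousAt]
  intro M
  rw [ContinuousAt, tendsto_iff_norm_sub_tendsto_zero]
  set S : (Fin p → Fin p → ℝ) → Matrix (Fin p) (Fin p) ℝ :=
    fun M => (1 / 2 : ℝ) • (Matrix.of M + (Matrix.of M).transpose) with hS
  have hcont : Continuous (fun N => √(L ^ 2 * frobSq (S N - S M))) := by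
    simp only [frobSq, hS, Matrix.sub_apply, Matrix.smul_apply, Matrix.add_apply,
      Matrix.transpose_apply, Matrix.of_apply]
    fun_prop
  have hlim : Tendsto (fun N => √(L ^ 2 * frobSq (S N - S M))) (𝓝 M) (𝓝 0) := by
    have := hcont.tendsto M
    simpa [frobSq] using this
  refine squeeze_zero (fun _ => norm_nonneg _) (fun N => ?_) hlim
  rw [Real.norm_eq_abs]
  refine Real.abs_le_sqrt ?_
  exact (sq_le_frobSq (spectralMap f (isHermitian_symmetrization (Matrix.of N))
    - spectralMap f (isHermitian_symmetrization (Matrix.of M))) k l).trans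
    (frobSq_spectralMap_sub_le _ _ fun i j => hf _ _)

/-- The thresholded inverse depends measurably on the matrix: it is a pointwise limit of Lipschitz
spectral functions. -/
lemma measurable_thresholdedInv {Ω : Type*} [MeasurableSpace Ω]
    {M : Ω → Matrix (Fin p) (Fin p) ℝ} (hM : ∀ ω, (M ω).IsHermitian)
    (hmeas : ∀ k l, Measurable fun ω => M ω k l) {c : ℝ} (hc : 0 < c) (k l : Fin p) :
    Measurable fun ω => thresholdedInv c (hM ω) k l := by
  -- `f m` vanishes up to `c`, equals `t⁻¹` from `c + 1/m` on, and is continuous in between.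
  set f : ℕ → ℝ → ℝ := fun m t => min 1 (m * max (t - c) 0) * (max t c)⁻¹ with hf
  have hlip : ∀ m : ℕ, ∀ s t, |f m s - f m t| ≤ (m * c⁻¹ + c⁻¹ * c⁻¹) * |s - t| := by
    intro m s t
    have hs : 0 < max s c := lt_max_of_lt_right hc
    have ht : 0 < max t c := lt_max_of_lt_right hc
    have h1 : |min 1 (m * max (s - c) 0) - min 1 (m * max (t - c) 0)| ≤ m * |s - t| := by
      have := abs_min_sub_min_le_max 1 ((m : ℝ) * max (s - c) 0) 1 (m * max (t - c) 0)
      refine this.trans ?_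
      rw [sub_self, abs_zero, max_eq_right (abs_nonneg _), ← mul_sub, abs_mul, Nat.abs_cast]
      refine mul_le_mul_of_nonneg_left ?_ (Nat.cast_nonneg m)
      have := abs_max_sub_max_le_max (s - c) 0 (t - c) 0
      simpa using this
    have h2 : |(max s c)⁻¹ - (max t c)⁻¹| ≤ c⁻¹ * c⁻¹ * |s - t| := by
      have e : (max s c)⁻¹ - (max t c)⁻¹ = ((max s c)⁻¹ * (max t c)⁻¹) * (max t c - max s c) := by
        field_simp
      rw [e, abs_mul, abs_of_pos (by positivity), abs_sub_comm s t]
      refine mul_le_mul ?_ ?_ (abs_nonneg _) (by positivity)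
      · gcongr
        · exact le_max_right _ _
        · exact le_max_right _ _
      · have := abs_max_sub_max_le_max t c s c
        simpa using this
    have e : f m s - f m t = (min 1 (m * max (s - c) 0) - min 1 (m * max (t - c) 0)) * (max s c)⁻¹
        + min 1 (m * max (t - c) 0) * ((max s c)⁻¹ - (max t c)⁻¹) := by
      simp only [hf]; ring
    have h3 : |min 1 ((m : ℝ) * max (t - c) 0)| ≤ 1 := by
      rw [abs_of_nonneg (by positivity)]; exact min_le_left _ _
    rw [e]
    refine (abs_add_le _ _).trans ?_
    rw [abs_mul, abs_mul, abs_of_pos (inv_pos.2 hs), add_mul]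
    refine add_le_add ?_ ?_
    · calc _ ≤ (m * |s - t|) * c⁻¹ := by gcongr; exact le_max_right _ _
        _ = _ := by ring
    · calc _ ≤ 1 * (c⁻¹ * c⁻¹ * |s - t|) := by gcongr
        _ = _ := by ring
  have hpt : ∀ t, Tendsto (fun m => f m t) atTop (𝓝 (if c < t then t⁻¹ else 0)) := by
    intro t
    split_ifs with h
    · refine tendsto_const_nhds.congr' ?_
      obtain ⟨m₀, hm₀⟩ := exists_nat_ge (1 / (t - c))
      filter_upwards [eventually_ge_atTop m₀] with m hm
      have h1 : 1 ≤ (m : ℝ) * (t - c) := by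
        rw [div_le_iff₀ (by linarith)] at hm₀
        refine hm₀.trans ?_
        have : (m₀ : ℝ) ≤ m := by exact_mod_cast hm
        have : 0 ≤ t - c := by linarith
        gcongr
      simp only [hf]
      rw [max_eq_left (by linarith : (0 : ℝ) ≤ t - c), min_eq_left h1, max_eq_left h.le, one_mul]
    · refine tendsto_const_nhds.congr fun m => ?_
      simp only [hf]
      rw [max_eq_right (by linarith : t - c ≤ 0)]
      simp
  refine measurable_of_tendsto_metrizable (f := fun m ω => spectralMap (f m) (hM ω) k l)
    (fun m => ?_) ?_
  · have h1 := (continuous_spectralMap_of_lipschitz (hlip m) k l).measurable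
    have hMm : Measurable (fun ω k l => M ω k l) :=
      measurable_pi_iff.2 fun k => measurable_pi_iff.2 fun l => hmeas k l
    convert! h1.comp hMm using 2 with ω
    refine congrFun (congrFun (spectralMap_congr _ _ _ ?_) k) l
    have ht : (M ω).transpose = M ω := by
      simpa [Matrix.IsHermitian, Matrix.conjTranspose_eq_transpose_of_trivial] using hM ω
    change M ω = (1 / 2 : ℝ) • (M ω + (M ω).transpose)
    rw [ht, ← two_smul ℝ (M ω), smul_smul]
    norm_num
  · rw [tendsto_pi_nhds]
    intro ω
    simp only [thresholdedInv, spectralMap_apply]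
    exact tendsto_finsetSum _ fun i _ => ((hpt _).const_mul _).mul_const _

end SpectralPerturbation

/-! ### Convergence in probability of thresholded inverses -/

section ThresholdLimit

variable {p : ℕ} {Ω : Type*} [MeasurableSpace Ω] {P : Measure Ω} [IsProbabilityMeasure P]

lemma tendstoInMeasure_pi {ι κ E : Type*} [Fintype κ] [PseudoEMetricSpace E] {l : Filter ι}
    {f : ι → Ω → κ → E} {c : κ → E}
    (h : ∀ k, TendstoInMeasure P (fun n ω => f n ω k) l (fun _ => c k)) :
    TendstoInMeasure P f l (fun _ => c) := by
  intro ε hε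
  have hs : Tendsto (fun n => ∑ k, P {ω | ε ≤ edist (f n ω k) (c k)}) l (𝓝 0) := by
    simpa using tendsto_finsetSum Finset.univ fun k _ => h k ε hε
  refine tendsto_of_tendsto_of_tendsto_of_le_of_le tendsto_const_nhds hs (fun _ => zero_le)
    fun n => ?_
  refine (measure_mono ?_).trans (measure_biUnion_finset_le Finset.univ _)
  intro ω hω
  by_contra hcon
  simp only [Set.mem_iUnion, Finset.mem_univ, true_and, exists_prop, not_exists] at hcon
  rw [Set.mem_ofPred_eq] at hω
  refine absurd hω (not_le.2 ?_)
  rw [edist_pi_def, Finset.sup_lt_iff hε]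
  exact fun k _ => by simpa using hcon k

lemma _root_.MeasureTheory.TendstoInMeasure.comp_continuousAt {ι E F : Type*} [PseudoMetricSpace E]
    [PseudoMetricSpace F] {l : Filter ι} {f : ι → Ω → E} {c : E}
    (h : TendstoInMeasure P f l (fun _ => c)) {g : E → F} (hg : ContinuousAt g c) :
    TendstoInMeasure P (fun n ω => g (f n ω)) l (fun _ => g c) := by
  rw [tendstoInMeasure_iff_dist] at h ⊢
  intro ε hε
  obtain ⟨δ, hδ, hgδ⟩ := Metric.continuousAt_iff.1 hg ε hε
  refine tendsto_of_tendsto_of_tendsto_of_le_of_le tendsto_const_nhds (h δ hδ)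
    (fun _ => zero_le) fun n => measure_mono fun ω hω => ?_
  by_contra hcon
  rw [Set.mem_ofPred_eq] at hω hcon
  exact absurd hω (not_le.2 (hgδ (not_le.1 hcon)))

lemma _root_.MeasureTheory.TendstoInMeasure.prodMk_const {ι E F : Type*} [PseudoEMetricSpace E]
    [PseudoEMetricSpace F] {l : Filter ι} {f : ι → Ω → E} {g : ι → Ω → F} {c : E} {d : F}
    (hf : TendstoInMeasure P f l (fun _ => c)) (hg : TendstoInMeasure P g l (fun _ => d)) :
    TendstoInMeasure P (fun n ω => (f n ω, g n ω)) l (fun _ => (c, d)) := by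
  intro ε hε
  have hs := (hf ε hε).add (hg ε hε)
  rw [add_zero] at hs
  refine tendsto_of_tendsto_of_tendsto_of_le_of_le tendsto_const_nhds hs (fun _ => zero_le)
    fun n => ?_
  refine (measure_mono ?_).trans (measure_union_le _ _)
  intro ω hω
  simpa [Prod.edist_eq, le_max_iff] using hω

/-- The perturbation is eventually smaller than the threshold, up to small probability. -/
lemma tendsto_measure_frobSq_ge {M : ℕ → Ω → Matrix (Fin p) (Fin p) ℝ}
    {B : Matrix (Fin p) (Fin p) ℝ} {c : ℕ → ℝ} (hc : ∀ᶠ n in atTop, 0 < c n)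
    (h : ∀ k l, TendstoInMeasure P (fun n ω => (M n ω k l - B k l) / c n) atTop
      (fun _ => (0 : ℝ))) :
    Tendsto (fun n => P {ω | c n ^ 2 ≤ frobSq (M n ω - B)}) atTop (𝓝 0) := by
  have hs : Tendsto (fun n => ∑ k : Fin p, ∑ l : Fin p,
      P {ω | 1 / ((p : ℝ) + 1) ≤ dist ((M n ω k l - B k l) / c n) 0}) atTop (𝓝 0) := by
    simpa using tendsto_finsetSum Finset.univ fun k _ => tendsto_finsetSum Finset.univ fun l _ =>
      (tendstoInMeasure_iff_dist.1 (h k l)) (1 / ((p : ℝ) + 1)) (by positivity)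
  refine tendsto_of_tendsto_of_tendsto_of_le_of_le' tendsto_const_nhds hs
    (Eventually.of_forall fun _ => zero_le) ?_
  filter_upwards [hc] with n hn
  have hsub : {ω | c n ^ 2 ≤ frobSq (M n ω - B)} ⊆ ⋃ k ∈ (Finset.univ : Finset (Fin p)),
      ⋃ l ∈ (Finset.univ : Finset (Fin p)),
      {ω | 1 / ((p : ℝ) + 1) ≤ dist ((M n ω k l - B k l) / c n) 0} := by
    intro ω hω
    by_contra hcon
    simp only [Set.mem_iUnion, Finset.mem_univ, exists_prop, not_exists, true_and,
      Set.mem_ofPred_eq, not_le] at hcon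
    rw [Set.mem_ofPred_eq] at hω
    refine absurd hω (not_le.2 ?_)
    have hent : ∀ k l, (M n ω - B) k l ^ 2 ≤ (c n / (p + 1)) ^ 2 := by
      intro k l
      have h1 := hcon k l
      rw [dist_zero_right, Real.norm_eq_abs, abs_div, abs_of_pos hn, div_lt_iff₀ hn] at h1
      rw [← sq_abs]
      have : |(M n ω - B) k l| ≤ c n / (p + 1) := by
        rw [Matrix.sub_apply]; exact h1.le.trans (le_of_eq (by ring))
      gcongr
    calc frobSq (M n ω - B) ≤ ∑ _k : Fin p, ∑ _l : Fin p, (c n / (p + 1)) ^ 2 :=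
          Finset.sum_le_sum fun k _ => Finset.sum_le_sum fun l _ => hent k l
      _ = c n ^ 2 * ((p : ℝ) / (p + 1)) ^ 2 := by simp; field_simp
      _ < c n ^ 2 * 1 := by
          have : (p : ℝ) / (p + 1) < 1 := by rw [div_lt_one (by positivity)]; linarith
          have h2 : ((p : ℝ) / (p + 1)) ^ 2 < 1 := pow_lt_one₀ (by positivity) this (by norm_num)
          gcongr
      _ = c n ^ 2 := mul_one _
  exact (measure_mono hsub).trans ((measure_biUnion_finset_le _ _).trans
    (Finset.sum_le_sum fun k _ => measure_biUnion_finset_le _ _))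

/-- If the threshold tends to `0`, but slower than the estimation error, then the thresholded
inverses converge in probability to the Moore–Penrose inverse of the limit. -/
lemma tendstoInMeasure_thresholdedInv {M : ℕ → Ω → Matrix (Fin p) (Fin p) ℝ}
    (hM : ∀ n ω, (M n ω).IsHermitian) {B : Matrix (Fin p) (Fin p) ℝ} (hB : B.IsHermitian)
    (hB0 : ∀ j, 0 ≤ hB.eigenvalues j) {c : ℕ → ℝ} (hc : ∀ᶠ n in atTop, 0 < c n)
    (hc0 : Tendsto c atTop (𝓝 0))
    (h : ∀ k l, TendstoInMeasure P (fun n ω => (M n ω k l - B k l) / c n) atTop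
      (fun _ => (0 : ℝ))) (k l : Fin p) :
    TendstoInMeasure P (fun n ω => thresholdedInv (c n) (hM n ω) k l) atTop
      (fun _ => mpInverse hB k l) := by
  obtain ⟨σ, hσ0, hσ⟩ : ∃ σ : ℝ, 0 < σ ∧ ∀ j, hB.eigenvalues j = 0 ∨ σ ≤ hB.eigenvalues j := by
    have hfin : ∀ᶠ σ in 𝓝[>] (0 : ℝ), ∀ j, hB.eigenvalues j = 0 ∨ σ ≤ hB.eigenvalues j := by
      rw [eventually_all]
      intro j
      rcases (hB0 j).eq_or_lt with hj | hj
      · exact Eventually.of_forall fun _ => Or.inl hj.symm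
      · filter_upwards [Ioo_mem_nhdsGT hj] with σ hσ using Or.inr hσ.2.le
    obtain ⟨σ, h1, h2⟩ := (hfin.and self_mem_nhdsWithin).exists
    exact ⟨σ, h2, h1⟩
  rw [tendstoInMeasure_iff_dist]
  intro δ hδ
  refine tendsto_of_tendsto_of_tendsto_of_le_of_le' tendsto_const_nhds
    (tendsto_measure_frobSq_ge hc h) (Eventually.of_forall fun _ => zero_le) ?_
  have hc1 : ∀ᶠ n in atTop, c n < σ / 2 := hc0.eventually_lt_const (by positivity)
  have hc2 : ∀ᶠ n in atTop, 4 / σ ^ 2 * c n < δ := by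
    have := hc0.const_mul (4 / σ ^ 2)
    rw [mul_zero] at this
    exact this.eventually_lt_const hδ
  filter_upwards [hc, hc1, hc2] with n hn hn1 hn2
  refine measure_mono fun ω hω => ?_
  by_contra hcon
  rw [Set.mem_ofPred_eq, not_le] at hcon
  have h1 := frobSq_thresholdedInv_sub_mpInverse_le (hM n ω) hB hn hn1.le hσ hcon
  have h2 := (sq_le_frobSq (thresholdedInv (c n) (hM n ω) - mpInverse hB) k l).trans h1
  have h3 : (thresholdedInv (c n) (hM n ω) - mpInverse hB) k l ^ 2 < δ ^ 2 := by
    refine h2.trans_lt ?_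
    calc _ ≤ (4 / σ ^ 2) ^ 2 * c n ^ 2 := by gcongr
      _ = (4 / σ ^ 2 * c n) ^ 2 := by ring
      _ < δ ^ 2 := by gcongr
  have h4 := abs_lt_of_sq_lt_sq h3 hδ.le
  rw [Set.mem_ofPred_eq, Real.dist_eq] at hω
  exact absurd hω (not_le.2 h4)

/-! ### Square roots of a positive semidefinite matrix and of its Moore–Penrose inverse -/

/-- A positive semidefinite matrix of rank `r` and its Moore–Penrose inverse have square roots with
`r` columns that are inverse to each other. -/
lemma exists_sqrt_mpInverse {A : Matrix (Fin p) (Fin p) ℝ} (hA : A.IsHermitian)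
    (h0 : ∀ j, 0 ≤ hA.eigenvalues j) :
    ∃ M N : Matrix (Fin p) (Fin A.rank) ℝ, M * M.transpose = A ∧
      N * N.transpose = mpInverse hA ∧ N.transpose * M = 1 := by
  have hcard : Fintype.card {i // hA.eigenvalues i ≠ 0} = Fintype.card (Fin A.rank) := by
    rw [Fintype.card_fin, hA.rank_eq_card_non_zero_eigs]
  set e : Fin A.rank ≃ {i // hA.eigenvalues i ≠ 0} := (Fintype.equivOfCardEq hcard).symm with he
  set lam := hA.eigenvalues with hlam
  have hpos : ∀ j, 0 < lam (e j) := fun j => lt_of_le_of_ne (h0 _) (Ne.symm (e j).2)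
  have hsum : ∀ f : Fin p → ℝ, (∀ i, lam i = 0 → f i = 0) → ∑ j, f (e j) = ∑ i, f i := by
    intro f hf
    rw [e.sum_comp (fun i : {i // lam i ≠ 0} => f i),
      ← Finset.sum_subtype (Finset.univ.filter fun i => lam i ≠ 0) (by simp) f]
    refine Finset.sum_filter_of_ne fun i _ hi h => hi (hf i h)
  refine ⟨Matrix.of fun k j => eigMat hA k (e j) * √(lam (e j)),
    Matrix.of fun k j => eigMat hA k (e j) * (√(lam (e j)))⁻¹, ?_, ?_, ?_⟩
  · conv_rhs => rw [← spectralMap_id hA]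
    ext k l
    rw [spectralMap_apply, ← hsum _ (fun i hi => by simp [← hlam, hi]), Matrix.mul_apply]
    refine Finset.sum_congr rfl fun j _ => ?_
    simp only [Matrix.of_apply, Matrix.transpose_apply]
    have := Real.mul_self_sqrt (hpos j).le
    linear_combination (eigMat hA k (e j) * eigMat hA l (e j)) * this
  · ext k l
    rw [mpInverse, spectralMap_apply, ← hsum _ (fun i hi => by simp [← hlam, hi]),
      Matrix.mul_apply]
    refine Finset.sum_congr rfl fun j _ => ?_
    simp only [Matrix.of_apply, Matrix.transpose_apply]
    have : (√(lam (e j)))⁻¹ * (√(lam (e j)))⁻¹ = (lam (e j))⁻¹ := by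
      rw [← mul_inv, Real.mul_self_sqrt (hpos j).le]
    linear_combination (eigMat hA k (e j) * eigMat hA l (e j)) * this
  · ext j j'
    have h1 := congrFun (congrFun (eigMat_transpose_mul hA) (e j)) (e j')
    rw [Matrix.mul_apply] at h1 ⊢
    simp only [Matrix.of_apply, Matrix.transpose_apply] at h1 ⊢
    have h2 : ∑ k, eigMat hA k (e j) * (√(lam (e j)))⁻¹ * (eigMat hA k (e j') * √(lam (e j')))
        = (√(lam (e j)))⁻¹ * √(lam (e j')) * ∑ k, eigMat hA k (e j) * eigMat hA k (e j') := by
      rw [Finset.mul_sum]; exact Finset.sum_congr rfl fun k _ => by ring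
    rw [h2, h1]
    by_cases hj : j = j'
    · subst hj
      simp [inv_mul_cancel₀ (Real.sqrt_pos.2 (hpos j)).ne']
    · have : (e j : Fin p) ≠ e j' := fun h => hj (e.injective (Subtype.ext h))
      simp [hj, this]

lemma quadForm_eq_sum_sq {r : ℕ} {A : Matrix (Fin p) (Fin p) ℝ} {N : Matrix (Fin p) (Fin r) ℝ}
    (hN : N * N.transpose = A) (v : EuclideanSpace ℝ (Fin p)) :
    quadForm A v = ∑ j, (∑ k, N k j * v k) ^ 2 := by
  subst hN
  simp only [quadForm, Matrix.mul_apply, Matrix.transpose_apply, pow_two,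
    Finset.mul_sum, Finset.sum_mul]
  calc _ = ∑ k, ∑ j, ∑ l, v k * (N k j * N l j) * v l :=
        Finset.sum_congr rfl fun k _ => Finset.sum_comm
    _ = ∑ j, ∑ k, ∑ l, v k * (N k j * N l j) * v l := Finset.sum_comm
    _ = _ := Finset.sum_congr rfl fun j _ => Finset.sum_congr rfl fun k _ =>
        Finset.sum_congr rfl fun l _ => by ring

/-- The quadratic form of the Moore–Penrose inverse is positive off the kernel. -/
lemma quadForm_mpInverse_pos {A : Matrix (Fin p) (Fin p) ℝ} (hA : A.IsHermitian)
    (h0 : ∀ j, 0 ≤ hA.eigenvalues j) {v : EuclideanSpace ℝ (Fin p)}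
    (hv : v ∉ Module.End.eigenspace (Matrix.toEuclideanLin A) 0) :
    0 < quadForm (mpInverse hA) v := by
  obtain ⟨M, N, -, hN, -⟩ := exists_sqrt_mpInverse hA h0
  rw [quadForm_eq_sum_sq hN]
  refine lt_of_le_of_ne (by positivity) fun hcon => hv ?_
  have hz : N.transpose.mulVec v = 0 := by
    funext j
    have := (Finset.sum_eq_zero_iff_of_nonneg (fun j _ => sq_nonneg _)).1 hcon.symm j
      (Finset.mem_univ j)
    simpa [Matrix.mulVec, dotProduct] using this
  have h1 : (mpInverse hA).mulVec v = 0 := by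
    rw [← hN, ← Matrix.mulVec_mulVec, hz, Matrix.mulVec_zero]
  have hcomm : A * mpInverse hA = mpInverse hA * A := by
    have e1 := spectralMap_mul (fun t => t) (fun t => t⁻¹) hA
    have e2 := spectralMap_mul (fun t => t⁻¹) (fun t => t) hA
    rw [spectralMap_id] at e1 e2
    rw [mpInverse, e1, e2]
    simp only [mul_comm]
  have h2 : A.mulVec v = 0 := by
    have := (isMoorePenrose_mpInverse hA).mul_mul_left
    rw [← this, Matrix.mul_assoc, ← hcomm, ← Matrix.mulVec_mulVec, ← Matrix.mulVec_mulVec, h1]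
    simp
  rw [Module.End.mem_eigenspace_iff, zero_smul]
  ext k
  simpa [Matrix.toEuclideanLin] using congrFun h2 k

end ThresholdLimit

/-! ### Noncentral chi-squared laws -/

section ChiSq

/-- Rotational invariance: the law of `‖ξ + m‖²` depends on `m` only through `‖m‖`. -/
lemma map_stdGaussian_norm_add_sq (r : ℕ) (m : EuclideanSpace ℝ (Fin r)) :
    (stdGaussian (EuclideanSpace ℝ (Fin r))).map (fun ξ => ‖ξ + m‖ ^ 2)
      = ncChiSq r (‖m‖ ^ 2) := by
  set m' : EuclideanSpace ℝ (Fin r) := WithLp.toLp 2 fun _ => √(‖m‖ ^ 2 / r) with hm'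
  have hnorm : ‖m‖ = ‖m'‖ := by
    rw [← sq_eq_sq₀ (norm_nonneg _) (norm_nonneg _), EuclideanSpace.norm_sq_eq m']
    simp only [hm', Real.norm_eq_abs, sq_abs]
    rw [Finset.sum_const, Finset.card_univ, Fintype.card_fin, nsmul_eq_mul,
      Real.sq_sqrt (by positivity)]
    rcases Nat.eq_zero_or_pos r with rfl | hr
    · simp [Subsingleton.elim m 0]
    · field_simp
  set R := (ℝ ∙ (m - m'))ᗮ.reflection with hR
  have hRm : R m = m' := Submodule.reflection_sub hnorm
  have h1 : (fun ξ => ‖ξ + m‖ ^ 2) = (fun ξ => ‖ξ + m'‖ ^ 2) ∘ R := by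
    funext ξ
    simp only [Function.comp]
    rw [← hRm, ← map_add, LinearIsometryEquiv.norm_map]
  rw [h1, ← Measure.map_map (by fun_prop) (by fun_prop), stdGaussian_map,
    ← map_pi_eq_stdGaussian, Measure.map_map (by fun_prop) (by fun_prop), ncChiSq]
  congr 1
  funext ξ
  simp [EuclideanSpace.norm_sq_eq, hm']

lemma chiSq_eq_ncChiSq_zero (r : ℕ) : chiSq r = ncChiSq r 0 := by
  simp [chiSq, ncChiSq]

instance (r : ℕ) (θ : ℝ) : IsProbabilityMeasure (ncChiSq r θ) :=
  Measure.isProbabilityMeasure_map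
    (by exact (show Measurable fun ξ : Fin r → ℝ => ∑ k, (ξ k + √(θ / r)) ^ 2
      by fun_prop).aemeasurable)

/-- For `r ≥ 1` degrees of freedom there are no atoms: fixing all coordinates but one leaves at
most two points of a given value. -/
lemma ncChiSq_singleton {r : ℕ} (hr : r ≠ 0) (θ y : ℝ) : ncChiSq r θ {y} = 0 := by
  obtain ⟨s, rfl⟩ := Nat.exists_eq_succ_of_ne_zero hr
  generalize hc : √(θ / (s.succ : ℕ)) = c
  have hmeas : Measurable fun ξ : Fin (s + 1) → ℝ => ∑ k, (ξ k + c) ^ 2 := by fun_prop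
  rw [ncChiSq, hc, Measure.map_apply hmeas (measurableSet_singleton y)]
  have hmp := measurePreserving_piFinSuccAbove (fun _ : Fin (s + 1) => gaussianReal 0 1) 0
  set T : Set (ℝ × (Fin s → ℝ)) := {x | (x.1 + c) ^ 2 + ∑ k, (x.2 k + c) ^ 2 = y} with hT
  have hTm : MeasurableSet T := measurableSet_eq_fun (by fun_prop) measurable_const
  have hpre : (fun ξ : Fin (s + 1) → ℝ => ∑ k, (ξ k + c) ^ 2) ⁻¹' {y}
      = MeasurableEquiv.piFinSuccAbove (fun _ => ℝ) 0 ⁻¹' T := by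
    ext ξ
    simp [hT, Fin.sum_univ_succ, MeasurableEquiv.piFinSuccAbove, Fin.tail]
  have : NullSingletonClass (gaussianReal 0 1) := nullSingletonClass_gaussianReal (by norm_num)
  rw [hpre, hmp.measure_preimage hTm.nullMeasurableSet, Measure.prod_apply_symm hTm]
  refine lintegral_eq_zero_of_ae_eq_zero (Eventually.of_forall fun w => ?_)
  set u := √(y - ∑ k, (w k + c) ^ 2) with hu
  refine measure_mono_null (t := {-c + u, -c - u}) ?_ (Set.Finite.measure_zero (by simp) _)
  intro x hx
  rw [Set.mem_preimage, hT, Set.mem_ofPred_eq] at hx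
  have h1 : (x + c) ^ 2 = y - ∑ k, (w k + c) ^ 2 := by linarith
  have h2 : (x + c) ^ 2 = u ^ 2 := by rw [hu, ← h1, Real.sq_sqrt (sq_nonneg _)]
  rcases sq_eq_sq_iff_eq_or_eq_neg.1 h2 with h | h
  · left; linarith
  · right; rw [Set.mem_singleton_iff]; linarith

/-- The quantiles of the point mass at `0` are nonnegative. -/
lemma chiSqQuantile_zero_nonneg {t : ℝ} (ht : 0 < t) : 0 ≤ chiSqQuantile 0 t := by
  refine Real.sInf_nonneg fun y hy => ?_
  by_contra! hneg
  have h0 : cdf (chiSq 0) y = 0 := by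
    rw [cdf_eq_real, chiSq, measureReal_def, Measure.map_apply (by fun_prop) measurableSet_Iic]
    have : (fun ξ : Fin 0 → ℝ => ∑ k, ξ k ^ 2) ⁻¹' Set.Iic y = ∅ := by
      ext ξ; simpa using hneg
    rw [this]; simp
  rw [Set.mem_ofPred_eq, h0] at hy
  linarith

lemma ncChiSq_zero_Ioi {q : ℝ} (hq : 0 ≤ q) (θ : ℝ) : ncChiSq 0 θ {y | q < y} = 0 := by
  have hm : MeasurableSet {y : ℝ | q < y} := measurableSet_Ioi
  rw [ncChiSq, Measure.map_apply (by fun_prop) hm]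
  have : (fun ξ : Fin 0 → ℝ => ∑ k, (ξ k + √(θ / (0 : ℕ))) ^ 2) ⁻¹' {y | q < y} = ∅ := by
    ext ξ; simpa using hq
  rw [this]; simp

end ChiSq

/-! ### The multivariate central limit theorem -/

section CLT

variable {Ω X : Type*} [MeasurableSpace Ω] [MeasurableSpace X] {P : Measure Ω}
  [IsProbabilityMeasure P] {μ : Measure X} [IsProbabilityMeasure μ] {D : ℕ → Ω → X} {p r : ℕ}

/-- By the criterion of characteristic functions, the central limit theorem for vectors follows
from the one for their linear combinations. The limit law is written as that of `M ξ` with a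
standard Gaussian vector `ξ`, where `M M'` is the covariance matrix. -/
theorem IIDSeq.tendstoInDistribution_sum (hD : IIDSeq P D μ) {Y : Fin p → X → ℝ}
    (hYm : ∀ k, Measurable (Y k)) (hY2 : ∀ k, MemLp (Y k) 2 μ) (hY0 : ∀ k, ∫ x, Y k x ∂μ = 0)
    {M : Matrix (Fin p) (Fin r) ℝ}
    (hM : ∀ k l, (M * M.transpose) k l = ∫ x, Y k x * Y l x ∂μ) :
    TendstoInDistribution
      (fun (n : ℕ) ω k => (√(n : ℝ))⁻¹ * ∑ i ∈ Finset.range n, Y k (D i ω)) atTop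
      (fun ξ : EuclideanSpace ℝ (Fin r) => M.mulVec ξ) (fun _ => P)
      (stdGaussian (EuclideanSpace ℝ (Fin r))) := by
  have hDm := hD.measurable
  set S : ℕ → Ω → EuclideanSpace ℝ (Fin p) := fun n ω =>
    WithLp.toLp 2 fun k => (√(n : ℝ))⁻¹ * ∑ i ∈ Finset.range n, Y k (D i ω) with hS
  have hSm : ∀ n, Measurable (S n) := fun n => by
    refine (WithLp.measurable_toLp 2 _).comp (measurable_pi_iff.2 fun k => ?_)
    exact (Finset.measurable_sum _ fun i _ => (hYm k).comp (hDm i)).const_mul _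
  set Z : EuclideanSpace ℝ (Fin r) → EuclideanSpace ℝ (Fin p) := fun ξ =>
    WithLp.toLp 2 (M.mulVec ξ) with hZ
  have hZm : Measurable Z := by
    refine (WithLp.measurable_toLp 2 _).comp (measurable_pi_iff.2 fun k => ?_)
    simp only [Matrix.mulVec, dotProduct]
    fun_prop
  have key : TendstoInDistribution S atTop Z (fun _ => P)
      (stdGaussian (EuclideanSpace ℝ (Fin r))) := by
    refine ⟨fun n => (hSm n).aemeasurable, hZm.aemeasurable, ?_⟩
    refine ProbabilityMeasure.tendsto_iff_tendsto_charFun.2 fun t => ?_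
    -- The linear combination with coefficients `t`.
    set X' : ℕ → Ω → ℝ := fun i ω => ∑ k, t k * Y k (D i ω) with hX'
    set φ : X → ℝ := fun x => ∑ k, t k * Y k x with hφ
    have hφm : Measurable φ := by fun_prop
    have hφ2 : MemLp φ 2 μ := memLp_finsetSum _ fun k _ => (hY2 k).const_mul (t k)
    have hφ0 : ∫ x, φ x ∂μ = 0 := by
      simp only [hφ]
      rw [integral_finsetSum _ fun k _ => ((hY2 k).integrable (by norm_num)).const_mul _]
      simp [integral_const_mul, hY0]
    have hind : iIndepFun X' P := hD.indep.comp (fun _ => φ) fun _ => hφm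
    have hid : ∀ i, IdentDistrib (X' i) (X' 0) P P := fun i =>
      IdentDistrib.comp (u := φ) ⟨(hDm i).aemeasurable, (hDm 0).aemeasurable,
        by rw [hD.law, hD.law]⟩ hφm
    have hX2 : MemLp (X' 0) 2 P := hφ2.comp_measurePreserving (hD.measurePreserving 0)
    have hX0 : ∫ ω, X' 0 ω ∂P = 0 := by
      rw [← hφ0, ← hD.law 0, integral_map (hDm 0).aemeasurable hφm.aestronglyMeasurable]
    set s : EuclideanSpace ℝ (Fin r) := WithLp.toLp 2 (M.transpose.mulVec t) with hs
    have hvar : Var[X' 0; P] = ‖s‖ ^ 2 := by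
      have hXm : AEMeasurable (X' 0) P := (hφm.comp (hDm 0)).aemeasurable
      rw [variance_of_integral_eq_zero hXm hX0]
      have e1 : ∫ ω, X' 0 ω ^ 2 ∂P = ∫ x, φ x ^ 2 ∂μ := hD.integral_comp_sq hφm 0
      have e2 : ∫ x, φ x ^ 2 ∂μ = ∑ k, ∑ l, t k * t l * (M * M.transpose) k l := by
        have := integral_sum_sq (P := μ) Finset.univ (fun k x => t k * Y k x)
          fun k _ => (hY2 k).const_mul (t k)
        simp only [hφ]
        rw [this]
        refine Finset.sum_congr rfl fun k _ => Finset.sum_congr rfl fun l _ => ?_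
        rw [hM, ← integral_const_mul]
        congr 1
        funext x
        ring
      have e3 := quadForm_eq_sum_sq (rfl : M * M.transpose = M * M.transpose) t
      rw [EuclideanSpace.norm_sq_eq]
      simp only [hs, Real.norm_eq_abs, sq_abs, Matrix.mulVec, dotProduct, Matrix.transpose_apply]
      rw [← e3]
      refine (e1.trans e2).trans ?_
      simp only [quadForm]
      exact Finset.sum_congr rfl fun k _ => Finset.sum_congr rfl fun l _ => by ring
    have hclt := tendstoInDistribution_inv_sqrt_mul_sum_sub
      (Y := id) (P' := gaussianReal 0 Var[X' 0; P].toNNReal) HasLaw.id hX2 hind hid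
    have hchar := (ProbabilityMeasure.tendsto_iff_tendsto_charFun.1 hclt.tendsto) 1
    simp only [ProbabilityMeasure.coe_mk, Measure.map_id, charFun_gaussianReal] at hchar
    have hL : charFun ((stdGaussian (EuclideanSpace ℝ (Fin r))).map Z) t
        = Complex.exp (-(‖s‖ : ℂ) ^ 2 / 2) := by
      rw [← charFun_stdGaussian, charFun_apply, charFun_apply,
        integral_map hZm.aemeasurable (by fun_prop)]
      congr 1
      funext ξ
      congr 3
      simp only [hZ, hs, PiLp.inner_apply, Matrix.mulVec, dotProduct, Matrix.transpose_apply,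
        RCLike.inner_apply, conj_trivial, Finset.mul_sum, Finset.sum_mul]
      rw [Finset.sum_comm]
      exact Finset.sum_congr rfl fun k _ => Finset.sum_congr rfl fun l _ => by ring
    simp only [ProbabilityMeasure.coe_mk]
    rw [hL]
    convert! hchar using 2
    · rename_i n
      rw [charFun_apply, charFun_apply, integral_map (hSm n).aemeasurable (by fun_prop),
        integral_map _ (by fun_prop)]
      · congr 1
        funext ω
        congr 3
        simp only [hX0, mul_zero, sub_zero]
        simp only [hS, PiLp.inner_apply, RCLike.inner_apply, conj_trivial, hX', one_mul,
          Finset.mul_sum]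
        rw [Finset.sum_comm]
        exact Finset.sum_congr rfl fun k _ => Finset.sum_congr rfl fun l _ => by ring
      · exact ((Finset.measurable_sum _ fun i _ => hφm.comp (hDm i)).sub_const _ |>.const_mul
          _).aemeasurable
    · rw [hvar]
      simp [neg_div]
  exact key.continuous_comp (g := WithLp.ofLp) (PiLp.continuous_ofLp 2 _)

end CLT

/-! ### Limit laws of Wald statistics -/

section Wald

variable {Ω : Type*} [MeasurableSpace Ω] {P : Measure Ω} [IsProbabilityMeasure P] {p : ℕ}

lemma quadForm_smul (A : Matrix (Fin p) (Fin p) ℝ) (c : ℝ) (v : EuclideanSpace ℝ (Fin p)) :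
    quadForm A (c • v) = c ^ 2 * quadForm A v := by
  simp only [quadForm, Finset.mul_sum, PiLp.smul_apply, smul_eq_mul]
  exact Finset.sum_congr rfl fun k _ => Finset.sum_congr rfl fun l _ => by ring

lemma continuous_quadForm : Continuous fun x : (Fin p → ℝ) × (Fin p → Fin p → ℝ) =>
    quadForm (Matrix.of x.2) (WithLp.toLp 2 x.1) := by
  simp only [quadForm, Matrix.of_apply]
  fun_prop

/-- If `√n δ_n` converges to a Gaussian vector with mean `a` and covariance matrix `B`, and `A_n`
converges in probability to the Moore–Penrose inverse of `B`, then `n δ_n' A_n δ_n` converges to a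
noncentral `χ²` law. -/
theorem tendstoInDistribution_wald {B : Matrix (Fin p) (Fin p) ℝ} (hB : B.IsHermitian)
    {r : ℕ} {M N : Matrix (Fin p) (Fin r) ℝ}
    (hN : N * N.transpose = mpInverse hB) (hNM : N.transpose * M = 1)
    (a : EuclideanSpace ℝ (Fin p)) {δ : ℕ → Ω → EuclideanSpace ℝ (Fin p)}
    (hδ : TendstoInDistribution (fun (n : ℕ) ω k => √(n : ℝ) * δ n ω k) atTop
      (fun ξ : EuclideanSpace ℝ (Fin r) => M.mulVec ξ + a.ofLp) (fun _ => P)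
      (stdGaussian (EuclideanSpace ℝ (Fin r))))
    {A : ℕ → Ω → Matrix (Fin p) (Fin p) ℝ} (hAm : ∀ n k l, AEMeasurable (fun ω => A n ω k l) P)
    (hA : ∀ k l, TendstoInMeasure P (fun n ω => A n ω k l) atTop (fun _ => mpInverse hB k l)) :
    TendstoInDistribution (fun (n : ℕ) ω => n * quadForm (A n ω) (δ n ω)) atTop id (fun _ => P)
      (ncChiSq r (quadForm (mpInverse hB) a)) := by
  have hpi : TendstoInMeasure P (fun n ω (k l : Fin p) => A n ω k l) atTop
      (fun _ k l => mpInverse hB k l) :=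
    tendstoInMeasure_pi fun k => tendstoInMeasure_pi fun l => hA k l
  have h1 := hδ.continuous_comp_prodMk_of_tendstoInMeasure_const continuous_quadForm hpi
    (fun n => aemeasurable_pi_iff.2 fun k => aemeasurable_pi_iff.2 fun l => hAm n k l)
  set m : EuclideanSpace ℝ (Fin r) := WithLp.toLp 2 (N.transpose.mulVec a) with hm
  have hlim : (fun ξ : EuclideanSpace ℝ (Fin r) =>
      quadForm (Matrix.of fun k l => mpInverse hB k l) (WithLp.toLp 2 (M.mulVec ξ + a.ofLp)))
      = fun ξ => ‖ξ + m‖ ^ 2 := by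
    funext ξ
    have e : (Matrix.of fun k l => mpInverse hB k l) = mpInverse hB := rfl
    rw [e, quadForm_eq_sum_sq hN, EuclideanSpace.norm_sq_eq]
    refine Finset.sum_congr rfl fun j _ => ?_
    rw [Real.norm_eq_abs, sq_abs]
    congr 1
    have e2 : N.transpose.mulVec (M.mulVec ξ + a.ofLp) = ξ.ofLp + N.transpose.mulVec a := by
      rw [Matrix.mulVec_add, Matrix.mulVec_mulVec, hNM, Matrix.one_mulVec]
    have e3 := congrFun e2 j
    simpa [Matrix.mulVec, dotProduct, hm] using e3
  have hθ : quadForm (mpInverse hB) a = ‖m‖ ^ 2 := by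
    rw [quadForm_eq_sum_sq hN, EuclideanSpace.norm_sq_eq]
    refine Finset.sum_congr rfl fun j _ => ?_
    rw [Real.norm_eq_abs, sq_abs]
    simp [Matrix.mulVec, dotProduct, hm]
  have hseq : ∀ n ω, quadForm (Matrix.of fun k l => A n ω k l)
      (WithLp.toLp 2 fun k => √(n : ℝ) * δ n ω k) = n * quadForm (A n ω) (δ n ω) := by
    intro n ω
    have e : (WithLp.toLp 2 fun k => √(n : ℝ) * δ n ω k) = √(n : ℝ) • δ n ω := by
      ext k; simp
    have e2 : (Matrix.of fun k l => A n ω k l) = A n ω := rfl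
    rw [e, e2, quadForm_smul, Real.sq_sqrt (Nat.cast_nonneg n)]
  simp only [hseq] at h1
  have hlaw : (stdGaussian (EuclideanSpace ℝ (Fin r))).map (fun ξ : EuclideanSpace ℝ (Fin r) =>
      quadForm (Matrix.of fun k l => mpInverse hB k l) (WithLp.toLp 2 (M.mulVec ξ + a.ofLp)))
      = (ncChiSq r (quadForm (mpInverse hB) a)).map id := by
    rw [hlim, map_stdGaussian_norm_add_sq, hθ, Measure.map_id]
  refine ⟨h1.forall_aemeasurable, aemeasurable_id, ?_⟩
  have h2 := h1.tendsto
  convert! h2 using 2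
  exact congrArg 𝓝 (Subtype.ext hlaw.symm)

/-- If `δ_n` converges in probability to a vector at which the limit of the quadratic forms `A_n`
is positive, then `n δ_n' A_n δ_n` exceeds every bound with probability tending to one. -/
theorem tendsto_measure_lt_wald {δ : ℕ → Ω → EuclideanSpace ℝ (Fin p)}
    {d : EuclideanSpace ℝ (Fin p)}
    (hδ : ∀ k, TendstoInMeasure P (fun n ω => δ n ω k) atTop (fun _ => d k))
    {A : ℕ → Ω → Matrix (Fin p) (Fin p) ℝ} {A₀ : Matrix (Fin p) (Fin p) ℝ}
    (hA : ∀ k l, TendstoInMeasure P (fun n ω => A n ω k l) atTop (fun _ => A₀ k l))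
    (hpos : 0 < quadForm A₀ d) (hmeas : ∀ n, AEMeasurable (fun ω => quadForm (A n ω) (δ n ω)) P)
    (y : ℝ) :
    Tendsto (fun n : ℕ => P {ω | y < n * quadForm (A n ω) (δ n ω)}) atTop (𝓝 1) := by
  have hq : TendstoInMeasure P (fun n ω => quadForm (A n ω) (δ n ω)) atTop
      (fun _ => quadForm A₀ d) := by
    have h1 : TendstoInMeasure P (fun n ω k => δ n ω k) atTop (fun _ k => d k) :=
      tendstoInMeasure_pi hδ
    have h2 : TendstoInMeasure P (fun n ω k l => A n ω k l) atTop (fun _ k l => A₀ k l) :=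
      tendstoInMeasure_pi fun k => tendstoInMeasure_pi fun l => hA k l
    set g := fun x : (Fin p → ℝ) × (Fin p → Fin p → ℝ) =>
      quadForm (Matrix.of x.2) (WithLp.toLp 2 x.1) with hg
    have h3 := (h1.prodMk_const h2).comp_continuousAt (g := g) continuous_quadForm.continuousAt
    have e1 : ∀ n ω, g (fun k => δ n ω k, fun k l => A n ω k l) = quadForm (A n ω) (δ n ω) :=
      fun n ω => rfl
    have e2 : g (fun k => d k, fun k l => A₀ k l) = quadForm A₀ d := rfl
    simp only [e1, e2] at h3
    exact h3
  set κ := quadForm A₀ d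
  have hbad := tendstoInMeasure_iff_dist.1 hq (κ / 2) (by positivity)
  have hgood : Tendsto (fun n => 1 - P {ω | κ / 2 ≤ dist (quadForm (A n ω) (δ n ω)) κ}) atTop
      (𝓝 1) := by
    have := ENNReal.Tendsto.sub (tendsto_const_nhds (x := (1 : ENNReal))) hbad (Or.inl (by simp))
    simpa using this
  refine tendsto_of_tendsto_of_tendsto_of_le_of_le' hgood tendsto_const_nhds ?_
    (Eventually.of_forall fun n => prob_le_one)
  have hev : ∀ᶠ n : ℕ in atTop, y < n * (κ / 2) := by
    have : Tendsto (fun n : ℕ => (n : ℝ) * (κ / 2)) atTop atTop :=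
      tendsto_natCast_atTop_atTop.atTop_mul_const (by positivity)
    exact this.eventually_gt_atTop y
  filter_upwards [hev] with n hn
  have hset : NullMeasurableSet {ω | κ / 2 ≤ dist (quadForm (A n ω) (δ n ω)) κ} P :=
    nullMeasurableSet_le aemeasurable_const ((hmeas n).dist aemeasurable_const)
  rw [← prob_compl_eq_one_sub₀ hset]
  refine measure_mono fun ω hω => ?_
  rw [Set.mem_compl_iff, Set.mem_ofPred_eq, not_le, Real.dist_eq, abs_lt] at hω
  rw [Set.mem_ofPred_eq]
  refine hn.trans_le ?_
  gcongr
  linarith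

end Wald

/-! ### The weighting function -/

section Weight

variable {q : ℕ} {ν : Measure (EuclideanSpace ℝ (Fin q))}

lemma kernelK_neg (z : EuclideanSpace ℝ (Fin q)) : kernelK ν (-z) = kernelK ν z := by
  simp [kernelK, inner_neg_left]

/-- `K` is measurable. For infinite `ν` the density `min(1, ‖s‖^α)` is moved from the integrand to
the measure, which makes the measure finite; at `s = 0` the integrand vanishes. -/
lemma IsIntegratingMeasure.measurable_kernelK (hν : IsIntegratingMeasure ν) :
    Measurable (kernelK ν) := by
  rcases hν.integrability with hfin | ⟨α, hα, -, hint⟩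
  · have h : StronglyMeasurable fun z : EuclideanSpace ℝ (Fin q) =>
        ∫ s, (1 - Real.cos (inner ℝ z s)) ∂ν :=
      StronglyMeasurable.integral_prod_right (f := fun z s => 1 - Real.cos (inner ℝ z s))
        (Measurable.stronglyMeasurable (by unfold Function.uncurry; fun_prop))
    exact h.measurable
  · set w : EuclideanSpace ℝ (Fin q) → NNReal := fun s => (min 1 (‖s‖ ^ α)).toNNReal with hw
    have hwm : Measurable w := by fun_prop
    have hfin : IsFiniteMeasure (ν.withDensity fun s => (w s : ENNReal)) :=
      isFiniteMeasure_withDensity hint.ne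
    have h : StronglyMeasurable fun z : EuclideanSpace ℝ (Fin q) =>
        ∫ s, ((w s : ℝ)⁻¹ * (1 - Real.cos (inner ℝ z s)))
          ∂(ν.withDensity fun s => (w s : ENNReal)) :=
      StronglyMeasurable.integral_prod_right
        (f := fun z s => (w s : ℝ)⁻¹ * (1 - Real.cos (inner ℝ z s)))
        (Measurable.stronglyMeasurable (by unfold Function.uncurry; fun_prop))
    convert! h.measurable using 1
    funext z
    rw [integral_withDensity_eq_integral_smul hwm, kernelK]
    congr 1
    funext s
    rw [NNReal.smul_def, smul_eq_mul]
    by_cases hs : s = 0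
    · simp [hs]
    · have h1 : 0 < min 1 (‖s‖ ^ α) := lt_min one_pos (Real.rpow_pos_of_pos (norm_pos_iff.2 hs) _)
      have h2 : (w s : ℝ) ≠ 0 := by
        simp only [hw]; rw [Real.coe_toNNReal _ h1.le]; exact h1.ne'
      field_simp

end Weight

/-! ### Conditional means -/

section CondMean

variable {p q : ℕ} {μ : Measure (Obs p q)} [IsProbabilityMeasure μ]
  {K : EuclideanSpace ℝ (Fin q) → ℝ}

lemma sigmaZ_le : sigmaZ p q ≤ (inferInstance : MeasurableSpace (Obs p q)) :=
  Measurable.comap_le (by fun_prop)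

/-- Functions of `Z` are uncorrelated with `U` under the null hypothesis. -/
lemma NullHypothesis.integral_mul_eq_zero (h : NullHypothesis μ)
    (hU : Integrable Obs.U μ) {φ : EuclideanSpace ℝ (Fin q) → ℝ} (hφ : Measurable φ)
    (hi : Integrable (fun e : Obs p q => φ e.Z * e.U) μ) :
    ∫ e : Obs p q, φ e.Z * e.U ∂μ = 0 := by
  have hφZ : StronglyMeasurable[sigmaZ p q] (fun e : Obs p q => φ e.Z) :=
    (hφ.comp (comap_measurable _)).stronglyMeasurable
  rw [← integral_condExp sigmaZ_le]
  have h1 : μ[fun e : Obs p q => φ e.Z * e.U | sigmaZ p q]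
      =ᵐ[μ] (fun e : Obs p q => φ e.Z) * μ[Obs.U | sigmaZ p q] :=
    condExp_mul_of_stronglyMeasurable_left hφZ hi hU
  refine integral_eq_zero_of_ae ?_
  filter_upwards [h1, h] with e he he0
  rw [he, Pi.mul_apply]
  have : μ[Obs.U | sigmaZ p q] e = 0 := he0
  simp [this]

/-- Under the null hypothesis `E[K(Z - Z†) U† g(D)] = 0` for every function `g`. -/
lemma NullHypothesis.integral_smul_eq_zero (h : NullHypothesis μ) (hK : Measurable K)
    (hU : Integrable Obs.U μ) {g : Obs p q → EuclideanSpace ℝ (Fin p)}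
    (hi : Integrable (fun x : Obs p q × Obs p q => (K (x.1.Z - x.2.Z) * x.2.U) • g x.1)
      (μ.prod μ)) :
    ∫ x : Obs p q × Obs p q, (K (x.1.Z - x.2.Z) * x.2.U) • g x.1 ∂(μ.prod μ) = 0 := by
  rw [integral_prod _ hi]
  refine integral_eq_zero_of_ae ?_
  filter_upwards [hi.prod_right_ae] with d hd
  simp only [Pi.zero_apply]
  rw [integral_smul_const]
  by_cases hg : g d = 0
  · simp [hg]
  · rw [integrable_smul_const hg] at hd
    rw [h.integral_mul_eq_zero hU (φ := fun z => K (d.Z - z)) (by fun_prop) hd, zero_smul]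

/-- In `a_o` the conditional mean of `V` may be replaced by `V`. -/
lemma integral_smul_eq_aO (hK : Measurable K) {a : EuclideanSpace ℝ (Fin q) → ℝ}
    (ha : Measurable a) (hV : Integrable Obs.V μ)
    (hi : Integrable (fun x : Obs p q × Obs p q => (K (x.1.Z - x.2.Z) * a x.2.Z) • x.1.V)
      (μ.prod μ)) :
    ∫ x : Obs p q × Obs p q, (K (x.1.Z - x.2.Z) * a x.2.Z) • x.1.V ∂(μ.prod μ) = aO K a μ := by
  have hpull : ∀ e : Obs p q,
      Integrable (fun d : Obs p q => (K (d.Z - e.Z) * a e.Z) • d.V) μ →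
      μ[fun d : Obs p q => (K (d.Z - e.Z) * a e.Z) • d.V | sigmaZ p q]
        =ᵐ[μ] fun d => (K (d.Z - e.Z) * a e.Z) • condMeanV μ d := by
    intro e he
    have hm : StronglyMeasurable[sigmaZ p q] (fun d : Obs p q => K (d.Z - e.Z) * a e.Z) := by
      have h0 : Measurable fun z : EuclideanSpace ℝ (Fin q) => K (z - e.Z) * a e.Z :=
        (hK.comp (measurable_id.sub_const _)).mul_const _
      exact (h0.comp (comap_measurable _)).stronglyMeasurable
    exact condExp_smul_of_aestronglyMeasurable_left hm.aestronglyMeasurable he hV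
  have hcm : StronglyMeasurable (condMeanV μ) := stronglyMeasurable_condExp.mono sigmaZ_le
  have hsm : StronglyMeasurable (fun x : Obs p q × Obs p q =>
      (K (x.1.Z - x.2.Z) * a x.2.Z) • condMeanV μ x.1) := by
    have hkm : Measurable (fun x : Obs p q × Obs p q => K (x.1.Z - x.2.Z) * a x.2.Z) := by
      fun_prop
    exact hkm.stronglyMeasurable.smul (hcm.comp_measurable measurable_fst)
  have hi2 : Integrable (fun x : Obs p q × Obs p q =>
      (K (x.1.Z - x.2.Z) * a x.2.Z) • condMeanV μ x.1) (μ.prod μ) := by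
    rw [integrable_prod_iff' hsm.aestronglyMeasurable]
    constructor
    · filter_upwards [hi.prod_left_ae] with e he
      exact integrable_condExp.congr (hpull e he)
    · refine (hi.norm.integral_prod_right).mono'
        (hsm.norm.integral_prod_left').aestronglyMeasurable ?_
      filter_upwards [hi.prod_left_ae] with e he
      rw [Real.norm_eq_abs, abs_of_nonneg (integral_nonneg fun _ => norm_nonneg _)]
      calc _ = ∫ d, ‖μ[fun d : Obs p q => (K (d.Z - e.Z) * a e.Z) • d.V | sigmaZ p q] d‖ ∂μ :=
            integral_congr_ae (by filter_upwards [hpull e he] with d hd; rw [hd])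
        _ ≤ _ := integral_norm_condExp_le _
  rw [aO, integral_prod_symm _ hi, integral_prod_symm _ hi2]
  refine integral_congr_ae ?_
  filter_upwards [hi.prod_left_ae] with e he
  rw [← integral_congr_ae (hpull e he), integral_condExp sigmaZ_le]

end CondMean

/-! ### The kernels of the statistics and their local expansion -/

section Kernels

variable {p q : ℕ} {μ : Measure (Obs p q)} [IsProbabilityMeasure μ]
  {K : EuclideanSpace ℝ (Fin q) → ℝ} {a : EuclideanSpace ℝ (Fin q) → ℝ}
  {b : Obs p q → EuclideanSpace ℝ (Fin p)}

/-- The coefficient of `n^{-1/2}` in the kernel `ψ` of a locally shifted sample. -/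
noncomputable def psiLin (K : EuclideanSpace ℝ (Fin q) → ℝ) (a : EuclideanSpace ℝ (Fin q) → ℝ)
    (b : Obs p q → EuclideanSpace ℝ (Fin p)) (d e : Obs p q) : EuclideanSpace ℝ (Fin p) :=
  ((1 / 2 : ℝ) * K (d.Z - e.Z)) • (d.U • b e + a d.Z • e.V + e.U • b d + a e.Z • d.V)

/-- The coefficient of `n⁻¹` in the kernel `ψ` of a locally shifted sample. -/
noncomputable def psiQuad (K : EuclideanSpace ℝ (Fin q) → ℝ) (a : EuclideanSpace ℝ (Fin q) → ℝ)
    (b : Obs p q → EuclideanSpace ℝ (Fin p)) (d e : Obs p q) : EuclideanSpace ℝ (Fin p) :=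
  ((1 / 2 : ℝ) * K (d.Z - e.Z)) • (a d.Z • b e + a e.Z • b d)

/-- The three coefficients in the expansion of a coordinate of `ψ` under local shifts. -/
noncomputable def psiCoeff (K : EuclideanSpace ℝ (Fin q) → ℝ) (a : EuclideanSpace ℝ (Fin q) → ℝ)
    (b : Obs p q → EuclideanSpace ℝ (Fin p)) (k : Fin p) : Fin 3 → Obs p q → Obs p q → ℝ :=
  ![fun d e => psi K d e k, fun d e => psiLin K a b d e k, fun d e => psiQuad K a b d e k]

lemma psi_localShift (n : ℕ) (d e : Obs p q) :
    psi K (localShift a b n d) (localShift a b n e) = psi K d e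
      + (n : ℝ) ^ (-(1 / 2) : ℝ) • (psiLin K a b d e
        + (n : ℝ) ^ (-(1 / 2) : ℝ) • psiQuad K a b d e) := by
  generalize ht : (n : ℝ) ^ (-(1 / 2) : ℝ) = t
  ext k
  simp only [psi, psiLin, psiQuad, localShift, Obs.U, Obs.V, Obs.Z, ht,
    PiLp.smul_apply, PiLp.add_apply, smul_eq_mul]
  ring

lemma rpow_neg_half_eq (n : ℕ) : (n : ℝ) ^ (-(1 / 2) : ℝ) = (√(n : ℝ))⁻¹ := by
  rw [Real.sqrt_eq_rpow, Real.rpow_neg (Nat.cast_nonneg n)]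

lemma localKernel_psiCoeff (k : Fin p) (n : ℕ) (d e : Obs p q) :
    localKernel (psiCoeff K a b k) n d e
      = psi K (localShift a b n d) (localShift a b n e) k := by
  rw [psi_localShift, rpow_neg_half_eq]
  simp [localKernel, psiCoeff, mul_add]

lemma measurable_localShift (ha : Measurable a) (hb : Measurable b) (n : ℕ) :
    Measurable (localShift a b n : Obs p q → Obs p q) := by
  unfold localShift; fun_prop

lemma measurable_psi (hK : Measurable K) :
    Measurable (fun x : Obs p q × Obs p q => psi K x.1 x.2) := by
  unfold psi; fun_prop

lemma MomentCondition.memLp_psi {ε : ℝ} (hε : 0 < ε) (hK : Measurable K)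
    (h : MomentCondition K ε μ) :
    MemLp (fun x : Obs p q × Obs p q => psi K x.1 x.2) 4 (μ.prod μ) := by
  have h1 : MemLp (fun x : Obs p q × Obs p q => psi K x.1 x.2) (ENNReal.ofReal (4 + ε))
      (μ.prod μ) := by
    refine ⟨(measurable_psi hK).aestronglyMeasurable, ?_⟩
    have h0 : ENNReal.ofReal (4 + ε) ≠ 0 := by simp; linarith
    rw [eLpNorm_lt_top_iff_lintegral_rpow_enorm_lt_top h0 ENNReal.ofReal_ne_top,
      ENNReal.toReal_ofReal (by linarith)]
    exact h.moment
  refine h1.mono_exponent ?_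
  rw [show (4 : ENNReal) = ENNReal.ofReal 4 by simp]
  exact ENNReal.ofReal_le_ofReal (by linarith)

lemma measurePreserving_localShift_pair (ha : Measurable a) (hb : Measurable b) (n : ℕ) :
    MeasurePreserving
      (fun x : Obs p q × Obs p q => (localShift a b n x.1, localShift a b n x.2))
      (μ.prod μ) ((μ.map (localShift a b n)).prod (μ.map (localShift a b n))) := by
  have hs := measurable_localShift (p := p) ha hb n
  have : IsProbabilityMeasure (μ.map (localShift a b n)) :=
    Measure.isProbabilityMeasure_map hs.aemeasurable
  exact ⟨by fun_prop, (Measure.map_prod_map μ μ hs hs).symm⟩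

/-- The coefficients of a quadratic polynomial inherit integrability from its values at three
points. -/
lemma memLp_coeff_of_quadratic {Y E : Type*} [MeasurableSpace Y] {m : Measure Y}
    [NormedAddCommGroup E] [NormedSpace ℝ E] {r : ENNReal} {f₀ f₁ f₂ : Y → E}
    (h0 : MemLp f₀ r m) (h1 : MemLp (fun y => f₀ y + (1 : ℝ) • (f₁ y + (1 : ℝ) • f₂ y)) r m)
    (h2 : MemLp (fun y => f₀ y + (1 / 2 : ℝ) • (f₁ y + (1 / 2 : ℝ) • f₂ y)) r m) :
    MemLp f₁ r m ∧ MemLp f₂ r m := by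
  have hlin : MemLp f₁ r m := by
    convert! ((h2.const_smul (4 : ℝ)).sub h1).sub (h0.const_smul (3 : ℝ)) using 1
    funext y
    simp only [Pi.sub_apply, Pi.smul_apply]
    module
  refine ⟨hlin, ?_⟩
  convert! (h1.sub h0).sub hlin using 1
  funext y
  simp only [Pi.sub_apply]
  module

lemma rpow_neg_half_one : ((1 : ℕ) : ℝ) ^ (-(1 / 2) : ℝ) = 1 := by simp

lemma rpow_neg_half_four : ((4 : ℕ) : ℝ) ^ (-(1 / 2) : ℝ) = 1 / 2 := by
  rw [rpow_neg_half_eq, show ((4 : ℕ) : ℝ) = 2 ^ 2 by norm_num, Real.sqrt_sq (by norm_num)]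
  norm_num

/-- The moment conditions at the null law and at the sample sizes `1` and `4`, where `n^{-1/2}` is
`1` and `1/2`, give the values of a quadratic polynomial at three points and so its coefficients. -/
lemma memLp_psiLin_psiQuad {ε : ℝ} (hε : 0 < ε) (hK : Measurable K) (ha : Measurable a)
    (hb : Measurable b) (h : MomentCondition K ε μ)
    (hn : ∀ n : ℕ, 1 ≤ n → MomentCondition K ε (μ.map (localShift a b n))) :
    MemLp (fun x : Obs p q × Obs p q => psiLin K a b x.1 x.2) 4 (μ.prod μ) ∧
      MemLp (fun x : Obs p q × Obs p q => psiQuad K a b x.1 x.2) 4 (μ.prod μ) := by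
  have hs : ∀ n : ℕ, 1 ≤ n → MemLp (fun x : Obs p q × Obs p q =>
      psi K (localShift a b n x.1) (localShift a b n x.2)) 4 (μ.prod μ) := fun n h1 => by
    have : IsProbabilityMeasure (μ.map (localShift a b n)) :=
      Measure.isProbabilityMeasure_map (measurable_localShift ha hb n).aemeasurable
    exact ((hn n h1).memLp_psi hε hK).comp_measurePreserving
      (measurePreserving_localShift_pair ha hb n)
  have h1 := hs 1 le_rfl
  have h4 := hs 4 (by norm_num)
  simp only [psi_localShift, rpow_neg_half_one, rpow_neg_half_four] at h1 h4
  exact memLp_coeff_of_quadratic (h.memLp_psi hε hK) h1 h4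

lemma symmL4_psi {ε : ℝ} (hε : 0 < ε) (hK : Measurable K) (hKs : ∀ z, K (-z) = K z)
    (h : MomentCondition K ε μ) (k : Fin p) : SymmL4 μ (fun d e => psi K d e k) := by
  have hKc : ∀ z w, K (z - w) = K (w - z) := fun z w => by rw [← hKs, neg_sub]
  refine ⟨?_, fun d e => ?_, (h.memLp_psi hε hK).eval_piLp k⟩
  · simp only [psi]; fun_prop
  · simp only [psi]; rw [hKc]; simp [add_comm]

lemma symmL4_psiCoeff {ε : ℝ} (hε : 0 < ε) (hK : Measurable K) (hKs : ∀ z, K (-z) = K z)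
    (ha : Measurable a) (hb : Measurable b) (h : MomentCondition K ε μ)
    (hn : ∀ n : ℕ, 1 ≤ n → MomentCondition K ε (μ.map (localShift a b n))) (k : Fin p)
    (i : Fin 3) : SymmL4 μ (psiCoeff K a b k i) := by
  have hKc : ∀ z w, K (z - w) = K (w - z) := fun z w => by rw [← hKs, neg_sub]
  obtain ⟨h1, h2⟩ := memLp_psiLin_psiQuad hε hK ha hb h hn
  fin_cases i
  · exact symmL4_psi hε hK hKs h k
  · change SymmL4 μ (fun d e => psiLin K a b d e k)
    refine ⟨?_, fun d e => ?_, h1.eval_piLp k⟩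
    · simp only [psiLin]; fun_prop
    · simp only [psiLin]; rw [hKc]; simp; ring
  · change SymmL4 μ (fun d e => psiQuad K a b d e k)
    refine ⟨?_, fun d e => ?_, h2.eval_piLp k⟩
    · simp only [psiQuad]; fun_prop
    · simp only [psiQuad]; rw [hKc]; simp; ring

/-- The mean of a symmetrization is that of the original kernel. -/
lemma kmean_symmetrization {Ψ : Obs p q → Obs p q → EuclideanSpace ℝ (Fin p)}
    {g : Obs p q × Obs p q → EuclideanSpace ℝ (Fin p)} (hg : Integrable g (μ.prod μ))
    (hΨ : ∀ x : Obs p q × Obs p q, Ψ x.1 x.2 = (1 / 2 : ℝ) • (g x + g x.swap)) (k : Fin p) :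
    kmean μ (fun d e => Ψ d e k) = (∫ x, g x ∂(μ.prod μ)) k := by
  have hi : Integrable (fun x : Obs p q × Obs p q => Ψ x.1 x.2) (μ.prod μ) := by
    simp_rw [hΨ]
    exact (hg.add hg.swap).smul (1 / 2 : ℝ)
  have hik : ∀ k, Integrable (fun x : Obs p q × Obs p q => Ψ x.1 x.2 k) (μ.prod μ) := fun k =>
    memLp_one_iff_integrable.1 ((memLp_one_iff_integrable.2 hi).eval_piLp k)
  have hsw : ∫ x, g x.swap ∂(μ.prod μ) = ∫ x, g x ∂(μ.prod μ) := integral_prod_swap g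
  have hsum : ∫ x, (g x + g x.swap) ∂(μ.prod μ)
      = ∫ x, g x ∂(μ.prod μ) + ∫ x, g x.swap ∂(μ.prod μ) := integral_add hg hg.swap
  have e : ∫ x : Obs p q × Obs p q, Ψ x.1 x.2 ∂(μ.prod μ) = ∫ x, g x ∂(μ.prod μ) := by
    simp_rw [hΨ]
    rw [integral_smul, hsum, hsw]
    module
  rw [← e, eval_integral_piLp hik, integral_prod _ (hik k)]
  rfl

/-- The mean of `ψ` is `δ_V`. -/
lemma kmean_psi {ε : ℝ} (hKs : ∀ z, K (-z) = K z)
    (h : MomentCondition K ε μ) (k : Fin p) :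
    kmean μ (fun d e => psi K d e k) = delta K μ k := by
  have hKc : ∀ z w, K (z - w) = K (w - z) := fun z w => by rw [← hKs, neg_sub]
  refine kmean_symmetrization h.integrable_delta (fun x => ?_) k
  rw [psi, Prod.fst_swap, Prod.snd_swap, hKc x.2.Z]
  module

/-- Under the null hypothesis, the mean of the linear coefficient of `ψ` under local shifts is
`a_o`; the shift of `V` does not contribute to it. -/
lemma kmean_psiLin {ε : ℝ} (hK : Measurable K) (hKs : ∀ z, K (-z) = K z)
    (ha : Measurable a) (hb : Measurable b) (h0 : NullHypothesis μ) (h : MomentCondition K ε μ)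
    (hn : ∀ n : ℕ, 1 ≤ n → MomentCondition K ε (μ.map (localShift a b n)))
    (hi : Integrable (fun x : Obs p q × Obs p q => (K (x.1.Z - x.2.Z) * a x.2.Z) • x.1.V)
      (μ.prod μ)) (k : Fin p) :
    kmean μ (fun d e => psiLin K a b d e k) = aO K a μ k := by
  have hKc : ∀ z w, K (z - w) = K (w - z) := fun z w => by rw [← hKs, neg_sub]
  -- Integrability of `K(Z - Z†) U† b(D)`.
  have hd : ∀ n : ℕ, 1 ≤ n → Integrable (fun x : Obs p q × Obs p q =>
      (K (x.1.Z - x.2.Z) * x.2.U) • x.1.V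
      + (n : ℝ) ^ (-(1 / 2) : ℝ) • (((K (x.1.Z - x.2.Z) * a x.2.Z) • x.1.V
        + (K (x.1.Z - x.2.Z) * x.2.U) • b x.1)
        + (n : ℝ) ^ (-(1 / 2) : ℝ) • ((K (x.1.Z - x.2.Z) * a x.2.Z) • b x.1))) (μ.prod μ) := by
    intro n h1
    have h2 := (measurePreserving_localShift_pair (μ := μ) ha hb n).integrable_comp_of_integrable
      (hn n h1).integrable_delta
    convert! h2 using 1
    funext x
    simp only [Function.comp, localShift, Obs.U, Obs.V, Obs.Z]
    generalize (n : ℝ) ^ (-(1 / 2) : ℝ) = t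
    module
  have h1 := hd 1 le_rfl
  have h4 := hd 4 (by norm_num)
  rw [rpow_neg_half_one] at h1
  rw [rpow_neg_half_four] at h4
  have hlin := memLp_one_iff_integrable.1 (memLp_coeff_of_quadratic
    (memLp_one_iff_integrable.2 h.integrable_delta) (memLp_one_iff_integrable.2 h1)
    (memLp_one_iff_integrable.2 h4)).1
  have hb' : Integrable (fun x : Obs p q × Obs p q => (K (x.1.Z - x.2.Z) * x.2.U) • b x.1)
      (μ.prod μ) := by
    have := hlin.sub hi
    convert! this using 1
    funext x
    simp
  have hint : ∫ x : Obs p q × Obs p q, ((K (x.1.Z - x.2.Z) * a x.2.Z) • x.1.V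
        + (K (x.1.Z - x.2.Z) * x.2.U) • b x.1) ∂(μ.prod μ) = aO K a μ := by
    rw [integral_add hi hb', h0.integral_smul_eq_zero hK h.integrable_U hb', add_zero,
      integral_smul_eq_aO hK ha h.integrable_V hi]
  rw [← hint]
  refine kmean_symmetrization hlin (fun x => ?_) k
  rw [psiLin, Prod.fst_swap, Prod.snd_swap, hKc x.2.Z]
  module

end Kernels

/-! ### The estimators as U-statistics -/

section Estimators

variable {p q : ℕ} {K : EuclideanSpace ℝ (Fin q) → ℝ}

lemma psiHat_apply (n : ℕ) (x : ℕ → Obs p q) (i : ℕ) (k : Fin p) :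
    psiHat K n x i k = rowMean (fun d e => psi K d e k) n x i := by
  simp only [psiHat, rowMean, psi, PiLp.smul_apply, WithLp.ofLp_sum, Finset.sum_apply,
    PiLp.add_apply, smul_eq_mul, Finset.mul_sum]
  refine Finset.sum_congr rfl fun j _ => ?_
  rw [one_div, mul_inv]
  ring

lemma deltaHat_apply (hKs : ∀ z, K (-z) = K z) (n : ℕ) (x : ℕ → Obs p q) (k : Fin p) :
    deltaHat K n x k = uStat (fun d e => psi K d e k) n x := by
  have hKc : ∀ z w, K (z - w) = K (w - z) := fun z w => by rw [← hKs, neg_sub]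
  set F : ℕ → ℕ → ℝ := fun i j => K ((x i).Z - (x j).Z) * (x i).U * (x j).V k with hF
  have hswap : ∑ i ∈ Finset.range n, ∑ j ∈ (Finset.range n).erase i, F j i
      = ∑ i ∈ Finset.range n, ∑ j ∈ (Finset.range n).erase i, F i j :=
    Finset.sum_comm' fun i j => by simp only [Finset.mem_erase]; tauto
  have h1 : uStat (fun d e => psi K d e k) n x = (1 / (n : ℝ)) * ((1 / ((n : ℝ) - 1)) *
      ((1 / 2) * (∑ i ∈ Finset.range n, ∑ j ∈ (Finset.range n).erase i, F i j
        + ∑ i ∈ Finset.range n, ∑ j ∈ (Finset.range n).erase i, F j i))) := by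
    simp only [uStat, rowMean, ← Finset.mul_sum, ← Finset.sum_add_distrib]
    congr 2
    simp only [Finset.mul_sum]
    refine Finset.sum_congr rfl fun i _ => Finset.sum_congr rfl fun j _ => ?_
    simp only [psi, hF, PiLp.smul_apply, PiLp.add_apply, smul_eq_mul]
    rw [hKc (x j).Z]
    ring
  have h2 : deltaHat K n x k = (1 / ((n : ℝ) * ((n : ℝ) - 1))) *
      ∑ i ∈ Finset.range n, ∑ j ∈ (Finset.range n).erase i, F i j := by
    simp only [deltaHat, hF, PiLp.smul_apply, WithLp.ofLp_sum, Finset.sum_apply, smul_eq_mul]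
  rw [h1, h2, hswap, one_div, mul_inv]
  ring

lemma omegaTilde_apply (hKs : ∀ z, K (-z) = K z) (n : ℕ) (x : ℕ → Obs p q) (k l : Fin p) :
    omegaTilde K n x k l
      = rowCov (fun d e => psi K d e k) (fun d e => psi K d e l) n x := by
  simp only [omegaTilde, rowCov, Matrix.of_apply, psiHat_apply, deltaHat_apply hKs]

variable {a : EuclideanSpace ℝ (Fin q) → ℝ} {b : Obs p q → EuclideanSpace ℝ (Fin p)}

lemma deltaHat_localShift (hKs : ∀ z, K (-z) = K z) (n : ℕ) (x : ℕ → Obs p q) (k : Fin p) :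
    deltaHat K n (fun i => localShift a b n (x i)) k
      = uStat (localKernel (psiCoeff K a b k) n) n x := by
  have h : localKernel (psiCoeff K a b k) n
      = fun d e => psi K (localShift a b n d) (localShift a b n e) k := by
    funext d e; exact localKernel_psiCoeff k n d e
  rw [deltaHat_apply hKs, h]
  rfl

lemma omegaTilde_localShift (hKs : ∀ z, K (-z) = K z) (n : ℕ) (x : ℕ → Obs p q) (k l : Fin p) :
    omegaTilde K n (fun i => localShift a b n (x i)) k l
      = rowCov (localKernel (psiCoeff K a b k) n) (localKernel (psiCoeff K a b l) n) n x := by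
  have h : ∀ k, localKernel (psiCoeff K a b k) n
      = fun d e => psi K (localShift a b n d) (localShift a b n e) k := fun k => by
    funext d e; exact localKernel_psiCoeff k n d e
  rw [omegaTilde_apply hKs, h, h]
  rfl

lemma measurable_omegaTilde (hK : Measurable K) {Ω : Type*} [MeasurableSpace Ω]
    {X : ℕ → Ω → Obs p q} (hX : ∀ i, Measurable (X i)) (n : ℕ) (k l : Fin p) :
    Measurable fun ω => omegaTilde K n (fun i => X i ω) k l := by
  have hδ : Measurable fun ω => deltaHat K n (fun i => X i ω) := by unfold deltaHat; fun_prop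
  have hψ : ∀ i, Measurable fun ω => psiHat K n (fun i => X i ω) i := fun i => by
    unfold psiHat; fun_prop
  simp only [omegaTilde, Matrix.of_apply]
  fun_prop

lemma measurable_deltaHat (hK : Measurable K) {Ω : Type*} [MeasurableSpace Ω]
    {X : ℕ → Ω → Obs p q} (hX : ∀ i, Measurable (X i)) (n : ℕ) :
    Measurable fun ω => deltaHat K n (fun i => X i ω) := by
  unfold deltaHat; fun_prop

lemma measurable_omegaHatInv (hK : Measurable K) {Ω : Type*} [MeasurableSpace Ω]
    {X : ℕ → Ω → Obs p q} (hX : ∀ i, Measurable (X i)) (ι : ℝ) (n : ℕ) (k l : Fin p) :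
    Measurable fun ω => omegaHatInv K ι n (fun i => X i ω) k l := by
  rcases Nat.eq_zero_or_pos n with rfl | hn
  · -- An empty sample gives the zero matrix, whatever the observations are.
    have h0 : ∀ x y : ℕ → Obs p q, omegaTilde K 0 x = omegaTilde K 0 y := fun x y => by
      ext k l; simp [omegaTilde]
    have h1 : ∀ x y : ℕ → Obs p q, omegaHatInv K ι 0 x = omegaHatInv K ι 0 y := fun x y => by
      unfold omegaHatInv thresholdedInv
      exact spectralMap_congr _ _ _ (h0 x y)
    have h2 : (fun ω => omegaHatInv K ι 0 (fun i => X i ω) k l)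
        = fun _ => omegaHatInv K ι 0 (fun _ => 0) k l := by
      funext ω
      rw [h1]
    rw [h2]
    exact measurable_const
  · exact measurable_thresholdedInv (fun ω => omegaTilde_isHermitian K n fun i => X i ω)
      (measurable_omegaTilde hK hX n) (by positivity) k l

end Estimators

/-! ### The asymptotic covariance matrix -/

section Covariance

variable {p q : ℕ} {K : EuclideanSpace ℝ (Fin q) → ℝ} {μ : Measure (Obs p q)}
  [IsProbabilityMeasure μ] {ε : ℝ}

/-- `Ω_V` is the second moment matrix of the vector `2 (ψ⁽¹⁾ - E ψ)`, which is the influence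
function of `δ̂_V`. -/
lemma omegaV_apply (hε : 0 < ε) (hK : Measurable K) (h : MomentCondition K ε μ) (k l : Fin p) :
    omegaV K μ k l = ∫ d, (2 * (proj μ (fun d e => psi K d e k) d
        - kmean μ fun d e => psi K d e k)) *
      (2 * (proj μ (fun d e => psi K d e l) d - kmean μ fun d e => psi K d e l)) ∂μ := by
  have hint : Integrable (fun x : Obs p q × Obs p q => psi K x.1 x.2) (μ.prod μ) :=
    (h.memLp_psi hε hK).integrable (by norm_num)
  have hae : ∀ k : Fin p, (fun d => psi1 K μ d k) =ᵐ[μ] proj μ (fun d e => psi K d e k) :=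
    fun k => by
    filter_upwards [hint.prod_right_ae] with d hd
    exact eval_integral_piLp (fun k => memLp_one_iff_integrable.1
      ((memLp_one_iff_integrable.2 hd).eval_piLp k)) k
  simp only [omegaV, Matrix.of_apply, covariance]
  rw [integral_congr_ae (hae k), integral_congr_ae (hae l), ← integral_const_mul]
  refine integral_congr_ae ?_
  filter_upwards [hae k, hae l] with d h1 h2
  rw [h1, h2, kmean, kmean]
  ring

lemma omegaV_eq_projCov (hε : 0 < ε) (hK : Measurable K) (hKs : ∀ z, K (-z) = K z)
    (h : MomentCondition K ε μ) (k l : Fin p) :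
    omegaV K μ k l = projCov μ (fun d e => psi K d e k) (fun d e => psi K d e l) := by
  have hS := fun k => symmL4_psi hε hK hKs h k
  have h2 : ∀ k, MemLp (proj μ (fun d e => psi K d e k)) 2 μ := fun k =>
    (hS k).memLp_proj.mono_exponent (by norm_num)
  have := covariance_eq_sub (h2 k) (h2 l)
  rw [omegaV_apply hε hK h, projCov]
  simp only [Pi.mul_apply] at this
  rw [kmean, kmean, ← this, covariance, ← integral_const_mul]
  exact integral_congr_ae (.of_forall fun d => by simp only; ring)

lemma omegaV_eigenvalues_nonneg (hε : 0 < ε) (hK : Measurable K) (hKs : ∀ z, K (-z) = K z)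
    (h : MomentCondition K ε μ) (j : Fin p) :
    0 ≤ (omegaV_isHermitian K μ).eigenvalues j := by
  refine (Matrix.PosSemidef.of_dotProduct_mulVec_nonneg (omegaV_isHermitian K μ)
    fun c => ?_).eigenvalues_nonneg j
  set Y : Fin p → Obs p q → ℝ := fun k d =>
    2 * (proj μ (fun d e => psi K d e k) d - kmean μ fun d e => psi K d e k) with hY
  have hY2 : ∀ k, MemLp (Y k) 2 μ := fun k =>
    (((symmL4_psi hε hK hKs h k).memLp_proj.mono_exponent (by norm_num)).sub
      (memLp_const _)).const_mul 2
  have e : star c ⬝ᵥ (omegaV K μ).mulVec c = ∫ d, (∑ k, c k * Y k d) ^ 2 ∂μ := by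
    rw [integral_sum_sq Finset.univ (fun k d => c k * Y k d) fun k _ => (hY2 k).const_mul (c k)]
    simp only [dotProduct, Matrix.mulVec, Finset.mul_sum, omegaV_apply hε hK h]
    refine Finset.sum_congr rfl fun k _ => Finset.sum_congr rfl fun l _ => ?_
    rw [Pi.star_apply, star_trivial, ← mul_assoc, mul_right_comm, ← integral_const_mul]
    exact integral_congr_ae (.of_forall fun d => by simp only [hY]; ring)
  rw [e]
  exact integral_nonneg fun d => sq_nonneg _

end Covariance

/-! ### Limits of the estimators along local shifts of a law -/

section Limits

variable {Ω : Type*} [MeasurableSpace Ω] {P : Measure Ω} [IsProbabilityMeasure P]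
  {p q : ℕ} {K : EuclideanSpace ℝ (Fin q) → ℝ} {μ : Measure (Obs p q)}
  [IsProbabilityMeasure μ] {ε ι : ℝ} {D : ℕ → Ω → Obs p q}
  {a : EuclideanSpace ℝ (Fin q) → ℝ} {b : Obs p q → EuclideanSpace ℝ (Fin p)}

lemma tendsto_threshold (hι' : ι < 1 / 2) :
    Tendsto (fun n : ℕ => (n : ℝ) ^ (-(1 / 2) + ι : ℝ)) atTop (𝓝 0) := by
  have := (tendsto_rpow_neg_atTop (y := 1 / 2 - ι) (by linarith)).comp tendsto_natCast_atTop_atTop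
  refine this.congr fun n => ?_
  simp only [Function.comp]
  congr 1; ring

lemma eventually_threshold_pos : ∀ᶠ n : ℕ in atTop, 0 < (n : ℝ) ^ (-(1 / 2) + ι : ℝ) := by
  filter_upwards [eventually_gt_atTop 0] with n hn
  positivity

/-- The error of `Ω̃_{V,n}` is negligible with respect to the threshold `c_n`. -/
lemma tendstoInMeasure_omegaTilde_sub_div (hε : 0 < ε) (hι : 0 < ι) (hK : Measurable K)
    (hKs : ∀ z, K (-z) = K z) (hD : IIDSeq P D μ) (ha : Measurable a) (hb : Measurable b)
    (h : MomentCondition K ε μ)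
    (hn : ∀ n : ℕ, 1 ≤ n → MomentCondition K ε (μ.map (localShift a b n))) (k l : Fin p) :
    TendstoInMeasure P (fun (n : ℕ) ω =>
      (omegaTilde K n (fun i => localShift a b n (D i ω)) k l - omegaV K μ k l)
        / (n : ℝ) ^ (-(1 / 2) + ι : ℝ)) atTop (fun _ => (0 : ℝ)) := by
  refine L1Rate.tendstoInMeasure_div ?_ hι
  refine (l1Rate_rowCov_localKernel (symmL4_psiCoeff hε hK hKs ha hb h hn k)
    (symmL4_psiCoeff hε hK hKs ha hb h hn l) hD).congr fun n _ ω => ?_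
  rw [omegaTilde_localShift hKs, omegaV_eq_projCov hε hK hKs h]
  rfl

lemma tendstoInMeasure_omegaHatInv (hε : 0 < ε) (hι : 0 < ι) (hι' : ι < 1 / 2)
    (hK : Measurable K) (hKs : ∀ z, K (-z) = K z) (hD : IIDSeq P D μ) (ha : Measurable a)
    (hb : Measurable b) (h : MomentCondition K ε μ)
    (hn : ∀ n : ℕ, 1 ≤ n → MomentCondition K ε (μ.map (localShift a b n))) (k l : Fin p) :
    TendstoInMeasure P
      (fun (n : ℕ) ω => omegaHatInv K ι n (fun i => localShift a b n (D i ω)) k l) atTop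
      (fun _ => mpInverse (omegaV_isHermitian K μ) k l) :=
  tendstoInMeasure_thresholdedInv
    (fun n ω => omegaTilde_isHermitian K n fun i => localShift a b n (D i ω))
    (omegaV_isHermitian K μ) (omegaV_eigenvalues_nonneg hε hK hKs h) eventually_threshold_pos
    (tendsto_threshold hι')
    (tendstoInMeasure_omegaTilde_sub_div hε hι hK hKs hD ha hb h hn) k l

/-- If `Ω_V` has rank zero then `Ω̂⁻_{V,n}`, hence the test statistic, vanishes with probability
tending to one. -/
lemma tendsto_measure_lt_waldStat_of_rank_eq_zero (hε : 0 < ε) (hι : 0 < ι)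
    (hK : Measurable K) (hKs : ∀ z, K (-z) = K z) (hD : IIDSeq P D μ) (ha : Measurable a)
    (hb : Measurable b) (h : MomentCondition K ε μ)
    (hn : ∀ n : ℕ, 1 ≤ n → MomentCondition K ε (μ.map (localShift a b n)))
    (hr : (omegaV K μ).rank = 0) {y : ℝ} (hy : 0 ≤ y) :
    Tendsto (fun n : ℕ => P {ω | y < waldStat K ι n (fun i => localShift a b n (D i ω))}) atTop
      (𝓝 0) := by
  have h0 : ∀ j, (omegaV_isHermitian K μ).eigenvalues j = 0 := by
    rw [(omegaV_isHermitian K μ).rank_eq_card_non_zero_eigs, Fintype.card_eq_zero_iff] at hr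
    exact fun j => by_contra fun hj => hr.elim ⟨j, hj⟩
  have hlim := tendsto_measure_frobSq_ge
    (M := fun n ω => omegaTilde K n (fun i => localShift a b n (D i ω)))
    eventually_threshold_pos (tendstoInMeasure_omegaTilde_sub_div hε hι hK hKs hD ha hb h hn)
  refine tendsto_of_tendsto_of_tendsto_of_le_of_le' tendsto_const_nhds hlim
    (Eventually.of_forall fun _ => zero_le) ?_
  filter_upwards [eventually_threshold_pos (ι := ι)] with n hc
  refine measure_mono fun ω hω => ?_
  rw [Set.mem_ofPred_eq] at hω ⊢
  by_contra! hlt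
  have hz : omegaHatInv K ι n (fun i => localShift a b n (D i ω)) = 0 :=
    thresholdedInv_eq_zero _ (omegaV_isHermitian K μ) hc h0 hlt
  rw [waldStat, hz] at hω
  simp [quadForm] at hω
  linarith

/-- Under local alternatives, `√n δ̂_V` is asymptotically normal with covariance matrix
`Ω_V = M M'` and mean `a_o`. -/
lemma tendstoInDistribution_deltaHat (hε : 0 < ε)
    (hK : Measurable K) (hKs : ∀ z, K (-z) = K z) (hD : IIDSeq P D μ) (ha : Measurable a)
    (hb : Measurable b) (h0 : NullHypothesis μ) (h : MomentCondition K ε μ)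
    (hn : ∀ n : ℕ, 1 ≤ n → MomentCondition K ε (μ.map (localShift a b n)))
    (hi : Integrable (fun x : Obs p q × Obs p q => (K (x.1.Z - x.2.Z) * a x.2.Z) • x.1.V)
      (μ.prod μ)) {r : ℕ} {M : Matrix (Fin p) (Fin r) ℝ} (hM : M * M.transpose = omegaV K μ) :
    TendstoInDistribution
      (fun (n : ℕ) ω k => √(n : ℝ) * deltaHat K n (fun i => localShift a b n (D i ω)) k) atTop
      (fun ξ : EuclideanSpace ℝ (Fin r) => M.mulVec ξ + (aO K a μ).ofLp) (fun _ => P)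
      (stdGaussian (EuclideanSpace ℝ (Fin r))) := by
  have hS := symmL4_psiCoeff hε hK hKs ha hb h hn
  have hm0 : ∀ k, kmean μ (fun d e => psi K d e k) = 0 := fun k => by
    rw [kmean_psi hKs h, delta, h0.integral_smul_eq_zero hK h.integrable_U h.integrable_delta]
    rfl
  set Y : Fin p → Obs p q → ℝ := fun k d =>
    2 * (proj μ (fun d e => psi K d e k) d - kmean μ fun d e => psi K d e k) with hY
  have hpi : ∀ k, Integrable (proj μ (fun d e => psi K d e k)) μ := fun k =>
    (hS k 0).memLp_proj.integrable (by norm_num)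
  have hYm : ∀ k, Measurable (Y k) := fun k =>
    ((hS k 0).measurable_proj.sub_const _).const_mul 2
  have hclt := hD.tendstoInDistribution_sum hYm
    (fun k => (((hS k 0).memLp_proj.mono_exponent (by norm_num)).sub (memLp_const _)).const_mul 2)
    (fun k => by
      rw [hY, integral_const_mul, integral_sub (hpi k) (integrable_const _)]
      simp [kmean])
    (M := M) (fun k l => by rw [hM, omegaV_apply hε hK h])
  -- The remainder converges to `a_o` in probability.
  set R : ℕ → Ω → Fin p → ℝ := fun n ω k =>
    √(n : ℝ) * deltaHat K n (fun i => localShift a b n (D i ω)) k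
      - (√(n : ℝ))⁻¹ * ∑ i ∈ Finset.range n, Y k (D i ω) with hR
  have hDm := hD.measurable
  have hsh := measurable_localShift (p := p) ha hb
  have hRm : ∀ n, Measurable (R n) := fun n => by
    have := measurable_deltaHat hK (X := fun i ω => localShift a b n (D i ω))
      (fun i => (hsh n).comp (hDm i)) n
    refine measurable_pi_iff.2 fun k => ?_
    simp only [hR]
    fun_prop
  have hlim : TendstoInMeasure P R atTop (fun _ => (aO K a μ).ofLp) := by
    refine tendstoInMeasure_pi fun k => ?_
    have e1 := (hS k 0).l1Rate_hoeffding_remainder hD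
    have e2 := (hS k 1).l1Rate_uStat hD
    have e3 := ((hS k 2).l1Rate_uStat hD).mul_bdd (a := fun n => (√(n : ℝ))⁻¹) (K := 1)
      fun n hn2 => by
        rw [abs_of_nonneg (by positivity)]
        refine inv_le_one_of_one_le₀ (Real.one_le_sqrt.2 ?_)
        exact_mod_cast (by omega : 1 ≤ n)
    have e4 : L1Rate P (fun (n : ℕ) (_ : Ω) => (√(n : ℝ))⁻¹ * kmean μ (psiCoeff K a b k 2)) :=
      L1Rate.const (K := |kmean μ (psiCoeff K a b k 2)|) fun n _ => by
        rw [abs_mul, abs_of_nonneg (by positivity), mul_comm, div_eq_mul_inv]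
    have hrate : L1Rate P (fun n ω => R n ω k - aO K a μ k) := by
      refine (((e1.add e2).add e3).add e4).congr fun n hn2 ω => ?_
      have hn' : (2 : ℝ) ≤ n := by exact_mod_cast hn2
      have hs : 0 < √(n : ℝ) := Real.sqrt_pos.2 (by linarith)
      have hss : (n : ℝ) = √(n : ℝ) * √n := (Real.mul_self_sqrt (by linarith)).symm
      have hk1 : kmean μ (psiCoeff K a b k 1) = aO K a μ k :=
        kmean_psiLin hK hKs ha hb h0 h hn hi k
      have hk0 : kmean μ (psiCoeff K a b k 0) = 0 := hm0 k
      have hu : deltaHat K n (fun i => localShift a b n (D i ω)) k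
          = uStat (psiCoeff K a b k 0) n (fun j => D j ω) + (√(n : ℝ))⁻¹ *
            (uStat (psiCoeff K a b k 1) n (fun j => D j ω) + (√(n : ℝ))⁻¹ *
              uStat (psiCoeff K a b k 2) n (fun j => D j ω)) := by
        rw [deltaHat_localShift hKs]
        simp only [← uStat_const_mul, ← uStat_add]
        rfl
      have hsum : ∑ i ∈ Finset.range n, Y k (D i ω)
          = 2 * ∑ i ∈ Finset.range n, (proj μ (psiCoeff K a b k 0) (D i ω)
            - kmean μ (psiCoeff K a b k 0)) := by
        rw [Finset.mul_sum]; rfl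
      simp only [hR]
      rw [hsum, hu, hk0, hk1]
      generalize ∑ i ∈ Finset.range n, (proj μ (psiCoeff K a b k 0) (D i ω) - 0) = T
      generalize uStat (psiCoeff K a b k 0) n (fun j => D j ω) = u0
      generalize uStat (psiCoeff K a b k 1) n (fun j => D j ω) = u1
      generalize uStat (psiCoeff K a b k 2) n (fun j => D j ω) = u2
      rw [show (2 : ℝ) / n = 2 * (√(n : ℝ))⁻¹ * (√(n : ℝ))⁻¹ by
        rw [div_eq_mul_inv, hss, mul_inv, ← hss, mul_assoc]]
      generalize √(n : ℝ) = s at hs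
      field_simp
      ring
    have := hrate.tendstoInMeasure
    rw [tendstoInMeasure_iff_dist] at this ⊢
    simpa [Real.dist_eq] using this
  have := hclt.add_of_tendstoInMeasure_const hlim fun n => (hRm n).aemeasurable
  convert! this using 3 with n
  funext k
  simp [hR]

/-- Under local alternatives, the test statistic is asymptotically noncentral `χ²`. -/
theorem tendstoInDistribution_waldStat (hε : 0 < ε) (hι : 0 < ι) (hι' : ι < 1 / 2)
    (hK : Measurable K) (hKs : ∀ z, K (-z) = K z) (hD : IIDSeq P D μ) (ha : Measurable a)
    (hb : Measurable b) (h0 : NullHypothesis μ) (h : MomentCondition K ε μ)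
    (hn : ∀ n : ℕ, 1 ≤ n → MomentCondition K ε (μ.map (localShift a b n)))
    (hi : Integrable (fun x : Obs p q × Obs p q => (K (x.1.Z - x.2.Z) * a x.2.Z) • x.1.V)
      (μ.prod μ)) :
    TendstoInDistribution
      (fun (n : ℕ) ω => waldStat K ι n (fun i => localShift a b n (D i ω))) atTop id (fun _ => P)
      (ncChiSq (omegaV K μ).rank
        (quadForm (mpInverse (omegaV_isHermitian K μ)) (aO K a μ))) := by
  obtain ⟨M, N, hM, hN, hNM⟩ := exists_sqrt_mpInverse (omegaV_isHermitian K μ)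
    (omegaV_eigenvalues_nonneg hε hK hKs h)
  exact tendstoInDistribution_wald (omegaV_isHermitian K μ) hN hNM (aO K a μ)
    (tendstoInDistribution_deltaHat hε hK hKs hD ha hb h0 h hn hi hM)
    (fun n k l => (measurable_omegaHatInv hK
      (fun i => (measurable_localShift ha hb n).comp (hD.measurable i)) ι n k l).aemeasurable)
    (tendstoInMeasure_omegaHatInv hε hι hι' hK hKs hD ha hb h hn)

/-- The asymptotic local power. Weak convergence gives it when the limit law has no atoms, that is,
for positive rank. -/
theorem tendsto_measure_lt_waldStat_local (hε : 0 < ε) (hι : 0 < ι) (hι' : ι < 1 / 2)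
    (hK : Measurable K) (hKs : ∀ z, K (-z) = K z) (hD : IIDSeq P D μ) (ha : Measurable a)
    (hb : Measurable b) (h0 : NullHypothesis μ) (h : MomentCondition K ε μ)
    (hn : ∀ n : ℕ, 1 ≤ n → MomentCondition K ε (μ.map (localShift a b n)))
    (hi : Integrable (fun x : Obs p q × Obs p q => (K (x.1.Z - x.2.Z) * a x.2.Z) • x.1.V)
      (μ.prod μ)) {t : ℝ} (ht : 0 < t) :
    Tendsto (fun n : ℕ => P {ω | chiSqQuantile (omegaV K μ).rank t <
        waldStat K ι n (fun i => localShift a b n (D i ω))}) atTop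
      (𝓝 (ncChiSq (omegaV K μ).rank
        (quadForm (mpInverse (omegaV_isHermitian K μ)) (aO K a μ))
        {y | chiSqQuantile (omegaV K μ).rank t < y})) := by
  rcases eq_or_ne (omegaV K μ).rank 0 with hr | hr
  · -- The limit law has an atom at `0`, and the critical value is `0`.
    have hq := chiSqQuantile_zero_nonneg ht
    rw [hr, ncChiSq_zero_Ioi hq]
    exact tendsto_measure_lt_waldStat_of_rank_eq_zero hε hι hK hKs hD ha hb h hn hr hq
  · have hd := tendstoInDistribution_waldStat hε hι hι' hK hKs hD ha hb h0 h hn hi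
    set c := chiSqQuantile (omegaV K μ).rank t
    have hm : MeasurableSet {y : ℝ | c < y} := measurableSet_Ioi
    have hlim := ProbabilityMeasure.tendsto_measure_of_null_frontier_of_tendsto' hd.tendsto
      (E := {y : ℝ | c < y}) (by
        change Measure.map id _ (frontier (Set.Ioi c)) = 0
        rw [frontier_Ioi, Measure.map_id, ncChiSq_singleton hr])
    change Tendsto (fun n : ℕ => (Measure.map (fun ω => waldStat K ι n
      (fun i => localShift a b n (D i ω))) P) {y : ℝ | c < y}) atTop
      (𝓝 (Measure.map id _ {y : ℝ | c < y})) at hlim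
    rw [Measure.map_id] at hlim
    refine hlim.congr fun n => ?_
    rw [Measure.map_apply_of_aemeasurable (hd.forall_aemeasurable n) hm]
    rfl

lemma localShift_zero (n : ℕ) : localShift (0 : EuclideanSpace ℝ (Fin q) → ℝ)
    (0 : Obs p q → EuclideanSpace ℝ (Fin p)) n = id := by
  funext d
  simp [localShift]

lemma measurable_quadForm {A : Ω → Matrix (Fin p) (Fin p) ℝ}
    (hA : ∀ k l, Measurable fun ω => A ω k l) {v : Ω → EuclideanSpace ℝ (Fin p)}
    (hv : Measurable v) : Measurable fun ω => quadForm (A ω) (v ω) := by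
  unfold quadForm
  fun_prop

/-- Consistency against alternatives at which `δ_V` is outside the kernel of `Ω_V`. -/
theorem tendsto_measure_lt_waldStat_of_delta (hε : 0 < ε) (hι : 0 < ι) (hι' : ι < 1 / 2)
    (hK : Measurable K) (hKs : ∀ z, K (-z) = K z) (hD : IIDSeq P D μ)
    (h : MomentCondition K ε μ)
    (hδ : delta K μ ∉ Module.End.eigenspace (Matrix.toEuclideanLin (omegaV K μ)) 0) (y : ℝ) :
    Tendsto (fun n : ℕ => P {ω | y < waldStat K ι n (fun i => D i ω)}) atTop (𝓝 1) := by
  have hA := tendstoInMeasure_omegaHatInv (a := 0) (b := 0) hε hι hι' hK hKs hD measurable_zero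
    measurable_zero h (fun n _ => by rwa [localShift_zero, Measure.map_id])
  simp only [localShift_zero, id] at hA
  refine tendsto_measure_lt_wald (fun k => ?_) hA
    (quadForm_mpInverse_pos _ (omegaV_eigenvalues_nonneg hε hK hKs h) hδ) (fun n => ?_) y
  · have := ((symmL4_psi hε hK hKs h k).l1Rate_uStat hD).tendstoInMeasure
    simp only [← deltaHat_apply hKs, kmean_psi hKs h] at this
    rw [tendstoInMeasure_iff_dist] at this ⊢
    simpa [Real.dist_eq] using this
  · have h1 := measurable_deltaHat hK hD.measurable n
    have h2 := measurable_omegaHatInv hK hD.measurable ι n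
    exact (measurable_quadForm h2 h1).aemeasurable

end Limits

end GMDD

theorem mainTheorem1 {Ω : Type*} [MeasurableSpace Ω] (P : Measure Ω) [IsProbabilityMeasure P]
    {p q : ℕ} (ν : Measure (EuclideanSpace ℝ (Fin q))) (hν : GMDD.IsIntegratingMeasure ν)
    (ε : ℝ) (hε : 0 < ε) (ι : ℝ) (hι : 0 < ι) (hι' : ι < 1 / 2)
    (μ : Measure (GMDD.Obs p q)) [IsProbabilityMeasure μ]
    (D : ℕ → Ω → GMDD.Obs p q) (hD : GMDD.IsIIDSample P D μ)
    (hμ : GMDD.MomentCondition (GMDD.kernelK ν) ε μ) :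
    -- (i) the null hypothesis
    (GMDD.NullHypothesis μ →
      (∀ k l, TendstoInMeasure P
        (fun (n : ℕ) ω => GMDD.omegaHatInv (GMDD.kernelK ν) ι n (fun i => D i ω) k l) atTop
        (fun _ => GMDD.mpInverse (GMDD.omegaV_isHermitian (GMDD.kernelK ν) μ) k l)) ∧
      TendstoInDistribution
        (fun (n : ℕ) ω => GMDD.waldStat (GMDD.kernelK ν) ι n (fun i => D i ω)) atTop
        id (fun _ => P) (GMDD.chiSq (GMDD.omegaV (GMDD.kernelK ν) μ).rank)) ∧
    -- (ii) Pitman local alternatives around the null law `μ`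
    (∀ (a : EuclideanSpace ℝ (Fin q) → ℝ) (b : GMDD.Obs p q → EuclideanSpace ℝ (Fin p)),
      Measurable a → Measurable b → GMDD.NullHypothesis μ →
      (∀ n : ℕ, 1 ≤ n →
        GMDD.MomentCondition (GMDD.kernelK ν) ε (μ.map (GMDD.localShift a b n))) →
      Integrable (fun x : GMDD.Obs p q × GMDD.Obs p q =>
        (GMDD.kernelK ν (x.1.Z - x.2.Z) * a x.2.Z) • x.1.V) (μ.prod μ) →
      (∀ k l, TendstoInMeasure P
        (fun (n : ℕ) ω => GMDD.omegaHatInv (GMDD.kernelK ν) ι n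
          (fun i => GMDD.localShift a b n (D i ω)) k l) atTop
        (fun _ => GMDD.mpInverse (GMDD.omegaV_isHermitian (GMDD.kernelK ν) μ) k l)) ∧
      ∀ α : ℝ, 0 < α → α < 1 →
        Tendsto
          (fun n : ℕ => P {ω |
            GMDD.chiSqQuantile (GMDD.omegaV (GMDD.kernelK ν) μ).rank (1 - α) <
              GMDD.waldStat (GMDD.kernelK ν) ι n (fun i => GMDD.localShift a b n (D i ω))})
          atTop
          (𝓝 (GMDD.ncChiSq (GMDD.omegaV (GMDD.kernelK ν) μ).rank
            (GMDD.quadForm (GMDD.mpInverse (GMDD.omegaV_isHermitian (GMDD.kernelK ν) μ))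
              (GMDD.aO (GMDD.kernelK ν) a μ))
            {y | GMDD.chiSqQuantile (GMDD.omegaV (GMDD.kernelK ν) μ).rank (1 - α) < y}))) ∧
    -- (iii) the fixed alternative; the number `r` of degrees of freedom used for the critical
    -- value is arbitrary, in particular it can be the rank of `Ω_V` under a null law
    (∀ a : EuclideanSpace ℝ (Fin q) → ℝ, Measurable a → GMDD.FixedAlternative a μ →
      (∀ k l, TendstoInMeasure P
        (fun (n : ℕ) ω => GMDD.omegaHatInv (GMDD.kernelK ν) ι n (fun i => D i ω) k l) atTop
        (fun _ => GMDD.mpInverse (GMDD.omegaV_isHermitian (GMDD.kernelK ν) μ) k l)) ∧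
      (GMDD.delta (GMDD.kernelK ν) μ ∉
          Module.End.eigenspace (Matrix.toEuclideanLin (GMDD.omegaV (GMDD.kernelK ν) μ)) 0 →
        ∀ (r : ℕ) (α : ℝ), 0 < α → α < 1 →
          Tendsto
            (fun n : ℕ => P {ω | GMDD.chiSqQuantile r (1 - α) <
              GMDD.waldStat (GMDD.kernelK ν) ι n (fun i => D i ω)})
            atTop (𝓝 1))) := by
  have hK := hν.measurable_kernelK
  have hKs : ∀ z, GMDD.kernelK ν (-z) = GMDD.kernelK ν z := GMDD.kernelK_neg
  have hD' : GMDD.IIDSeq P D μ := ⟨hD.measurable, hD.indep, hD.law⟩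
  have hn0 : ∀ n : ℕ, 1 ≤ n → GMDD.MomentCondition (GMDD.kernelK ν) ε (μ.map
      (GMDD.localShift (0 : EuclideanSpace ℝ (Fin q) → ℝ)
        (0 : GMDD.Obs p q → EuclideanSpace ℝ (Fin p)) n)) := fun n _ => by
    rwa [GMDD.localShift_zero, Measure.map_id]
  have hinv := GMDD.tendstoInMeasure_omegaHatInv hε hι hι' hK hKs hD' measurable_zero
    measurable_zero hμ hn0
  simp only [GMDD.localShift_zero, id] at hinv
  refine ⟨fun h0 => ⟨hinv, ?_⟩, fun a b ha hb h0 hn hi => ⟨?_, fun α _ hα => ?_⟩,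
    fun a _ _ => ⟨hinv, fun hδ r α _ _ => ?_⟩⟩
  · have h := GMDD.tendstoInDistribution_waldStat (a := 0) (b := 0) hε hι hι' hK hKs hD'
      measurable_zero measurable_zero h0 hμ hn0 (by simp)
    have hz : GMDD.quadForm (GMDD.mpInverse (GMDD.omegaV_isHermitian (GMDD.kernelK ν) μ))
        (GMDD.aO (GMDD.kernelK ν) 0 μ) = 0 := by
      simp [GMDD.aO, GMDD.quadForm]
    simp only [GMDD.localShift_zero, id, hz, ← GMDD.chiSq_eq_ncChiSq_zero] at h
    exact h
  · exact GMDD.tendstoInMeasure_omegaHatInv hε hι hι' hK hKs hD' ha hb hμ hn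
  · exact GMDD.tendsto_measure_lt_waldStat_local hε hι hι' hK hKs hD' ha hb h0 hμ hn hi
      (by linarith)
  · exact GMDD.tendsto_measure_lt_waldStat_of_delta hε hι hι' hK hKs hD' hμ hδ _
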